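/- For $A\in SL(2,\mathbb Z)$ let $T^2(A)$ be the oriented mapping torus of the induced linear diffeomorphism of $T^2=\mathbb R^2/\mathbb Z^2$, i.e. $T^2\times[0,1]$ with $(x,0)$ identified with $(Ax,1)$, with the orientation induced by the product orientation. Let $$\tau_a=\begin{pmatrix}1&1\\0&1\end{pmatrix},\qquad \tau_b=\begin{pmatrix}1&0\\-1&1\end{pmatrix},\qquad \Phi=\begin{pmatrix}0&1\\-1&0\end{pmatrix}$$ ($\tau_a,\tau_b$ are right-handed Dehn twists). Then $\Phi=\tau_a\tau_b\tau_a$, and there is a compact, oriented, smooth, aspherical $4$-manifold $X$ with Euler characteristic $\chi(X)=0$ whose boundary, with the boundary orientation, is $$\partial X\;\cong\;T^2(\tau_a)\sqcup T^2(\tau_b)\sqcup T^2(\tau_a)\sqcup -T^2(\Phi)$$ (orientation-preserving diffeomorphism), where each boundary component is aspherical and its inclusion into $X$ is injective on $\pi_1$. Moreover, $X$ is the total space of a smooth $T^2$-bundle over the compact disk with three holes (the "three-times punctured disk"), with monodromies $\tau_a,\tau_b,\tau_a$ around the three holes. More precisely, let the holes be arranged in a row, in this order, and join a base point below them to the lowest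 points of the three inner boundary circles and of the outer boundary circle by straight arcs. Then the bundle over the four boundary circles, parametrized clockwise from their lowest points, is identified by the above diffeomorphism with $T^2(\tau_a),T^2(\tau_b),T^2(\tau_a),T^2(\Phi)$ respectively, and the resulting identifications with $T^2$ of the fibers over the four lowest points all come from a single identification of the fiber over the base point with $T^2$ by transport along the four arcs. -/

import Mathlib

open scoped Manifold ContDiff Topology
open Set
noncomputable section

/-- Two points of `F × ℝ` are equivalent when they lie in the same orbit of the transformation
`(x, t) ↦ (φ x, t + 1)`. -/
def mappingTorusSetoid {F : Type*} [TopologicalSpace F] (φ : F ≃ₜ F) : Setoid (F × ℝ) where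
  r a b := ∃ n : ℤ, b = ((φ ^ n) a.1, a.2 + n)
  iseqv :=
    { refl := fun a => ⟨0, by simp⟩
      symm := by
        rintro a b ⟨n, rfl⟩
        refine ⟨-n, ?_⟩
        ext
        · simp [← Homeomorph.mul_apply]
        · simp
      trans := by
        rintro a b c ⟨n, rfl⟩ ⟨m, rfl⟩
        refine ⟨m + n, ?_⟩
        ext
        · simp [zpow_add]
        · push_cast; ring }

/-- The mapping torus `F(φ)`, i.e. `F × [0, 1]` with `(x, 0)` identified with `(φ x, 1)`, presented
as the orbit space of `F × ℝ` under the transformation `(x, t) ↦ (φ x, t + 1)`. -/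
def MappingTorus {F : Type*} [TopologicalSpace F] (φ : F ≃ₜ F) : Type _ :=
  Quotient (mappingTorusSetoid φ)

namespace MappingTorus

section
variable {F : Type*} [TopologicalSpace F] (φ : F ≃ₜ F)

instance : TopologicalSpace (MappingTorus φ) :=
  inferInstanceAs (TopologicalSpace (Quotient (mappingTorusSetoid φ)))

/-- The class `[x, t]` of a point of `F × ℝ`. -/
def mk (a : F × ℝ) : MappingTorus φ := Quotient.mk (mappingTorusSetoid φ) a

/-- The deck transformation `(x, t) ↦ (φⁿ x, t + n)`. -/
def deck (n : ℤ) : F × ℝ ≃ₜ F × ℝ := (φ ^ n).prodCongr (Homeomorph.addRight (n : ℝ))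

theorem deck_apply (n : ℤ) (a : F × ℝ) : deck φ n a = ((φ ^ n) a.1, a.2 + n) := rfl

theorem mk_eq_mk_iff {a b : F × ℝ} : mk φ a = mk φ b ↔ ∃ n : ℤ, b = deck φ n a :=
  Quotient.eq (r := mappingTorusSetoid φ)

theorem continuous_mk : Continuous (mk φ) := continuous_quotient_mk'

theorem mk_surjective : Function.Surjective (mk φ) := Quotient.mk_surjective

theorem isOpenMap_mk : IsOpenMap (mk φ) := by
  intro U hU
  have h : (mk φ) ⁻¹' ((mk φ) '' U) = ⋃ n : ℤ, (deck φ n) ⁻¹' U := by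
    ext a
    simp only [mem_preimage, mem_image, mem_iUnion]
    constructor
    · rintro ⟨b, hb, hab⟩
      obtain ⟨n, rfl⟩ := (mk_eq_mk_iff φ).1 hab.symm
      exact ⟨n, hb⟩
    · rintro ⟨n, hn⟩
      exact ⟨_, hn, ((mk_eq_mk_iff φ).2 ⟨n, rfl⟩).symm⟩
  change IsOpen ((mk φ) ⁻¹' ((mk φ) '' U))
  rw [h]
  exact isOpen_iUnion fun n => hU.preimage (deck φ n).continuous

theorem isLocalHomeomorph_mk : IsLocalHomeomorph (mk φ) := by
  rw [isLocalHomeomorph_iff_isOpenEmbedding_restrict]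
  intro a
  have hU : IsOpen {b : F × ℝ | |b.2 - a.2| < 1 / 2} :=
    isOpen_lt (by fun_prop) continuous_const
  refine ⟨_, hU.mem_nhds (by simp), ?_⟩
  refine .of_continuous_injective_isOpenMap
    ((continuous_mk φ).comp continuous_subtype_val) ?_ ((isOpenMap_mk φ).domRestrict hU)
  rintro ⟨b, hb⟩ ⟨c, hc⟩ hbc
  obtain ⟨n, hn⟩ := (mk_eq_mk_iff φ).1 (show mk φ b = mk φ c from hbc)
  rw [Subtype.mk.injEq, hn]
  have h2 : c.2 = b.2 + n := by rw [hn]; rfl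
  simp only [mem_ofPred_eq, abs_lt] at hb hc
  have h3 : (n : ℝ) < 1 := by linarith
  have h4 : (-1 : ℝ) < n := by linarith
  have h5 : n = 0 := by
    have h3' : n < 1 := by exact_mod_cast h3
    have h4' : -1 < n := by exact_mod_cast h4
    omega
  subst h5
  ext <;> simp [deck_apply]

end

section
variable {F : Type*} [TopologicalSpace F] (φ : F ≃ₜ F)
  {H : Type*} [TopologicalSpace H] [ChartedSpace H F]

/-- The charts of `F(φ)` are the local inverses of `F × ℝ → F(φ)` followed by charts of `F × ℝ`. -/
instance : ChartedSpace (ModelProd H ℝ) (MappingTorus φ) :=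
  (isLocalHomeomorph_mk φ).chartedSpace (mk_surjective φ)

variable {E : Type*} [NormedAddCommGroup E] [NormedSpace ℝ E] (I : ModelWithCorners ℝ E H)

theorem contMDiff_zpow {n : ℕ∞ω} (h : ContMDiff I I n φ) (h' : ContMDiff I I n φ.symm) (m : ℤ) :
    ContMDiff I I n (φ ^ m : F ≃ₜ F) := by
  have key : ∀ (ψ : F ≃ₜ F), ContMDiff I I n ψ → ∀ k : ℕ, ContMDiff I I n (ψ ^ k : F ≃ₜ F) := by
    intro ψ hψ k
    induction k with
    | zero => exact contMDiff_id
    | succ k ih => rw [pow_succ]; exact ih.comp hψ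
  obtain ⟨k, rfl | rfl⟩ := m.eq_nat_or_neg
  · rw [zpow_natCast]; exact key φ h k
  · rw [zpow_neg, zpow_natCast, ← inv_pow]; exact key _ h' k

/-- If `φ` is a diffeomorphism, then these charts make `F(φ)` a smooth manifold. -/
theorem isManifold {n : ℕ∞ω} [IsManifold I n F]
    (h : ContMDiff I I n φ) (h' : ContMDiff I I n φ.symm) :
    IsManifold (I.prod 𝓘(ℝ, ℝ)) n (MappingTorus φ) := by
  apply isManifold_of_contDiffOn
  rintro _ _ ⟨p, rfl⟩ ⟨q, rfl⟩
  set g := (mk_surjective φ).hasRightInverse.choose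
  set L := (isLocalHomeomorph_mk φ).localInverseAt
  set c := chartAt (ModelProd H ℝ) (g p)
  set d := chartAt (ModelProd H ℝ) (g q)
  set J := I.prod 𝓘(ℝ, ℝ)
  rintro y ⟨hy, hyr⟩
  have hy' : J.symm y ∈ (((L (g p)).trans c).symm.trans ((L (g q)).trans d)).source := hy
  simp only [OpenPartialHomeomorph.trans_symm_eq_symm_trans_symm,
    OpenPartialHomeomorph.trans_source, OpenPartialHomeomorph.symm_source, mem_inter_iff,
    mem_preimage, OpenPartialHomeomorph.coe_trans,
    Function.comp_apply] at hy'
  obtain ⟨⟨hc, hLp⟩, hLq, hd⟩ := hy'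
  have hLs : ∀ a b, (L a).symm b = mk φ b := fun a b => by
    have := (isLocalHomeomorph_mk φ).localInverseAt_symm (x := a)
    exact congrFun this b
  rw [hLs] at hLq hd
  set z := c.symm (J.symm y) with hz
  have hw : mk φ (L (g q) (mk φ z)) = mk φ z :=
    (isLocalHomeomorph_mk φ).apply_localInverseAt_of_mem hLq
  obtain ⟨m, hm⟩ := (mk_eq_mk_iff φ).1 hw.symm
  have hwt : deck φ m z ∈ (L (g q)).target := hm ▸ (L (g q)).map_source hLq
  rw [hm] at hd
  have hnear : ∀ᶠ u in 𝓝 z, L (g q) (mk φ u) = deck φ m u := by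
    filter_upwards [(deck φ m).continuous.continuousAt.eventually
      ((L (g q)).open_target.mem_nhds hwt)] with u hu
    have h1 : mk φ u = (L (g q)).symm (deck φ m u) := by
      rw [hLs]
      exact (mk_eq_mk_iff φ).2 ⟨m, rfl⟩
    rw [h1]
    exact (L (g q)).right_inv hu
  have hD : ContMDiff J J n (deck φ m) :=
    (contMDiff_zpow φ I h h' m).prodMap
      (contDiff_id.add contDiff_const : ContDiff ℝ n fun t : ℝ => t + (m : ℝ)).contMDiff
  have hzc : z ∈ c.source := c.map_target hc
  have key := (contMDiffAt_iff_of_mem_maximalAtlas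
    (IsManifold.chart_mem_maximalAtlas (I := J) (n := n) (g p))
    (IsManifold.chart_mem_maximalAtlas (I := J) (n := n) (g q)) hzc hd).1 (hD z)
  have hyz : c.extend J z = y := by
    simp [hz, OpenPartialHomeomorph.extend, c.right_inv hc, J.right_inv hyr]
  have key2 := key.2
  rw [hyz] at key2
  have hcont : ContinuousAt (fun v => c.symm (J.symm v)) y :=
    ContinuousAt.comp (c.continuousAt_symm hc) J.continuous_symm.continuousAt
  have hev : ∀ᶠ v in 𝓝 y, L (g q) (mk φ (c.symm (J.symm v))) = deck φ m (c.symm (J.symm v)) :=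
    hcont.eventually hnear
  refine (key2.mono inter_subset_right).congr_of_eventuallyEq
    (mem_nhdsWithin_of_mem_nhds ?_) ?_
  · filter_upwards [hev] with v hv
    change J (d (L (g q) ((L (g p)).symm (c.symm (J.symm v))))) =
      J (d (deck φ m (c.symm (J.symm v))))
    rw [hLs, hv]
  · have := hev.self_of_nhds
    change J (d (L (g q) ((L (g p)).symm (c.symm (J.symm y))))) =
      J (d (deck φ m (c.symm (J.symm y))))
    rw [hLs, this]
end
end MappingTorus

/-! ### The torus and its linear diffeomorphisms -/

/-- The 2-torus. -/
abbrev Torus : Type := Circle × Circle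

/-- The model with corners of the 2-torus. -/
abbrev torusModel := (𝓡 1).prod (𝓡 1)

/-- The linear self-map of the torus given by an integer matrix: `(z, w) ↦ (zᵃ wᵇ, zᶜ wᵈ)`,
which is induced by `x ↦ A x` on `ℝ² / ℤ²`. -/
def linearTorusMap (A : Matrix (Fin 2) (Fin 2) ℤ) (x : Torus) : Torus :=
  (x.1 ^ A 0 0 * x.2 ^ A 0 1, x.1 ^ A 1 0 * x.2 ^ A 1 1)

theorem linearTorusMap_mul (A B : Matrix (Fin 2) (Fin 2) ℤ) (x : Torus) :
    linearTorusMap A (linearTorusMap B x) = linearTorusMap (A * B) x := by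
  ext1 <;>
  · simp only [linearTorusMap, Matrix.mul_apply, Fin.sum_univ_two, mul_zpow, ← zpow_mul, zpow_add]
    rw [mul_mul_mul_comm]
    simp only [mul_comm (A _ _)]

theorem linearTorusMap_one (x : Torus) : linearTorusMap 1 x = x := by
  simp [linearTorusMap]

theorem contMDiff_linearTorusMap (A : Matrix (Fin 2) (Fin 2) ℤ) :
    ContMDiff torusModel torusModel ∞ (linearTorusMap A) := by
  have hz : ∀ n : ℤ, ContMDiff (𝓡 1) (𝓡 1) ∞ fun z : Circle => z ^ n := by
    intro n
    obtain ⟨k, rfl | rfl⟩ := n.eq_nat_or_neg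
    · simpa using contMDiff_pow k
    · simpa using (contMDiff_pow k).inv
  exact (((hz _).comp contMDiff_fst).mul ((hz _).comp contMDiff_snd)).prodMk
    (((hz _).comp contMDiff_fst).mul ((hz _).comp contMDiff_snd))

/-- The linear diffeomorphism of the torus given by a matrix in `SL(2, ℤ)`. -/
def torusHomeo (A : Matrix.SpecialLinearGroup (Fin 2) ℤ) : Torus ≃ₜ Torus where
  toFun := linearTorusMap A.1
  invFun := linearTorusMap A⁻¹.1
  left_inv x := by
    have h : A⁻¹.1 * A.1 = 1 := by
      rw [← Matrix.SpecialLinearGroup.coe_mul, inv_mul_cancel, Matrix.SpecialLinearGroup.coe_one]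
    rw [linearTorusMap_mul, h, linearTorusMap_one]
  right_inv x := by
    have h : A.1 * A⁻¹.1 = 1 := by
      rw [← Matrix.SpecialLinearGroup.coe_mul, mul_inv_cancel, Matrix.SpecialLinearGroup.coe_one]
    rw [linearTorusMap_mul, h, linearTorusMap_one]
  continuous_toFun := (contMDiff_linearTorusMap _).continuous
  continuous_invFun := (contMDiff_linearTorusMap _).continuous

/-- The torus bundle `T²(A)` over the circle. -/
abbrev TorusBundle (A : Matrix.SpecialLinearGroup (Fin 2) ℤ) : Type :=
  MappingTorus (torusHomeo A)

/-- The model with corners of the 3-manifold `T²(A)`. -/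
abbrev torusBundleModel := torusModel.prod 𝓘(ℝ, ℝ)

instance (A : Matrix.SpecialLinearGroup (Fin 2) ℤ) :
    IsManifold torusBundleModel ∞ (TorusBundle A) :=
  MappingTorus.isManifold _ _ (contMDiff_linearTorusMap A.1) (contMDiff_linearTorusMap A⁻¹.1)

/-- The right-handed Dehn twist `τ_a` of the torus. -/
def twistA : Matrix.SpecialLinearGroup (Fin 2) ℤ := ⟨!![1, 1; 0, 1], by simp⟩

/-- The right-handed Dehn twist `τ_b` of the torus. -/
def twistB : Matrix.SpecialLinearGroup (Fin 2) ℤ := ⟨!![1, 0; -1, 1], by simp⟩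

/-- The matrix `Φ`. -/
def matrixPhi : Matrix.SpecialLinearGroup (Fin 2) ℤ := ⟨!![0, 1; -1, 0], by simp⟩

/-- The monodromies of the four boundary components of the splitter. -/
def splitterMonodromy : Fin 4 → Matrix.SpecialLinearGroup (Fin 2) ℤ :=
  ![twistA, twistB, twistA, matrixPhi]

/-! ### Asphericity and Euler characteristic -/

/-- A space is aspherical if it is path connected and its higher homotopy groups vanish. -/
def IsAspherical (X : Type*) [TopologicalSpace X] : Prop :=
  PathConnectedSpace X ∧ ∀ n : ℕ, 2 ≤ n → ∀ x : X, Subsingleton (HomotopyGroup.Pi n X x)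

/-- A continuous map is `π₁`-injective if it is injective on fundamental groups at all
base points. -/
def IsPiOneInjective {Y X : Type*} [TopologicalSpace Y] [TopologicalSpace X] (f : C(Y, X)) : Prop :=
  ∀ y : Y, Function.Injective (FundamentalGroup.map f y)

/-- The singular chain complex of a space with rational coefficients. -/
def rationalSingularChains (X : Type) [TopologicalSpace X] : ChainComplex (ModuleCat.{0} ℚ) ℕ :=
  ((AlgebraicTopology.singularChainComplexFunctor (ModuleCat.{0} ℚ)).obj (ModuleCat.of ℚ ℚ)).obj
    (TopCat.of X)

/-- The rational singular homology of `X` is finite dimensional, and the alternating sum of the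
Betti numbers is `k`. -/
structure HasEulerCharacteristic (X : Type) [TopologicalSpace X] (k : ℤ) : Prop where
  finite : ∀ i, Module.Finite ℚ ((rationalSingularChains X).homology i)
  bounded : ∃ N, ∀ i, N < i → Subsingleton ((rationalSingularChains X).homology i)
  eulerChar_eq : (rationalSingularChains X).homologyEulerChar = k

/-! ### Orientations -/

/-- An orientation of a smooth `n`-manifold (possibly with boundary): orientations of all tangent
spaces which are locally constant in the local trivializations of the tangent bundle. -/
structure ManifoldOrientation {n : ℕ} {H : Type*} [TopologicalSpace H]
    (I : ModelWithCorners ℝ (EuclideanSpace ℝ (Fin n)) H)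
    (M : Type*) [TopologicalSpace M] [ChartedSpace H M] [IsManifold I 1 M] where
  /-- The orientation of the tangent space at each point. -/
  orient : ∀ x : M, Orientation ℝ (TangentSpace I x) (Fin n)
  locallyConstant : ∀ x₀ : M, ∃ ρ : Orientation ℝ (EuclideanSpace ℝ (Fin n)) (Fin n),
    ∀ᶠ x in 𝓝 x₀, ∀ hx : x ∈ (trivializationAt (EuclideanSpace ℝ (Fin n))
        (TangentSpace I : M → Type _) x₀).baseSet,
      Orientation.map (Fin n)
        ((trivializationAt (EuclideanSpace ℝ (Fin n)) (TangentSpace I : M → Type _)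
          x₀).continuousLinearEquivAt ℝ x hx).toLinearEquiv (orient x) = ρ

section Boundary
variable {X : Type} [TopologicalSpace X] [ChartedSpace (EuclideanHalfSpace 4) X]

/-- A tangent vector `v` at a boundary point `x` points outward if, in a chart with values in the
half space `{y | 0 ≤ y 0}`, its coordinate `0` is negative. -/
def IsOutward (x : X) (v : TangentSpace (𝓡∂ 4) x) : Prop :=
  let w : EuclideanSpace ℝ (Fin 4) :=
    mfderiv (𝓡∂ 4) 𝓘(ℝ, EuclideanSpace ℝ (Fin 4)) (extChartAt (𝓡∂ 4) x) x v
  w 0 < 0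

/-- The covering `ℝ³ → T²(A)`, `(a, b, t) ↦ [(exp (2πia), exp (2πib)), t]`. The orientation of
`T²(A)` is the one which makes it an orientation preserving local diffeomorphism; it is induced by
the product orientation of `T² × ℝ`. -/
def unroll (A : Matrix.SpecialLinearGroup (Fin 2) ℤ) (a : EuclideanSpace ℝ (Fin 3)) :
    TorusBundle A :=
  MappingTorus.mk _ ((Circle.exp (2 * Real.pi * a 0), Circle.exp (2 * Real.pi * a 1)), a 2)

/-- With respect to the orientations `σ x` of the tangent spaces of `X`, the map `f` from `T²(A)` to
the boundary of `X` preserves orientations, where the boundary is oriented by the convention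
"outward normal first". -/
def PreservesBoundaryOrientation {A : Matrix.SpecialLinearGroup (Fin 2) ℤ}
    (σ : ∀ x : X, Orientation ℝ (TangentSpace (𝓡∂ 4) x) (Fin 4)) (f : TorusBundle A → X) : Prop :=
  ∀ (a : EuclideanSpace ℝ (Fin 3)) (v : TangentSpace (𝓡∂ 4) (f (unroll A a))), IsOutward _ v →
    ∃ e : Module.Basis (Fin 4) ℝ (TangentSpace (𝓡∂ 4) (f (unroll A a))),
      e 0 = v ∧
      (∀ i : Fin 3, e i.succ =
        mfderiv (𝓡 3) (𝓡∂ 4) (f ∘ unroll A) a (EuclideanSpace.single i (1 : ℝ))) ∧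
      e.orientation = σ (f (unroll A a))

/-- The maps `f i` are smooth embeddings with disjoint images, and these images together form the
boundary of `X`, i.e. they form a diffeomorphism of the disjoint union of the `T²(m i)` onto `∂X`. -/
structure ParametrizesBoundary {ι : Type} {m : ι → Matrix.SpecialLinearGroup (Fin 2) ℤ}
    (f : ∀ i, C(TorusBundle (m i), X)) : Prop where
  smooth : ∀ i, ContMDiff torusBundleModel (𝓡∂ 4) ∞ (f i)
  embedding : ∀ i, Topology.IsEmbedding (f i)
  immersion : ∀ i y, Function.Injective (mfderiv torusBundleModel (𝓡∂ 4) (f i) y)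
  disjoint : Pairwise fun i j => Disjoint (range (f i)) (range (f j))
  range_eq : ⋃ i, range (f i) = (𝓡∂ 4).boundary X

/-! ### Torus bundles over the disk with three holes -/

/-- `p` is a smooth fiber bundle over `B ⊆ ℂ` with fiber the torus: it is smooth and over a
neighborhood of each point of `B` there is a smooth trivialization `x ↦ (p x, r x)` with smooth
inverse `s`. -/
structure IsSmoothTorusFibration (p : X → ℂ) (B : Set ℂ) : Prop where
  smooth : ContMDiff (𝓡∂ 4) 𝓘(ℝ, ℂ) ∞ p
  mem_base : ∀ x, p x ∈ B
  locallyTrivial : ∀ b ∈ B, ∃ U : Set ℂ, IsOpen U ∧ b ∈ U ∧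
    ∃ (r : X → Torus) (s : ℂ × Torus → X),
      ContMDiffOn (𝓡∂ 4) torusModel ∞ r (p ⁻¹' U) ∧
      ContMDiffOn (𝓘(ℝ, ℂ).prod torusModel) (𝓡∂ 4) ∞ s ((U ∩ B) ×ˢ univ) ∧
      (∀ x, p x ∈ U → s (p x, r x) = x) ∧
      ∀ z ∈ U ∩ B, ∀ w : Torus, p (s (z, w)) = z ∧ r (s (z, w)) = w

end Boundary

/-- The centers of the four boundary circles of the disk with three holes; the last one is the
outer circle. -/
def circleCenter : Fin 4 → ℂ := ![-2, 0, 2, 0]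

/-- The radii of the four boundary circles of the disk with three holes. -/
def circleRadius : Fin 4 → ℝ := ![1 / 2, 1 / 2, 1 / 2, 4]

/-- The compact disk with three holes ("three-times punctured disk"). -/
def threeHoledDisk : Set ℂ :=
  {z | ‖z‖ ≤ 4 ∧ ∀ i : Fin 3, 1 / 2 ≤ ‖z - circleCenter i.castSucc‖}

/-- The `i`-th boundary circle, parametrized clockwise with period `1`, starting at its lowest
point. For the three inner circles this is the direction of the boundary orientation; for the
outer circle it is the opposite one. -/
def boundaryLoop (i : Fin 4) (t : ℝ) : ℂ :=
  circleCenter i - circleRadius i * Complex.I * Complex.exp (-(2 * Real.pi * t * Complex.I))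

/-- The straight arc from the base point `-3i` to the starting point of the `i`-th boundary
circle. -/
def boundaryArc (i : Fin 4) (s : ℝ) : ℂ :=
  (1 - s) * (-3 * Complex.I) + s * boundaryLoop i 0

/-- The bundle `p` over the disk with three holes has monodromies `m i`: over the `i`-th boundary
circle the map `f i` identifies it with `T²(m i)`, and the identifications of the fibers over the
starting points of the four circles with the torus arise from one identification `θ` of the fiber
over the base point by transport along the four arcs. -/
structure HasMonodromies {X : Type} [TopologicalSpace X] (p : X → ℂ)
    {m : Fin 4 → Matrix.SpecialLinearGroup (Fin 2) ℤ}
    (f : ∀ i, C(TorusBundle (m i), X)) : Prop where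
  covers : ∀ i (w : Torus) (t : ℝ), p (f i (MappingTorus.mk _ (w, t))) = boundaryLoop i t
  transport : ∃ θ : Torus → X, ∀ i, ∃ h : C(unitInterval × Torus, X),
    (∀ s : unitInterval, BijOn (fun w => h (s, w)) univ (p ⁻¹' {boundaryArc i s})) ∧
    ∀ w : Torus, h (0, w) = θ w ∧ h (1, w) = f i (MappingTorus.mk _ (w, 0))

end

/-!
The manifold is built as a flat torus bundle over the disk with three holes. The real axis meets
this disk in four segments, which cut it into two half disks. Let the free group `Free3` on three
generators be its fundamental group, a path picking up the element `crossing k` whenever it crosses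
the `k`-th segment upwards. A homomorphism `ρ` from `Free3` to the homeomorphisms of a space `F`
defines the bundle `FlatBundle ρ` with fiber `F`, glued from one trivialization over each of the
four sets `sheet k`. The boundary circle `i` crosses one segment upwards and another one
downwards, so that its class `peripheral i` is a product of two of the elements `crossing k`, and
the four classes together can be given the monodromies `τ_a`, `τ_b`, `τ_a`, `Φ` because
`Φ = τ_a τ_b τ_a` (`splitterMatrix_peripheral`). The resulting bundle is `Splitter`. Horizontal
lifts of the boundary circles identify its boundary with the four mapping tori (`loopMap`,
`boundaryMap`), and below the real axis the bundle is trivial, which gives the transport along the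
four arcs.

The flat bundle `DiskCover` whose fiber is the free group itself is the universal cover of the base.
It is a tree of half disks, glued along segments. A half disk retracts onto each of its segments,
so the tree is contracted by retracting the half disks one after the other towards a root, those of
high rank first (`TileTree.continuous_move`). The product of `DiskCover` and `F` covers
`FlatBundle ρ`, and for the torus it is in turn covered by a contractible space. Spaces with a
contractible covering are aspherical (`HasUniqueLifting.isAspherical`). The inclusion of a boundary
component lifts to an injective map of contractible coverings, because `peripheral i` has infinite
order, and hence is injective on fundamental groups (`HasUniqueLifting.isPiOneInjective`).

For the Euler characteristic, let a free group with basis `J` act on `E` with quotient covering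
`E → Y`. The singular chains form a short exact sequence `C(J × E) → C(E) → C(Y)`, whose first map
sends `(j, s)` to `j • s - s`; it is split in each degree by Fox derivatives. Thus
`χ(Y) = χ(E) - χ(J × E)` (`IsQuotientCoveringMap.hasEulerCharacteristic`). With `E = P × ℝ` this
gives `χ(P × S¹) = 0`, and with `E = DiskCover × T²` it gives `χ(FlatBundle ρ) = 0`.

The charts of the splitter are products of angular coordinates on the torus with holomorphic
coordinates on the base, which near a boundary circle are logarithmic polar coordinates
(`collarMap`). Coordinate changes are products of holomorphic maps and affine maps with linear part
in `SL(2, ℤ)`, so they are smooth and orientation preserving (`exists_transition`). In such charts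
the parametrizations of the boundary components are affine; their linear part is computed in
`exists_mfderiv_boundaryMap_unroll`, and the induced boundary orientation is read off from a
determinant, whose sign is opposite at the outer circle.
-/

noncomputable section

/-! ### Chains on a free quotient by a free group -/

section FreeGroupCrossedHom

variable {J : Type*} {M : Type*} [AddCommGroup M]

/-- On a free group, a function `D` with `D 1 = 0` may be prescribed by its increments under left
multiplication by generators. With `M = ℤ[J × F]` this is the Fox derivative. -/
theorem FreeGroup.exists_of_increments (φ : J → FreeGroup J → M) :
    ∃ D : FreeGroup J → M, D 1 = 0 ∧
      ∀ j h, D (FreeGroup.of j * h) = D h + φ j h := by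
  let step (j : J) : Equiv.Perm (FreeGroup J × M) :=
    { toFun := fun x => (FreeGroup.of j * x.1, x.2 + φ j x.1)
      invFun := fun x => ((FreeGroup.of j)⁻¹ * x.1, x.2 - φ j ((FreeGroup.of j)⁻¹ * x.1))
      left_inv := fun x => by simp
      right_inv := fun x => by simp }
  let L : FreeGroup J →* Equiv.Perm (FreeGroup J × M) := FreeGroup.lift step
  have hL : ∀ j x, L (FreeGroup.of j) x = (FreeGroup.of j * x.1, x.2 + φ j x.1) := fun j x => by
    simp [L, step]
  have fst_L : ∀ g : FreeGroup J, ∀ x, (L g x).1 = g * x.1 := by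
    intro g
    induction g using FreeGroup.induction_on with
    | C1 => simp
    | of j => intro x; rw [hL]
    | inv_of j _ => intro x; simp [L, step]
    | mul a b ha hb => intro x; rw [_root_.map_mul, Equiv.Perm.mul_apply, ha, hb, mul_assoc]
  refine ⟨fun g => (L g (1, 0)).2, by simp, fun j h => ?_⟩
  dsimp only
  rw [_root_.map_mul, Equiv.Perm.mul_apply, hL, fst_L, mul_one]

/-- A function on a free group is determined by its value at `1` and its increments. -/
theorem FreeGroup.eq_of_increments {D D' : FreeGroup J → M} (h1 : D 1 = D' 1)
    (h : ∀ j g, D (FreeGroup.of j * g) - D g = D' (FreeGroup.of j * g) - D' g) (g : FreeGroup J) :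
    D g = D' g := by
  have key : ∀ g k : FreeGroup J, D k = D' k → D (g * k) = D' (g * k) := by
    intro g
    induction g using FreeGroup.induction_on with
    | C1 => simp
    | of j => intro k hk; have := h j k; rw [hk] at this; exact sub_left_injective this
    | inv_of j _ =>
      intro k hk
      have := h j ((FreeGroup.of j)⁻¹ * k)
      rw [mul_inv_cancel_left, hk] at this
      exact sub_right_injective this
    | mul a b ha hb => intro k hk; rw [mul_assoc]; exact ha _ (hb _ hk)
  simpa using key g 1 h1

end FreeGroupCrossedHom

section ChainModules
open CategoryTheory Limits Simplicial

/-- If a free group with basis `J` acts freely on the `n`-simplices of `S` with quotient the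
`n`-simplices of `O`, then `0 → ℤ[J × Sₙ] → ℤ[Sₙ] → ℤ[Oₙ] → 0` is split exact, where the first map
sends `(j, s)` to `j • s - s`. The retraction is given by the Fox derivatives. -/
theorem SSet.nonempty_splitting_of_free_action {C : Type*} [Category* C] [Preadditive C]
    [HasCoproducts.{0} C] (R : C) {T S O : SSet.{0}} (a b : T ⟶ S) (p : S ⟶ O) (n : ℕ)
    {J : Type*} [MulAction (FreeGroup J) (S _⦋n⦌)] (i : J → S _⦋n⦌ → T _⦋n⦌)
    (hi : ∀ t, ∃ j s, i j s = t) (ha : ∀ j s, a.app _ (i j s) = FreeGroup.of j • s)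
    (hb : ∀ j s, b.app _ (i j s) = s) (hp : Function.Surjective (p.app (.op ⦋n⦌)))
    (horb : ∀ s s' : S _⦋n⦌, p.app _ s = p.app _ s' ↔ s ∈ MulAction.orbit (FreeGroup J) s')
    (hfree : ∀ (g : FreeGroup J) (s : S _⦋n⦌), g • s = s → g = 1)
    (w : (SSet.chainComplexMap a R - SSet.chainComplexMap b R).f n ≫
      (SSet.chainComplexMap p R).f n = 0) :
    Nonempty (ShortComplex.mk _ _ w).Splitting := by
  choose rep hrep using hp
  have hg : ∀ s, ∃ g : FreeGroup J, g • rep (p.app _ s) = s := fun s => by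
    have := (horb s (rep (p.app _ s))).1 (hrep _).symm
    exact this
  choose c hc using hg
  have hcu : ∀ (g : FreeGroup J) (o : O _⦋n⦌), c (g • rep o) = g := by
    intro g o
    have h1 : p.app _ (g • rep o) = o := by
      rw [← hrep o, horb, hrep]; exact ⟨g, rfl⟩
    have h2 := hc (g • rep o)
    rw [h1] at h2
    have h3 := hfree (g⁻¹ * c (g • rep o)) (rep o) (by rw [mul_smul, h2, inv_smul_smul])
    exact (inv_mul_eq_one.1 h3).symm
  have hpg : ∀ (g : FreeGroup J) (s), p.app _ (g • s) = p.app _ s := fun g s =>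
    (horb _ _).2 ⟨g, rfl⟩
  choose D hD1 hD using fun o : O _⦋n⦌ => FreeGroup.exists_of_increments
    (fun j h => T.ιChainComplex (R := R) (i j (h • rep o)))
  let r : (S.chainComplex R).X n ⟶ (T.chainComplex R).X n :=
    Cofan.IsColimit.desc (S.isColimitChainComplexXCofan R n)
      (fun s => D (p.app _ s) (c s))
  let sec : (O.chainComplex R).X n ⟶ (S.chainComplex R).X n :=
    Cofan.IsColimit.desc (O.isColimitChainComplexXCofan R n)
      (fun o => S.ιChainComplex (rep o))
  have hr : ∀ s, S.ιChainComplex s ≫ r = D (p.app _ s) (c s) := fun s =>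
    Cofan.IsColimit.fac (S.isColimitChainComplexXCofan R n) _ s
  have hsec : ∀ o, O.ιChainComplex o ≫ sec = S.ιChainComplex (rep o) := fun o =>
    Cofan.IsColimit.fac (O.isColimitChainComplexXCofan R n) _ o
  have hf : ∀ j s, T.ιChainComplex (i j s) ≫
      (SSet.chainComplexMap a R - SSet.chainComplexMap b R).f n =
      S.ιChainComplex (FreeGroup.of j • s) - S.ιChainComplex s := fun j s => by
    rw [HomologicalComplex.sub_f_apply, Preadditive.comp_sub, SSet.ι_chainComplexMap_f,
      SSet.ι_chainComplexMap_f, ha, hb]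
  refine ⟨⟨r, sec, ?_, ?_, ?_⟩⟩
  · refine SSet.chainComplex_hom_ext fun t => ?_
    obtain ⟨j, s, rfl⟩ := hi t
    dsimp only
    rw [← Category.assoc, hf, Preadditive.sub_comp, hr, hr, hpg, Category.comp_id]
    have h1 : c (FreeGroup.of j • s) = FreeGroup.of j * c s := by
      conv_lhs => rw [← hc s, ← mul_smul]
      exact hcu _ _
    rw [h1, hD, add_sub_cancel_left, hc]
  · refine SSet.chainComplex_hom_ext fun o => ?_
    dsimp only
    rw [← Category.assoc, hsec, SSet.ι_chainComplexMap_f, hrep, Category.comp_id]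
  · refine SSet.chainComplex_hom_ext fun s => ?_
    dsimp only
    rw [Preadditive.comp_add, ← Category.assoc, hr, ← Category.assoc, SSet.ι_chainComplexMap_f,
      hsec, Category.comp_id]
    have key := FreeGroup.eq_of_increments
      (D := fun g => D (p.app _ s) g ≫
        (SSet.chainComplexMap a R - SSet.chainComplexMap b R).f n)
      (D' := fun g => S.ιChainComplex (R := R) (g • rep (p.app _ s)) -
        S.ιChainComplex (rep (p.app _ s))) (by simp [hD1])
      (fun j g => by
        rw [hD, Preadditive.add_comp, add_sub_cancel_left, hf, ← mul_smul]
        abel) (c s)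
    dsimp only at key
    rw [key, hc, sub_add_cancel]

end ChainModules

section EulerCharacteristic
open CategoryTheory Limits Simplicial

/-! ### Euler characteristics of free quotients -/

section Singular
variable {X Y : Type} [TopologicalSpace X] [TopologicalSpace Y]

/-- The singular simplicial set of a space. -/
abbrev singularSet (X : Type) [TopologicalSpace X] : SSet.{0} := TopCat.toSSet.obj (TopCat.of X)

/-- The map of singular simplicial sets induced by a continuous map. -/
abbrev singularMap (f : C(X, Y)) : singularSet X ⟶ singularSet Y :=
  TopCat.toSSet.map (TopCat.ofHom f)

/-- A singular simplex, as a continuous map on the standard simplex. -/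
abbrev simplexEquiv (X : Type) [TopologicalSpace X] (n : ℕ) :
    singularSet X _⦋n⦌ ≃ C(stdSimplex ℝ (Fin (n + 1)), X) :=
  TopCat.toSSetObjEquiv (TopCat.of X) (.op ⦋n⦌)

theorem simplexEquiv_singularMap (f : C(X, Y)) (n : ℕ) (s : singularSet X _⦋n⦌) :
    simplexEquiv Y n ((singularMap f).app _ s) = f.comp (simplexEquiv X n s) := rfl

theorem singularMap_app_symm (f : C(X, Y)) (n : ℕ) (s : C(stdSimplex ℝ (Fin (n + 1)), X)) :
    (singularMap f).app _ ((simplexEquiv X n).symm s) = (simplexEquiv Y n).symm (f.comp s) := by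
  apply (simplexEquiv Y n).injective
  rw [simplexEquiv_singularMap, Equiv.apply_symm_apply, Equiv.apply_symm_apply]

instance (n : ℕ) : ContractibleSpace (stdSimplex ℝ (Fin (n + 1))) :=
  (convex_stdSimplex ℝ (Fin (n + 1))).contractibleSpace ⟨_, (stdSimplex.vertex 0).2⟩

instance (n : ℕ) : LocallyPathConnectedSpace (stdSimplex ℝ (Fin (n + 1))) :=
  (convex_stdSimplex ℝ (Fin (n + 1))).locallyPathConnectedSpace

end Singular

section Rank
open Module

/-- Dimension count in an exact sequence `V₁ → V₂ → V₃ → W₁ → W₂`. -/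
theorem finrank_of_exact {V₁ V₂ V₃ W₁ W₂ : Type*} [AddCommGroup V₁] [AddCommGroup V₂]
    [AddCommGroup V₃] [AddCommGroup W₁] [AddCommGroup W₂] [Module ℚ V₁] [Module ℚ V₂] [Module ℚ V₃]
    [Module ℚ W₁] [Module ℚ W₂] [Module.Finite ℚ V₁] [Module.Finite ℚ V₂] [Module.Finite ℚ W₁]
    (α : V₁ →ₗ[ℚ] V₂) (β : V₂ →ₗ[ℚ] V₃) (δ : V₃ →ₗ[ℚ] W₁) (α' : W₁ →ₗ[ℚ] W₂)
    (h₁ : Function.Exact α β) (h₂ : Function.Exact β δ) (h₃ : Function.Exact δ α') :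
    Module.Finite ℚ V₃ ∧
      (finrank ℚ V₃ : ℤ) = finrank ℚ V₂ - finrank ℚ (LinearMap.range α) + finrank ℚ W₁ -
        finrank ℚ (LinearMap.range α') := by
  have hfin : Module.Finite ℚ V₃ := by
    have e := δ.quotKerEquivRange
    have h : Module.Finite ℚ (V₃ ⧸ LinearMap.ker δ) := Module.Finite.equiv e.symm
    have h' : Module.Finite ℚ (LinearMap.ker δ) := by
      rw [h₂.linearMap_ker_eq]; infer_instance
    exact Module.Finite.of_submodule_quotient (LinearMap.ker δ)
  refine ⟨hfin, ?_⟩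
  have e1 := δ.finrank_range_add_finrank_ker
  have e2 := β.finrank_range_add_finrank_ker
  have e3 := α'.finrank_range_add_finrank_ker
  rw [h₂.linearMap_ker_eq] at e1
  rw [h₁.linearMap_ker_eq] at e2
  rw [h₃.linearMap_ker_eq] at e3
  omega

end Rank

/-- The Euler characteristic is additive on short exact sequences of complexes. -/
theorem ChainComplex.homologyEulerChar_of_shortExact
    {S : ShortComplex (ChainComplex (ModuleCat.{0} ℚ) ℕ)} (hS : S.ShortExact)
    (f₁ : ∀ i, Module.Finite ℚ (S.X₁.homology i)) (f₂ : ∀ i, Module.Finite ℚ (S.X₂.homology i))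
    (b₁ : ∃ N, ∀ i, N < i → Subsingleton (S.X₁.homology i))
    (b₂ : ∃ N, ∀ i, N < i → Subsingleton (S.X₂.homology i)) :
    (∀ i, Module.Finite ℚ (S.X₃.homology i)) ∧
    (∃ N, ∀ i, N < i → Subsingleton (S.X₃.homology i)) ∧
    S.X₃.homologyEulerChar = S.X₂.homologyEulerChar - S.X₁.homologyEulerChar := by
  let α (i : ℕ) := (HomologicalComplex.homologyMap S.f i).hom
  have ex₂ : ∀ i, Function.Exact (α i) (HomologicalComplex.homologyMap S.g i).hom := fun i =>
    (ShortComplex.ShortExact.moduleCat_exact_iff_function_exact _).1 (hS.homology_exact₂ i)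
  have step : ∀ i, Module.Finite ℚ (S.X₃.homology (i + 1)) ∧
      (Module.finrank ℚ (S.X₃.homology (i + 1)) : ℤ) = Module.finrank ℚ (S.X₂.homology (i + 1)) -
        Module.finrank ℚ (LinearMap.range (α (i + 1))) + Module.finrank ℚ (S.X₁.homology i) -
        Module.finrank ℚ (LinearMap.range (α i)) := fun i =>
    finrank_of_exact _ _ (hS.δ (i + 1) i (by simp)).hom _ (ex₂ (i + 1))
      ((ShortComplex.ShortExact.moduleCat_exact_iff_function_exact _).1
        (hS.homology_exact₃ (i + 1) i (by simp)))
      ((ShortComplex.ShortExact.moduleCat_exact_iff_function_exact _).1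
        (hS.homology_exact₁ (i + 1) i (by simp)))
  have step0 : Module.Finite ℚ (S.X₃.homology 0) ∧
      (Module.finrank ℚ (S.X₃.homology 0) : ℤ) = Module.finrank ℚ (S.X₂.homology 0) -
        Module.finrank ℚ (LinearMap.range (α 0)) := by
    have hepi : Epi (HomologicalComplex.homologyMap S.g 0) := by
      have := hS.epi_g
      exact HomologicalComplex.epi_homologyMap_of_epi_of_not_rel S.g 0 (by simp)
    have hsurj := (ModuleCat.epi_iff_surjective _).1 hepi
    have := finrank_of_exact (W₁ := (Fin 0 → ℚ)) (W₂ := ℚ) (α 0)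
      (HomologicalComplex.homologyMap S.g 0).hom 0 0 (ex₂ 0)
      (fun x => ⟨fun _ => hsurj x, fun _ => rfl⟩)
      (fun x => ⟨fun _ => ⟨0, Subsingleton.elim _ _⟩, fun _ => rfl⟩)
    have h0 : Module.finrank ℚ (LinearMap.range (0 : (Fin 0 → ℚ) →ₗ[ℚ] ℚ)) = 0 := by
      rw [LinearMap.range_zero, finrank_bot]
    refine ⟨this.1, ?_⟩
    have h := this.2
    rw [h0, Module.finrank_fin_fun] at h
    simpa using h
  obtain ⟨N₁, hN₁⟩ := b₁
  obtain ⟨N₂, hN₂⟩ := b₂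
  have hfin : ∀ i, Module.Finite ℚ (S.X₃.homology i) := fun i => by
    cases i with
    | zero => exact step0.1
    | succ i => exact (step i).1
  have hz₁ : ∀ i, N₁ < i → Module.finrank ℚ (S.X₁.homology i) = 0 := fun i hi => by
    have := hN₁ i hi
    exact Module.finrank_zero_of_subsingleton
  have hz₂ : ∀ i, N₂ < i → Module.finrank ℚ (S.X₂.homology i) = 0 := fun i hi => by
    have := hN₂ i hi
    exact Module.finrank_zero_of_subsingleton
  have hzα : ∀ i, N₁ < i → Module.finrank ℚ (LinearMap.range (α i)) = 0 := fun i hi => by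
    have h := LinearMap.finrank_range_le (α i)
    rw [hz₁ i hi] at h
    omega
  set N := N₁ + N₂ + 1
  have hz₃ : ∀ i, N < i → Module.finrank ℚ (S.X₃.homology i) = 0 := by
    intro i hi
    obtain ⟨i, rfl⟩ : ∃ j, i = j + 1 := ⟨i - 1, by omega⟩
    have := (step i).2
    rw [hz₁ i (by omega), hz₂ _ (by omega), hzα _ (by omega), hzα _ (by omega)] at this
    omega
  refine ⟨hfin, ⟨N, fun i hi => ?_⟩, ?_⟩
  · exact Module.finrank_zero_iff.1 (hz₃ i hi)
  · have hsum : ∀ K : ChainComplex (ModuleCat.{0} ℚ) ℕ,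
        (∀ i, N < i → Module.finrank ℚ (K.homology i) = 0) →
        K.homologyEulerChar =
          ∑ i ∈ Finset.range (N + 1), (-1) ^ i * (Module.finrank ℚ (K.homology i) : ℤ) := by
      intro K hK
      rw [HomologicalComplex.homologyEulerChar_eq_sum_finSet_of_finrankSupport_subset K
        (Finset.range (N + 1))]
      · simp
      · rw [GradedObject.finrankSupport_subset_iff]
        intro i hi
        exact hK i (by simpa using hi)
    rw [hsum _ hz₃, hsum _ (fun i hi => hz₂ i (by omega)), hsum _ (fun i hi => hz₁ i (by omega))]
    -- The ranks of the maps `α i` cancel in pairs.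
    have key : ∀ m, ∑ i ∈ Finset.range (m + 1), (-1) ^ i *
          (Module.finrank ℚ (S.X₃.homology i) : ℤ) =
        ∑ i ∈ Finset.range (m + 1), (-1) ^ i * (Module.finrank ℚ (S.X₂.homology i) : ℤ) -
        ∑ i ∈ Finset.range (m + 1), (-1) ^ i * (Module.finrank ℚ (S.X₁.homology i) : ℤ) +
        (-1) ^ m * ((Module.finrank ℚ (S.X₁.homology m) : ℤ) -
          Module.finrank ℚ (LinearMap.range (α m))) := by
      intro m
      induction m with
      | zero => simp [step0.2]
      | succ m ih =>
        rw [Finset.sum_range_succ, ih, Finset.sum_range_succ _ (m + 1),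
          Finset.sum_range_succ _ (m + 1), (step m).2]
        ring
    rw [key N, hz₁ N (by omega), hzα N (by omega)]
    simp

section Covering
variable {E Y J : Type} [TopologicalSpace E] [TopologicalSpace Y] [TopologicalSpace J]
  [DiscreteTopology J]

/-- For a regular covering `E → Y` with free deck group on `J`, the Euler characteristic of `Y` is
the difference of those of `E` and `J × E`. -/
theorem IsQuotientCoveringMap.hasEulerCharacteristic [MulAction (FreeGroup J) E] {f : E → Y}
    (hf : IsQuotientCoveringMap f (FreeGroup J)) {a b : ℤ} (hJ : HasEulerCharacteristic (J × E) a)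
    (hE : HasEulerCharacteristic E b) : HasEulerCharacteristic Y (b - a) := by
  have hcs := hf.toContinuousConstSMul
  have hcov := hf.isCoveringMap
  let F : C(E, Y) := ⟨f, hcov.continuous⟩
  let act : C(J × E, E) := ⟨fun x => FreeGroup.of x.1 • x.2,
    continuous_prod_of_discrete_left.2 fun j => continuous_const_smul (FreeGroup.of j)⟩
  let pr : C(J × E, E) := ⟨Prod.snd, continuous_snd⟩
  let R := ModuleCat.of ℚ ℚ
  have hw : (SSet.chainComplexMap (singularMap act) R - SSet.chainComplexMap (singularMap pr) R) ≫
      SSet.chainComplexMap (singularMap F) R = 0 := by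
    have h : singularMap act ≫ singularMap F = singularMap pr ≫ singularMap F := by
      refine (CategoryTheory.Functor.map_comp _ _ _).symm.trans
        (Eq.trans (congrArg _ ?_) (CategoryTheory.Functor.map_comp _ _ _))
      ext x
      exact hf.map_smul _
    rw [Preadditive.sub_comp, sub_eq_zero]
    refine (CategoryTheory.Functor.map_comp _ _ _).symm.trans
      (Eq.trans (congrArg _ h) (CategoryTheory.Functor.map_comp _ _ _))
  let S : ShortComplex (ChainComplex (ModuleCat.{0} ℚ) ℕ) := ShortComplex.mk _ _ hw
  have hS : S.ShortExact := by
    refine HomologicalComplex.shortExact_of_degreewise_shortExact S fun n => ?_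
    let T (g : FreeGroup J) : C(E, E) := ⟨(g • ·), continuous_const_smul g⟩
    let : MulAction (FreeGroup J) (singularSet E _⦋n⦌) :=
      { smul := fun g s => (singularMap (T g)).app _ s
        one_smul := fun s => by
          apply (simplexEquiv E n).injective
          ext x
          exact one_smul (FreeGroup J) (simplexEquiv E n s x)
        mul_smul := fun g h s => by
          apply (simplexEquiv E n).injective
          ext x
          exact mul_smul g h (simplexEquiv E n s x) }
    have hsm : ∀ (g : FreeGroup J) (s : singularSet E _⦋n⦌) x,
        simplexEquiv E n (g • s) x = g • simplexEquiv E n s x := fun _ _ _ => rfl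
    have hcancel := hf.isCancelSMul
    let x₀ : stdSimplex ℝ (Fin (n + 1)) := stdSimplex.vertex 0
    have hmain := SSet.nonempty_splitting_of_free_action (C := ModuleCat.{0} ℚ) R (singularMap act)
      (singularMap pr) (singularMap F) n
      (fun j s => (simplexEquiv (J × E) n).symm
        ((ContinuousMap.const _ j).prodMk (simplexEquiv E n s)))
      (fun t => by
        refine ⟨(simplexEquiv _ n t x₀).1, (singularMap pr).app _ t, ?_⟩
        rw [Equiv.symm_apply_eq]
        ext1 x
        refine Prod.ext ?_ rfl
        exact PreconnectedSpace.constant inferInstance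
          (continuous_fst.comp (simplexEquiv _ n t).continuous))
      (fun j s => by
        rw [singularMap_app_symm, Equiv.symm_apply_eq]; rfl)
      (fun j s => by
        rw [singularMap_app_symm, Equiv.symm_apply_eq]; rfl)
      (fun s => by
        obtain ⟨e₀, he₀⟩ := hf.surjective (simplexEquiv Y n s x₀)
        obtain ⟨G, ⟨_, hG⟩, _⟩ :=
          hcov.existsUnique_continuousMap_lifts (simplexEquiv Y n s) x₀ e₀ he₀
        refine ⟨(simplexEquiv E n).symm G, ?_⟩
        rw [singularMap_app_symm, Equiv.symm_apply_eq]
        ext1 x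
        exact congrFun hG x)
      (fun s s' => by
        constructor
        · intro h
          have h' : ∀ x, f (simplexEquiv E n s x) = f (simplexEquiv E n s' x) := fun x =>
            DFunLike.congr_fun (congrArg (simplexEquiv Y n) h) x
          obtain ⟨g, hg⟩ := hf.apply_eq_iff_mem_orbit.1 (h' x₀)
          refine ⟨g, (simplexEquiv E n).injective ?_⟩
          have := hcov.eq_of_comp_eq (g₁ := simplexEquiv E n (g • s')) (g₂ := simplexEquiv E n s)
            (map_continuous _) (map_continuous _)
            (funext fun x => (hf.map_smul _).trans (h' x).symm) x₀ hg
          exact DFunLike.coe_injective this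
        · rintro ⟨g, rfl⟩
          apply (simplexEquiv Y n).injective
          ext x
          exact hf.map_smul _)
      (fun g s h => by
        have h1 : g • simplexEquiv E n s x₀ = (1 : FreeGroup J) • simplexEquiv E n s x₀ := by
          rw [one_smul, ← hsm, h]
        exact IsCancelSMul.right_cancel _ _ _ h1)
      (by
        have := HomologicalComplex.congr_hom hw n
        exact this)
    exact hmain.some.shortExact
  obtain ⟨h1, h2, h3⟩ := ChainComplex.homologyEulerChar_of_shortExact hS hJ.finite hE.finite
    hJ.bounded hE.bounded
  refine ⟨h1, h2, ?_⟩
  rw [← hE.eulerChar_eq, ← hJ.eulerChar_eq]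
  exact h3

end Covering

section Homotopy
variable {X Y : Type} [TopologicalSpace X] [TopologicalSpace Y]

/-- Homotopy equivalent spaces have isomorphic rational homology. -/
theorem ContinuousMap.HomotopyEquiv.nonempty_homologyIso (e : ContinuousMap.HomotopyEquiv X Y)
    (n : ℕ) :
    Nonempty ((rationalSingularChains X).homology n ≅ (rationalSingularChains Y).homology n) := by
  let F := (AlgebraicTopology.singularChainComplexFunctor (ModuleCat.{0} ℚ)).obj (ModuleCat.of ℚ ℚ)
  let u : TopCat.of X ⟶ TopCat.of Y := TopCat.ofHom e.toFun
  let v : TopCat.of Y ⟶ TopCat.of X := TopCat.ofHom e.invFun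
  have h₁ : TopCat.Homotopy (u ≫ v) (𝟙 _) := e.left_inv.some
  have h₂ : TopCat.Homotopy (v ≫ u) (𝟙 _) := e.right_inv.some
  have k₁ := h₁.congr_homologyMap_singularChainComplexFunctor (ModuleCat.of ℚ ℚ) n
  have k₂ := h₂.congr_homologyMap_singularChainComplexFunctor (ModuleCat.of ℚ ℚ) n
  rw [CategoryTheory.Functor.map_comp, HomologicalComplex.homologyMap_comp,
    CategoryTheory.Functor.map_id,
    HomologicalComplex.homologyMap_id] at k₁ k₂
  exact ⟨⟨HomologicalComplex.homologyMap (F.map u) n, HomologicalComplex.homologyMap (F.map v) n,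
    k₁, k₂⟩⟩

theorem HasEulerCharacteristic.congr (e : ContinuousMap.HomotopyEquiv X Y) {k : ℤ}
    (h : HasEulerCharacteristic X k) : HasEulerCharacteristic Y k := by
  have i := fun n => (e.nonempty_homologyIso n).some.toLinearEquiv
  obtain ⟨N, hN⟩ := h.bounded
  refine ⟨fun n => ?_, ⟨N, fun n hn => ?_⟩, ?_⟩
  · have := h.finite n
    exact Module.Finite.equiv (i n)
  · have := hN n hn
    exact (i n).symm.toEquiv.subsingleton
  · rw [← h.eulerChar_eq]
    unfold HomologicalComplex.homologyEulerChar GradedObject.eulerChar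
    exact finsum_congr fun n => by rw [(i n).finrank_eq]

/-- A finite discrete space has an Euler characteristic. -/
theorem exists_hasEulerCharacteristic_of_finite (J : Type) [TopologicalSpace J]
    [DiscreteTopology J] [Finite J] : ∃ k, HasEulerCharacteristic J k := by
  refine ⟨_, ⟨fun n => ?_, ⟨0, fun n hn => ?_⟩, rfl⟩⟩
  · by_cases hn : n = 0
    · subst hn
      have e : (rationalSingularChains J).homology 0 ≅ ∐ fun _ : J => ModuleCat.of ℚ ℚ :=
        AlgebraicTopology.singularHomologyFunctorZeroOfTotallyDisconnectedSpace
          (ModuleCat.{0} ℚ) (ModuleCat.of ℚ ℚ) (TopCat.of J)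
      have e' := e ≪≫ (biproduct.isoCoproduct _).symm ≪≫
        ModuleCat.biproductIsoPi (fun _ : J => ModuleCat.of ℚ ℚ)
      have : Module.Finite ℚ (J → ℚ) := inferInstance
      exact Module.Finite.equiv e'.toLinearEquiv.symm
    · have := ModuleCat.subsingleton_of_isZero
        (AlgebraicTopology.isZero_singularHomologyFunctor_of_totallyDisconnectedSpace
          (ModuleCat.{0} ℚ) n (ModuleCat.of ℚ ℚ) (TopCat.of J) hn)
      have h2 : Subsingleton ((rationalSingularChains J).homology n) := this
      infer_instance
  · exact ModuleCat.subsingleton_of_isZero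
        (AlgebraicTopology.isZero_singularHomologyFunctor_of_totallyDisconnectedSpace
          (ModuleCat.{0} ℚ) n (ModuleCat.of ℚ ℚ) (TopCat.of J) (by omega))

/-- The product with a contractible space does not change the homotopy type. -/
theorem ContractibleSpace.nonempty_prod_homotopyEquiv (P C : Type) [TopologicalSpace P]
    [TopologicalSpace C] [ContractibleSpace C] : Nonempty (ContinuousMap.HomotopyEquiv P (P × C)) :=
  ⟨((Homeomorph.prodPUnit P).symm.toHomotopyEquiv).trans
    ((ContinuousMap.HomotopyEquiv.refl P).prodCongr (ContractibleSpace.hequiv PUnit C).some)⟩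

end Homotopy

/-- The covering `P × ℝ → P × S¹` is the quotient by an action of the free group on one generator,
and `P × ℝ` is homotopy equivalent to `P`. -/
theorem HasEulerCharacteristic.prod_circle {P : Type} [TopologicalSpace P] {k : ℤ}
    (h : HasEulerCharacteristic P k) : HasEulerCharacteristic (P × Circle) 0 := by
  let θ : FreeGroup Unit →* Multiplicative ℤ := FreeGroup.lift fun _ => Multiplicative.ofAdd 1
  have hof : ∀ n : ℤ, θ (FreeGroup.of () ^ n) = Multiplicative.ofAdd n := fun n => by
    rw [_root_.map_zpow, FreeGroup.lift_apply_of, ← ofAdd_zsmul, smul_eq_mul, mul_one]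
  have hpow : ∀ g : FreeGroup Unit, ∃ n : ℤ, FreeGroup.of () ^ n = g := fun g =>
    ⟨_, FreeGroup.freeGroupUnitEquivInt.symm_apply_apply g⟩
  let : MulAction (FreeGroup Unit) (P × ℝ) :=
    { smul := fun g x => (x.1, x.2 + 2 * Real.pi * (θ g).toAdd)
      one_smul := fun x => by
        change (x.1, x.2 + 2 * Real.pi * (θ 1).toAdd) = x
        simp
      mul_smul := fun g g' x => by
        change (x.1, x.2 + 2 * Real.pi * (θ (g * g')).toAdd) =
          (x.1, x.2 + 2 * Real.pi * (θ g').toAdd + 2 * Real.pi * (θ g).toAdd)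
        ext
        · rfl
        · simp; ring }
  have smul_def : ∀ (g : FreeGroup Unit) (x : P × ℝ),
      g • x = (x.1, x.2 + 2 * Real.pi * (θ g).toAdd) := fun _ _ => rfl
  have hsurj : Function.Surjective Circle.exp := fun z => ⟨_, Circle.exp_arg z⟩
  have hf : IsQuotientCoveringMap (fun x : P × ℝ => (x.1, Circle.exp x.2)) (FreeGroup Unit) := by
    refine (isQuotientCoveringMap_iff ..).2 ⟨?_, ⟨fun g => ?_⟩, fun {x y} => ?_, fun x => ?_⟩
    · exact (IsOpenMap.id.prodMap isLocalHomeomorph_circleExp.isOpenMap).isQuotientMap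
        (by fun_prop) (Function.surjective_id.prodMap hsurj)
    · simp only [smul_def]
      fun_prop
    · rw [Prod.mk.injEq, Circle.exp_eq_exp]
      constructor
      · rintro ⟨h1, m, hm⟩
        refine ⟨FreeGroup.of () ^ m, ?_⟩
        ext
        · exact h1.symm
        · simp [smul_def, hof, hm]; ring
      · rintro ⟨g, rfl⟩
        exact ⟨rfl, (θ g).toAdd, by simp [smul_def]; ring⟩
    · refine ⟨Prod.snd ⁻¹' Metric.ball x.2 1,
        (Metric.isOpen_ball.preimage continuous_snd).mem_nhds (Metric.mem_ball_self one_pos), ?_⟩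
      rintro g ⟨_, ⟨y, hy, rfl⟩, hy'⟩
      obtain ⟨n, rfl⟩ := hpow g
      simp only [smul_def, hof, toAdd_ofAdd, mem_preimage, Metric.mem_ball, Real.dist_eq,
        abs_lt] at hy hy'
      have h3 := Real.pi_gt_three
      have h4 : n < 1 := by
        by_contra! hn
        have : (1 : ℝ) ≤ n := by exact_mod_cast hn
        nlinarith
      have h5 : -1 < n := by
        by_contra! hn
        have : (n : ℝ) ≤ -1 := by exact_mod_cast hn
        nlinarith
      obtain rfl : n = 0 := by omega
      exact zpow_zero _
  have hc := (ContractibleSpace.nonempty_prod_homotopyEquiv P ℝ).some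
  have := hf.hasEulerCharacteristic
    ((h.congr hc).congr (Homeomorph.punitProd (P × ℝ)).symm.toHomotopyEquiv) (h.congr hc)
  simpa using this

end EulerCharacteristic

/-! ### Unique lifting and asphericity -/

section Lifting
open unitInterval

/-- The lifting properties of covering maps. Unlike coverings, the maps with these properties are
closed under composition. -/
structure HasUniqueLifting {E X : Type} [TopologicalSpace E] [TopologicalSpace X] (p : E → X) :
    Prop where
  continuous : Continuous p
  exists_lift : ∀ {A : Type} [TopologicalSpace A] [SimplyConnectedSpace A]
    [LocallyPathConnectedSpace A] (f : C(A, X)) (a : A) (e : E), p e = f a →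
      ∃ F : C(A, E), F a = e ∧ ∀ x, p (F x) = f x
  eq_of_comp_eq : ∀ {A : Type} [TopologicalSpace A] [PreconnectedSpace A] (F F' : C(A, E)),
    (∀ x, p (F x) = p (F' x)) → ∀ a, F a = F' a → ∀ x, F x = F' x

variable {E X E' Y : Type} [TopologicalSpace E] [TopologicalSpace X] [TopologicalSpace E']
  [TopologicalSpace Y]

theorem IsCoveringMap.hasUniqueLifting {p : E → X} (hp : IsCoveringMap p) :
    HasUniqueLifting p where
  continuous := hp.continuous
  exists_lift f a e he := by
    obtain ⟨F, ⟨h1, h2⟩, -⟩ := hp.existsUnique_continuousMap_lifts f a e he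
    exact ⟨F, h1, fun x => congrFun h2 x⟩
  eq_of_comp_eq F F' h a ha x :=
    congrFun (hp.eq_of_comp_eq F.continuous F'.continuous (funext h) a ha) x

theorem HasUniqueLifting.comp {q : X → Y} {p : E → X} (hq : HasUniqueLifting q)
    (hp : HasUniqueLifting p) : HasUniqueLifting (q ∘ p) where
  continuous := hq.continuous.comp hp.continuous
  exists_lift f a e he := by
    obtain ⟨G, hG, hG'⟩ := hq.exists_lift f a (p e) he
    obtain ⟨F, hF, hF'⟩ := hp.exists_lift G a e hG.symm
    exact ⟨F, hF, fun x => by rw [Function.comp_apply, hF', hG']⟩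
  eq_of_comp_eq F F' h a ha x := by
    refine hp.eq_of_comp_eq F F' (fun y => ?_) a ha x
    exact hq.eq_of_comp_eq (ContinuousMap.comp ⟨p, hp.continuous⟩ F)
      (ContinuousMap.comp ⟨p, hp.continuous⟩ F') h a (congrArg p ha) y

theorem HasUniqueLifting.prodMap {p : E → X} {q : E' → Y} (hp : HasUniqueLifting p)
    (hq : HasUniqueLifting q) : HasUniqueLifting (Prod.map p q) where
  continuous := hp.continuous.prodMap hq.continuous
  exists_lift f a e he := by
    obtain ⟨F, hF, hF'⟩ := hp.exists_lift (ContinuousMap.fst.comp f) a e.1 (congrArg Prod.fst he)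
    obtain ⟨G, hG, hG'⟩ := hq.exists_lift (ContinuousMap.snd.comp f) a e.2 (congrArg Prod.snd he)
    exact ⟨F.prodMk G, Prod.ext hF hG, fun x => Prod.ext (hF' x) (hG' x)⟩
  eq_of_comp_eq F F' h a ha x :=
    Prod.ext
      (hp.eq_of_comp_eq (ContinuousMap.fst.comp F) (ContinuousMap.fst.comp F')
        (fun x => congrArg Prod.fst (h x)) a (congrArg Prod.fst ha) x)
      (hq.eq_of_comp_eq (ContinuousMap.snd.comp F) (ContinuousMap.snd.comp F')
        (fun x => congrArg Prod.snd (h x)) a (congrArg Prod.snd ha) x)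

theorem hasUniqueLifting_id : HasUniqueLifting (id : E → E) where
  continuous := continuous_id
  exists_lift f _ _ he := ⟨f, he.symm, fun _ => rfl⟩
  eq_of_comp_eq _ _ h _ _ x := h x

theorem isCoveringMap_circleExp : IsCoveringMap Circle.exp := by
  have h : (Circle.exp : ℝ → Circle) =
      AddCircle.homeomorphCircle' ∘ ((↑) : ℝ → AddCircle (2 * Real.pi)) := by
    ext x; rfl
  rw [h]
  exact (AddCircle.isCoveringMap_coe _).homeomorph_comp _

/-- The cube as a convex set. -/
def cubeHomeomorph (n : ℕ) : (Fin n → I) ≃ₜ Set.pi univ fun _ : Fin n => Icc (0 : ℝ) 1 where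
  toFun x := ⟨fun i => x i, fun i _ => (x i).2⟩
  invFun x i := ⟨x.1 i, x.2 i trivial⟩
  left_inv _ := rfl
  right_inv _ := rfl
  continuous_toFun := Continuous.subtype_mk (by fun_prop) _
  continuous_invFun := continuous_pi fun i =>
    Continuous.subtype_mk ((continuous_apply i).comp continuous_subtype_val) _

instance (n : ℕ) : ContractibleSpace (Fin n → I) :=
  have : ContractibleSpace (Set.pi univ fun _ : Fin n => Icc (0 : ℝ) 1) :=
    (convex_pi fun _ _ => convex_Icc (0 : ℝ) 1).contractibleSpace
      ⟨fun _ => 0, fun _ _ => ⟨le_rfl, zero_le_one⟩⟩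
  (cubeHomeomorph n).contractibleSpace

instance (n : ℕ) : LocallyPathConnectedSpace (Fin n → I) :=
  have : LocallyPathConnectedSpace (Set.pi univ fun _ : Fin n => Icc (0 : ℝ) 1) :=
    (convex_pi fun _ _ => convex_Icc (0 : ℝ) 1).locallyPathConnectedSpace
  (cubeHomeomorph n).isOpenEmbedding.locallyPathConnectedSpace

instance : ContractibleSpace I :=
  (convex_Icc (0 : ℝ) 1).contractibleSpace ⟨0, le_rfl, zero_le_one⟩

instance : ContractibleSpace (I × I) :=
  (ContractibleSpace.nonempty_prod_homotopyEquiv I I).some.symm.contractibleSpace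

instance : LocallyPathConnectedSpace I := (convex_Icc (0 : ℝ) 1).locallyPathConnectedSpace

/-- The coordinate change of the interval which stretches `[1/4, 3/4]` onto `[0, 1]` as `s` goes
from `0` to `1`. -/
def stretch (s t : I) : I := projIcc (0 : ℝ) 1 zero_le_one ((1 + s) * t - s / 2)

theorem stretch_zero (s : I) : stretch s 0 = 0 := by
  rw [stretch, projIcc_of_le_left]
  · rfl
  · have := s.2.1; simp; linarith

theorem stretch_one (s : I) : stretch s 1 = 1 := by
  rw [stretch, projIcc_of_right_le]
  · rfl
  · have := s.2.1; simp; linarith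

theorem zero_stretch (t : I) : stretch 0 t = t := by
  simp [stretch]

/-- In a contractible space every generalized loop is null-homotopic relative to the boundary. -/
theorem GenLoop.homotopic_const_of_contractible [ContractibleSpace E] {n : ℕ} {e : E}
    (f : GenLoop (Fin n) E e) : GenLoop.Homotopic f GenLoop.const := by
  obtain ⟨c, ⟨H⟩⟩ := id_nullhomotopic E
  -- `ρ` vanishes exactly on the boundary and is `1` on the inner cube `[1/4, 3/4]ⁿ`.
  let ρ : C((Fin n → I), I) :=
    ⟨fun x => ∏ i, ((projIcc (0 : ℝ) 1 zero_le_one (4 * x i) : I) *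
      (projIcc (0 : ℝ) 1 zero_le_one (4 * (1 - x i)) : I) : I), by
      refine continuous_finsetProd (M := I) _ fun i _ => Continuous.mul ?_ ?_
      · exact continuous_projIcc.comp (by fun_prop)
      · exact continuous_projIcc.comp (by fun_prop)⟩
  have hρ0 : ∀ x ∈ Cube.boundary (Fin n), ρ x = 0 := by
    rintro x ⟨i, hi⟩
    refine Finset.prod_eq_zero (M₀ := I) (Finset.mem_univ i) ?_
    rcases hi with hi | hi
    · rw [hi, projIcc_of_le_left _ (by simp)]
      exact zero_mul _
    · rw [hi, projIcc_of_le_left zero_le_one (x := 4 * (1 - ((1 : I) : ℝ))) (by simp)]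
      exact mul_zero _
  have hρ1 : ∀ x : Fin n → I, (∀ i, 1 / 4 ≤ (x i : ℝ) ∧ (x i : ℝ) ≤ 3 / 4) → ρ x = 1 := by
    intro x hx
    have hprod : ∀ u v : Fin n → I, (∀ i, u i = 1) → (∀ i, v i = 1) → ∏ i, u i * v i = 1 :=
      fun u v hu hv => Finset.prod_eq_one fun i _ => by rw [hu, hv, one_mul]
    refine hprod _ _ (fun i => ?_) (fun i => ?_)
    · exact projIcc_of_right_le _ (by linarith [(hx i).1])
    · exact projIcc_of_right_le _ (by linarith [(hx i).2])
  have hbd : ∀ s : I, ∀ x ∈ Cube.boundary (Fin n),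
      (fun i => stretch s (x i)) ∈ Cube.boundary (Fin n) := by
    rintro s x ⟨i, hi⟩
    refine ⟨i, hi.imp (fun h => ?_) (fun h => ?_)⟩
    · simp only [h, stretch_zero]
    · simp only [h, stretch_one]
  have hstc : Continuous fun y : I × (Fin n → I) => fun i => stretch y.1 (y.2 i) :=
    continuous_pi fun i => continuous_projIcc.comp (by fun_prop)
  have key : ∀ x, H (ρ x, f fun i => stretch 1 (x i)) = H (ρ x, e) := by
    intro x
    by_cases hx : ∀ i, 1 / 4 ≤ (x i : ℝ) ∧ (x i : ℝ) ≤ 3 / 4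
    · rw [hρ1 x hx, H.apply_one, H.apply_one]; rfl
    · push Not at hx
      obtain ⟨i, hi⟩ := hx
      rw [GenLoop.boundary f]
      refine ⟨i, ?_⟩
      rcases lt_or_ge (x i : ℝ) (1 / 4) with h | h
      · left
        change projIcc (0 : ℝ) 1 _ _ = 0
        rw [projIcc_of_le_left]
        · rfl
        · simp; linarith
      · right
        change projIcc (0 : ℝ) 1 _ _ = 1
        rw [projIcc_of_right_le]
        · rfl
        · have := hi h; simp; linarith
  let g₁ : C((Fin n → I), E) := ⟨fun x => f fun i => stretch 1 (x i),
    (map_continuous f.1).comp (hstc.comp (by fun_prop : Continuous fun x => ((1 : I), x)))⟩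
  let g₂ : C((Fin n → I), E) := ⟨fun x => H (ρ x, e), by fun_prop⟩
  have h₁ : f.1.HomotopicRel g₁ (Cube.boundary (Fin n)) :=
    ⟨{ toFun := fun y => f fun i => stretch y.1 (y.2 i)
       continuous_toFun := (map_continuous f.1).comp hstc
       map_zero_left := fun x => by simp [zero_stretch]
       map_one_left := fun x => rfl
       prop' := fun s x hx => by
         exact (GenLoop.boundary f _ (hbd s x hx)).trans (GenLoop.boundary f x hx).symm }⟩
  have h₂ : g₁.HomotopicRel g₂ (Cube.boundary (Fin n)) :=
    ⟨{ toFun := fun y => H (y.1 * ρ y.2, g₁ y.2)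
       continuous_toFun := by fun_prop
       map_zero_left := fun x => by rw [zero_mul, H.apply_zero]; rfl
       map_one_left := fun x => by rw [one_mul]; exact key x
       prop' := fun s x hx => by
         change H (s * ρ x, g₁ x) = g₁ x
         rw [hρ0 x hx, mul_zero, H.apply_zero]; rfl }⟩
  have h₃ : (ContinuousMap.const (Fin n → I) e).HomotopicRel g₂ (Cube.boundary (Fin n)) :=
    ⟨{ toFun := fun y => H (y.1 * ρ y.2, e)
       continuous_toFun := by fun_prop
       map_zero_left := fun x => by rw [zero_mul, H.apply_zero]; rfl
       map_one_left := fun x => by rw [one_mul]; rfl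
       prop' := fun s x hx => by
         change H (s * ρ x, e) = e
         rw [hρ0 x hx, mul_zero, H.apply_zero]; rfl }⟩
  exact (h₁.trans h₂).trans h₃.symm

/-- A space with a contractible covering is aspherical: generalized loops of dimension at least two
lift to generalized loops of the covering. -/
theorem HasUniqueLifting.isAspherical [ContractibleSpace E] {p : E → X} (hp : HasUniqueLifting p)
    (hsurj : Function.Surjective p) : IsAspherical X := by
  refine ⟨hsurj.pathConnectedSpace hp.continuous, fun n hn x => ?_⟩
  obtain ⟨e, rfl⟩ := hsurj x
  have main : ∀ f : GenLoop (Fin n) X (p e), GenLoop.Homotopic f GenLoop.const := by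
    intro f
    let o : Fin n → I := fun _ => 0
    have ho : f o = p e := GenLoop.boundary f o ⟨⟨0, by omega⟩, Or.inl rfl⟩
    obtain ⟨F, hF, hF'⟩ := hp.exists_lift f.1 o e ho.symm
    have hpath : ∀ γ : C(I, Fin n → I), (∀ s, γ s ∈ Cube.boundary (Fin n)) →
        F (γ 0) = F (γ 1) := by
      intro γ hγ
      refine (hp.eq_of_comp_eq (F.comp γ) (ContinuousMap.const I (F (γ 0))) (fun s => ?_) 0 rfl
        1).symm
      change p (F (γ s)) = p (F (γ 0))
      rw [hF', hF']
      exact (GenLoop.boundary f _ (hγ s)).trans (GenLoop.boundary f _ (hγ 0)).symm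
    -- A boundary point is joined to the corner `o` within the boundary: first shrink all
    -- coordinates but the extreme one, then this one.
    have hbd : ∀ y ∈ Cube.boundary (Fin n), F y = e := by
      rintro y ⟨i, hi⟩
      obtain ⟨j, hj⟩ : ∃ j : Fin n, j ≠ i := by
        have : Nontrivial (Fin n) := Fin.nontrivial_iff_two_le.2 hn
        exact exists_ne i
      have e1 := hpath ⟨fun s k => if k = i then y k else s * y k, by
        refine continuous_pi fun k => ?_
        split_ifs <;> fun_prop⟩ (fun s => ⟨i, by simpa using hi⟩)
      have e2 := hpath ⟨fun s k => if k = i then s * y k else 0, by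
        refine continuous_pi fun k => ?_
        split_ifs <;> fun_prop⟩ (fun s => ⟨j, by simp [hj]⟩)
      simp only [ContinuousMap.coe_mk, zero_mul, one_mul, ite_self] at e1 e2
      rw [← hF]
      exact (e1.symm.trans e2.symm)
    let G : GenLoop (Fin n) E e := ⟨F, hbd⟩
    have h : (F : C(Fin n → I, E)).HomotopicRel (ContinuousMap.const _ e) (Cube.boundary (Fin n)) :=
      GenLoop.homotopic_const_of_contractible G
    have h2 := h.comp_continuousMap ⟨p, hp.continuous⟩
    have h3 : (ContinuousMap.comp ⟨p, hp.continuous⟩ F) = f.1 := by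
      ext x; exact hF' x
    rw [h3] at h2
    exact h2
  refine ⟨fun a b => ?_⟩
  induction a using Quotient.inductionOn with | _ a
  induction b using Quotient.inductionOn with | _ b
  exact Quotient.sound ((main a).trans (main b).symm)

/-- A map which lifts to an injective map of coverings, the first of which is simply connected, is
injective on fundamental groups. -/
theorem HasUniqueLifting.isPiOneInjective [SimplyConnectedSpace E'] {q : E' → Y} {p : E → X}
    (hq : HasUniqueLifting q) (hqs : Function.Surjective q) (hp : HasUniqueLifting p) (f : C(Y, X))
    (F : C(E', E)) (hF : Function.Injective F) (hpF : ∀ x, p (F x) = f (q x)) :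
    IsPiOneInjective f := by
  intro y
  rw [injective_iff_map_eq_one]
  intro c hc
  obtain ⟨γ, rfl⟩ : ∃ γ : Path y y, Path.Homotopic.Quotient.mk γ = c := Quotient.exists_rep c
  obtain ⟨e, rfl⟩ := hqs y
  have hnull : Path.Homotopic (γ.map f.continuous) (Path.refl _) := by
    have h : Path.Homotopic.Quotient.mk (γ.map f.continuous) =
        Path.Homotopic.Quotient.mk (Path.refl (f (q e))) := hc
    exact Path.Homotopic.Quotient.exact h
  obtain ⟨H⟩ := hnull
  obtain ⟨Γ, hΓ0, hΓ⟩ := hq.exists_lift γ.toContinuousMap 0 e (by simp)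
  obtain ⟨K, hK0, hK⟩ := hp.exists_lift H.toContinuousMap (0, 0) (F e) (by simp [hpF])
  -- The lift `K` of the null-homotopy is constant on the three sides other than `{0} × I`.
  have a1 : ∀ t, K (0, t) = F (Γ t) := by
    refine hp.eq_of_comp_eq (K.comp ⟨fun t => (0, t), by fun_prop⟩) (F.comp Γ) (fun t => ?_) 0 ?_
    · change p (K (0, t)) = p (F (Γ t))
      rw [hK, hpF, hΓ]
      simp
    · change K (0, 0) = F (Γ 0)
      rw [hK0, hΓ0]
  have a2 : ∀ s, K (s, 0) = K (0, 0) := by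
    refine fun s => hp.eq_of_comp_eq (K.comp ⟨fun t => (t, 0), by fun_prop⟩)
      (ContinuousMap.const I (K (0, 0))) (fun t => ?_) 0 rfl s
    change p (K (t, 0)) = p (K (0, 0))
    rw [hK, hK]
    simp
  have a3 : ∀ s, K (s, 1) = K (0, 1) := by
    refine fun s => hp.eq_of_comp_eq (K.comp ⟨fun t => (t, 1), by fun_prop⟩)
      (ContinuousMap.const I (K (0, 1))) (fun t => ?_) 0 rfl s
    change p (K (t, 1)) = p (K (0, 1))
    rw [hK, hK]
    simp
  have a4 : ∀ t, K (1, t) = K (1, 0) := by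
    refine fun s => hp.eq_of_comp_eq (K.comp ⟨fun t => (1, t), by fun_prop⟩)
      (ContinuousMap.const I (K (1, 0))) (fun t => ?_) 0 rfl s
    change p (K (1, t)) = p (K (1, 0))
    rw [hK, hK]
    simp
  have hloop : Γ 1 = e := by
    apply hF
    rw [← a1, ← a3 1, a4, a2, hK0]
  let Γ' : Path e e := ⟨Γ, hΓ0, hloop⟩
  have h1 : Path.Homotopic Γ' (Path.refl e) := SimplyConnectedSpace.paths_homotopic _ _
  have h2 : Path.Homotopic (Γ'.map hq.continuous) ((Path.refl e).map hq.continuous) :=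
    h1.map ⟨q, hq.continuous⟩
  have h3 : Γ'.map hq.continuous = γ := by
    ext t; exact hΓ t
  rw [h3] at h2
  exact Path.Homotopic.Quotient.eq.2 h2

end Lifting

/-! ### The upper half of the disk with three holes -/

section HalfDisk
open unitInterval

/-- The part of the disk with three holes in the closed upper half plane. -/
def upperHalfDisk : Set ℂ := {z | z ∈ threeHoledDisk ∧ 0 ≤ z.im}

/-- The height of the holes over the point `x` of the real axis. -/
def holeHeight (x : ℝ) : ℝ :=
  √(1 / 4 - (x + 2) ^ 2) ⊔ (√(1 / 4 - x ^ 2) ⊔ √(1 / 4 - (x - 2) ^ 2))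

/-- The height of the outer circle over the point `x` of the real axis. -/
def outerHeight (x : ℝ) : ℝ := √(16 - x ^ 2)

theorem mem_threeHoledDisk_iff {z : ℂ} : z ∈ threeHoledDisk ↔ z.re ^ 2 + z.im ^ 2 ≤ 16 ∧
    1 / 4 ≤ (z.re + 2) ^ 2 + z.im ^ 2 ∧ 1 / 4 ≤ z.re ^ 2 + z.im ^ 2 ∧
    1 / 4 ≤ (z.re - 2) ^ 2 + z.im ^ 2 := by
  have normSq_eq : ∀ w : ℂ, ‖w‖ ^ 2 = w.re ^ 2 + w.im ^ 2 := fun w => by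
    rw [Complex.sq_norm, Complex.normSq_apply]; ring
  have h1 : ∀ w : ℂ, ‖w‖ ≤ 4 ↔ w.re ^ 2 + w.im ^ 2 ≤ 16 := fun w => by
    rw [← normSq_eq, show (16 : ℝ) = 4 ^ 2 by norm_num,
      sq_le_sq₀ (norm_nonneg _) (by norm_num)]
  have h2 : ∀ w : ℂ, 1 / 2 ≤ ‖w‖ ↔ 1 / 4 ≤ w.re ^ 2 + w.im ^ 2 := fun w => by
    rw [← normSq_eq, show (1 / 4 : ℝ) = (1 / 2) ^ 2 by norm_num,
      sq_le_sq₀ (by norm_num) (norm_nonneg _)]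
  simp only [threeHoledDisk, mem_ofPred_eq, Fin.forall_fin_succ, h1, h2]
  simp [circleCenter]

theorem mem_upperHalfDisk_iff {z : ℂ} : z ∈ upperHalfDisk ↔
    z.re ∈ Icc (-4 : ℝ) 4 ∧ holeHeight z.re ≤ z.im ∧ z.im ≤ outerHeight z.re := by
  rw [upperHalfDisk, mem_ofPred_eq, mem_threeHoledDisk_iff, holeHeight, outerHeight]
  constructor
  · rintro ⟨⟨h1, h2, h3, h4⟩, h5⟩
    refine ⟨⟨by nlinarith, by nlinarith⟩, ?_, Real.le_sqrt_of_sq_le (by linarith)⟩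
    refine sup_le ?_ (sup_le ?_ ?_) <;> exact Real.sqrt_le_iff.2 ⟨h5, by linarith⟩
  · rintro ⟨⟨h1, h2⟩, h3, h4⟩
    have h5 : 0 ≤ z.im := le_trans (le_sup_of_le_left (Real.sqrt_nonneg _)) h3
    obtain ⟨h6, h7, h8⟩ := by simpa only [sup_le_iff] using h3
    rw [Real.sqrt_le_left h5] at h6 h7 h8
    rw [Real.le_sqrt h5 (by nlinarith)] at h4
    exact ⟨⟨by linarith, by linarith, by linarith, by linarith⟩, h5⟩

theorem outerHeight_nonneg (x : ℝ) : 0 ≤ outerHeight x := Real.sqrt_nonneg _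

theorem holeHeight_le_outerHeight {x : ℝ} (hx : x ∈ Icc (-4 : ℝ) 4) :
    holeHeight x ≤ outerHeight x := by
  refine sup_le ?_ (sup_le ?_ ?_) <;> refine Real.sqrt_le_sqrt ?_ <;> nlinarith [hx.1, hx.2]

theorem continuous_holeHeight : Continuous holeHeight := by
  unfold holeHeight; fun_prop

theorem continuous_outerHeight : Continuous outerHeight := by
  unfold outerHeight; fun_prop

/-- The left ends of the four segments in which the disk with three holes meets the real axis. -/
def segLeft : Fin 4 → ℝ := ![-4, -3 / 2, 1 / 2, 5 / 2]

/-- The right ends of the four segments in which the disk with three holes meets the real axis. -/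
def segRight : Fin 4 → ℝ := ![-5 / 2, -1 / 2, 3 / 2, 4]

theorem segLeft_le_segRight (k : Fin 4) : segLeft k ≤ segRight k := by
  fin_cases k <;> simp [segLeft, segRight] <;> norm_num

theorem neg_four_le_segLeft (k : Fin 4) : -4 ≤ segLeft k := by
  fin_cases k <;> simp [segLeft] <;> norm_num

theorem segRight_le_four (k : Fin 4) : segRight k ≤ 4 := by
  fin_cases k <;> simp [segRight] <;> norm_num

theorem holeHeight_of_mem_seg {k : Fin 4} {x : ℝ} (hx : x ∈ Icc (segLeft k) (segRight k)) :
    holeHeight x = 0 := by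
  obtain ⟨h1, h2⟩ := hx
  unfold holeHeight
  rw [Real.sqrt_eq_zero_of_nonpos, Real.sqrt_eq_zero_of_nonpos, Real.sqrt_eq_zero_of_nonpos]
  · simp
  all_goals
    fin_cases k <;> simp [segLeft, segRight] at h1 h2 <;> nlinarith

/-- The deformation of the upper half disk onto the interval `[a, b]` of the real axis: the real
part moves into `[a, b]` and the imaginary part shrinks, as far as the holes and the outer circle
allow. -/
def squash (a b s : ℝ) (z : ℂ) : ℂ :=
  let x := (1 - s) * z.re + s * max a (min b z.re)
  ⟨x, max (holeHeight x) (min ((1 - s) * z.im) (outerHeight x))⟩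

theorem continuous_squash (a b : ℝ) : Continuous fun p : ℝ × ℂ => squash a b p.1 p.2 := by
  have h : ∀ f g : ℝ × ℂ → ℝ, Continuous f → Continuous g →
      Continuous fun p => (⟨f p, g p⟩ : ℂ) := fun f g hf hg =>
    Complex.equivRealProdCLM.symm.continuous.comp (hf.prodMk hg)
  have hx : Continuous fun p : ℝ × ℂ =>
      (1 - p.1) * p.2.re + p.1 * max a (min b p.2.re) := by fun_prop
  exact h _ _ hx ((continuous_holeHeight.comp hx).max
    (Continuous.min (by fun_prop) (continuous_outerHeight.comp hx)))

theorem squash_mem {a b s : ℝ} (ha : -4 ≤ a) (hab : a ≤ b) (hb : b ≤ 4) (hs : s ∈ Icc (0 : ℝ) 1)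
    {z : ℂ} (hz : z ∈ upperHalfDisk) : squash a b s z ∈ upperHalfDisk := by
  rw [mem_upperHalfDisk_iff] at hz ⊢
  have hx : (1 - s) * z.re + s * max a (min b z.re) ∈ Icc (-4 : ℝ) 4 :=
    (convex_Icc (-4 : ℝ) 4) hz.1 ⟨ha.trans (le_max_left _ _),
      max_le (hab.trans hb) ((min_le_left _ _).trans hb)⟩ (by linarith [hs.2]) hs.1 (by ring)
  exact ⟨hx, le_max_left _ _, max_le (holeHeight_le_outerHeight hx) (min_le_right _ _)⟩

theorem squash_zero {a b : ℝ} {z : ℂ} (hz : z ∈ upperHalfDisk) : squash a b 0 z = z := by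
  rw [mem_upperHalfDisk_iff] at hz
  apply Complex.ext <;> simp [squash, hz.2.1, hz.2.2]

theorem squash_of_mem {a b s : ℝ} {z : ℂ} (hz : z.re ∈ Icc a b) (hz' : z.im = 0)
    (h0 : holeHeight z.re = 0) : squash a b s z = z := by
  have : (1 - s) * z.re + s * max a (min b z.re) = z.re := by
    rw [min_eq_right hz.2, max_eq_right hz.1]; ring
  apply Complex.ext
  · simpa [squash] using this
  · simp [squash, this, h0, hz', outerHeight_nonneg]

theorem squash_one_re {a b : ℝ} (hab : a ≤ b) (z : ℂ) : (squash a b 1 z).re ∈ Icc a b := by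
  simp [squash, hab]

theorem squash_one_im {a b : ℝ} (hab : a ≤ b) (h0 : ∀ x ∈ Icc a b, holeHeight x = 0) (z : ℂ) :
    (squash a b 1 z).im = 0 := by
  have h := h0 _ (squash_one_re hab z)
  simp only [squash] at h ⊢
  rw [h]
  simp [outerHeight_nonneg]

/-- The segment of the real axis in the upper half disk with number `k`. -/
def realSegment (k : Fin 4) : Set upperHalfDisk :=
  {q | q.1.im = 0 ∧ q.1.re ∈ Icc (segLeft k) (segRight k)}

/-- The strong deformation retraction of the upper half disk onto a segment. -/
def segmentRetract (k : Fin 4) : C(I × upperHalfDisk, upperHalfDisk) where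
  toFun p := ⟨squash (segLeft k) (segRight k) p.1 p.2, squash_mem (neg_four_le_segLeft k)
    (segLeft_le_segRight k) (segRight_le_four k) p.1.2 p.2.2⟩
  continuous_toFun := Continuous.subtype_mk ((continuous_squash _ _).comp
    (by fun_prop : Continuous fun p : I × upperHalfDisk => ((p.1 : ℝ), (p.2 : ℂ)))) _

theorem segmentRetract_zero (k : Fin 4) (q : upperHalfDisk) : segmentRetract k (0, q) = q :=
  Subtype.ext (squash_zero q.2)

theorem segmentRetract_one_mem (k : Fin 4) (q : upperHalfDisk) :
    segmentRetract k (1, q) ∈ realSegment k :=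
  ⟨squash_one_im (segLeft_le_segRight k) (fun _ hx => holeHeight_of_mem_seg hx) _,
    squash_one_re (segLeft_le_segRight k) _⟩

theorem segmentRetract_of_mem (k : Fin 4) (s : I) {q : upperHalfDisk} (hq : q ∈ realSegment k) :
    segmentRetract k (s, q) = q :=
  Subtype.ext (squash_of_mem hq.2 hq.1 (holeHeight_of_mem_seg hq.2))

/-- A contraction of the upper half disk to the point `-4`. -/
def halfDiskContraction : C(I × upperHalfDisk, upperHalfDisk) where
  toFun p := ⟨squash (-4) (-4) p.1 p.2, squash_mem le_rfl le_rfl (by norm_num) p.1.2 p.2.2⟩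
  continuous_toFun := Continuous.subtype_mk ((continuous_squash _ _).comp
    (by fun_prop : Continuous fun p : I × upperHalfDisk => ((p.1 : ℝ), (p.2 : ℂ)))) _

theorem halfDiskContraction_zero (q : upperHalfDisk) : halfDiskContraction (0, q) = q :=
  Subtype.ext (squash_zero q.2)

theorem halfDiskContraction_one (q q' : upperHalfDisk) :
    halfDiskContraction (1, q) = halfDiskContraction (1, q') := by
  have h0 : ∀ x ∈ Icc (-4 : ℝ) (-4), holeHeight x = 0 := fun x hx =>
    holeHeight_of_mem_seg (k := 0) ⟨hx.1, hx.2.trans (by simp [segRight]; norm_num)⟩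
  have h1 := squash_one_re (le_refl (-4 : ℝ)) q
  have h2 := squash_one_re (le_refl (-4 : ℝ)) q'
  refine Subtype.ext (Complex.ext ?_ ?_)
  · exact (le_antisymm h1.2 h1.1).trans (le_antisymm h2.2 h2.1).symm
  · exact (squash_one_im le_rfl h0 _).trans (squash_one_im le_rfl h0 _).symm

end HalfDisk

/-! ### Contracting a tree of half disks -/

section Tree
open unitInterval

/-- The part of the time interval during which the tiles of rank `n` move: it is over before the
tiles of smaller rank start. -/
def tileClock (n : ℕ) (τ : I) : I := projIcc (0 : ℝ) 1 zero_le_one (2 ^ (n + 1) * τ - 1)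

theorem continuous_tileClock (n : ℕ) : Continuous (tileClock n) :=
  continuous_projIcc.comp (by fun_prop)

theorem tileClock_zero (n : ℕ) : tileClock n 0 = 0 := by
  rw [tileClock, projIcc_of_le_left]
  · rfl
  · simp

theorem tileClock_of_le {n : ℕ} {τ : I} (h : 2 ≤ 2 ^ (n + 1) * (τ : ℝ)) : tileClock n τ = 1 := by
  rw [tileClock, projIcc_of_right_le]
  · rfl
  · linarith

theorem tileClock_of_lt {m n : ℕ} (hmn : m < n) {τ : I} (h : 2 ^ (n + 1) * (τ : ℝ) ≤ 2) :
    tileClock m τ = 0 := by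
  rw [tileClock, projIcc_of_le_left]
  · rfl
  · have h1 : (2 : ℝ) ^ (m + 1) ≤ 2 ^ n := pow_le_pow_right₀ (by norm_num) hmn
    have h2 := mul_le_mul_of_nonneg_right h1 τ.2.1
    rw [pow_succ] at h
    linarith

/-- A tree of half disks: to each vertex `v` belongs a tile, and the tile `v` is glued to the tile
`nbr k v` along the `k`-th segment. For each vertex other than the root, one of the segments leads
towards the root; the rank decreases in this direction. -/
structure TileTree (V : Type) where
  /-- The vertex on the other side of the `k`-th segment. -/
  nbr : Fin 4 → V → V
  /-- The root. -/
  root : V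
  /-- The segment which leads towards the root. -/
  exit : V → Fin 4
  /-- The rank. -/
  rank : V → ℕ
  nbr_nbr : ∀ k v, nbr k (nbr k v) = v
  exit_or : ∀ k v, (v ≠ root ∧ exit v = k) ∨ (nbr k v ≠ root ∧ exit (nbr k v) = k)
  rank_lt : ∀ v, v ≠ root → rank (nbr (exit v) v) < rank v

namespace TileTree
variable {V : Type} {C : Type} [TopologicalSpace C]

open Classical in
/-- The movement of the tile `v`. It is retracted onto its exit segment and then moves with the next
tile; the tile of the root is contracted to a point. -/
def move (T : TileTree V) (cell : V → C(upperHalfDisk, C)) (v : V) (τ : I) (q : upperHalfDisk) :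
    C :=
  if h : v = T.root then cell v (halfDiskContraction (tileClock (T.rank v) τ, q))
  else if 2 ^ (T.rank v + 1) * (τ : ℝ) ≤ 2 then
    cell v (segmentRetract (T.exit v) (tileClock (T.rank v) τ, q))
  else move T cell (T.nbr (T.exit v) v) τ (segmentRetract (T.exit v) (1, q))
termination_by T.rank v
decreasing_by exact T.rank_lt v h

variable (T : TileTree V) (cell : V → C(upperHalfDisk, C))

theorem move_root (τ : I) (q : upperHalfDisk) : T.move cell T.root τ q =
    cell T.root (halfDiskContraction (tileClock (T.rank T.root) τ, q)) := by
  rw [move, dif_pos rfl]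

theorem move_of_le {v : V} (h : v ≠ T.root) {τ : I} (hτ : 2 ^ (T.rank v + 1) * (τ : ℝ) ≤ 2)
    (q : upperHalfDisk) :
    T.move cell v τ q = cell v (segmentRetract (T.exit v) (tileClock (T.rank v) τ, q)) := by
  rw [move, dif_neg h, if_pos hτ]

theorem move_of_lt {v : V} (h : v ≠ T.root) {τ : I} (hτ : 2 < 2 ^ (T.rank v + 1) * (τ : ℝ))
    (q : upperHalfDisk) : T.move cell v τ q =
      T.move cell (T.nbr (T.exit v) v) τ (segmentRetract (T.exit v) (1, q)) := by
  rw [move, dif_neg h, if_neg (not_le.2 hτ)]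

theorem move_eq_cell {v : V} {τ : I} (h : tileClock (T.rank v) τ = 0) (q : upperHalfDisk) :
    T.move cell v τ q = cell v q := by
  by_cases hv : v = T.root
  · subst hv
    rw [move_root, h, halfDiskContraction_zero]
  · rw [move_of_le, h, segmentRetract_zero]
    · exact hv
    · by_contra! h2
      rw [tileClock_of_le h2.le] at h
      exact one_ne_zero h

theorem move_zero (v : V) (q : upperHalfDisk) : T.move cell v 0 q = cell v q :=
  T.move_eq_cell cell (tileClock_zero _) q

theorem move_one (v : V) (q q' : upperHalfDisk) :
    T.move cell v 1 q = T.move cell T.root 1 q' := by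
  induction hn : T.rank v using Nat.strong_induction_on generalizing v q with | _ n ih
  subst hn
  have h1 : (2 : ℝ) ≤ 2 ^ (T.rank v + 1) * ((1 : I) : ℝ) := by
    have : (1 : ℝ) ≤ 2 ^ T.rank v := one_le_pow₀ (by norm_num)
    rw [pow_succ]; push_cast; linarith
  by_cases hv : v = T.root
  · subst hv
    rw [move_root, move_root, tileClock_of_le h1, halfDiskContraction_one q q']
  · rw [← ih _ (T.rank_lt v hv) _ (segmentRetract (T.exit v) (1, q)) rfl]
    refine T.move_of_lt cell hv ?_ q
    have h0 : T.rank v ≠ 0 := by have := T.rank_lt v hv; omega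
    obtain ⟨m, hm⟩ := Nat.exists_eq_succ_of_ne_zero h0
    have : (1 : ℝ) ≤ 2 ^ m := one_le_pow₀ (by norm_num)
    rw [hm, pow_succ, pow_succ]; push_cast; linarith

variable (hglue : ∀ k v, ∀ q ∈ realSegment k, cell v q = cell (T.nbr k v) q)
include hglue

/-- At all times the movements of adjacent tiles agree on the common segment. -/
theorem move_glue (k : Fin 4) (v : V) (τ : I) {q : upperHalfDisk} (hq : q ∈ realSegment k) :
    T.move cell v τ q = T.move cell (T.nbr k v) τ q := by
  have key : ∀ v, v ≠ T.root → T.exit v = k →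
      T.move cell v τ q = T.move cell (T.nbr k v) τ q := by
    rintro v hv rfl
    rcases le_or_gt (2 ^ (T.rank v + 1) * (τ : ℝ)) 2 with h | h
    · rw [move_of_le _ _ hv h, segmentRetract_of_mem _ _ hq,
        move_eq_cell _ _ (tileClock_of_lt (T.rank_lt v hv) h), hglue _ _ _ hq]
    · rw [move_of_lt _ _ hv h, segmentRetract_of_mem _ _ hq]
  rcases T.exit_or k v with ⟨h1, h2⟩ | ⟨h1, h2⟩
  · exact key v h1 h2
  · rw [key _ h1 h2, T.nbr_nbr]

theorem continuous_move (v : V) :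
    Continuous fun p : I × upperHalfDisk => T.move cell v p.1 p.2 := by
  induction hn : T.rank v using Nat.strong_induction_on generalizing v with | _ n ih
  subst hn
  by_cases hv : v = T.root
  · subst hv
    simp only [move_root]
    have := continuous_tileClock (T.rank T.root)
    fun_prop
  · have h1 := ih _ (T.rank_lt v hv) _ rfl
    have h2 := continuous_tileClock (T.rank v)
    have h3 : (fun p : I × upperHalfDisk => T.move cell v p.1 p.2) = fun p =>
        if 2 ^ (T.rank v + 1) * (p.1 : ℝ) ≤ 2 then
          cell v (segmentRetract (T.exit v) (tileClock (T.rank v) p.1, p.2))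
        else T.move cell (T.nbr (T.exit v) v) p.1 (segmentRetract (T.exit v) (1, p.2)) := by
      ext p
      rw [move, dif_neg hv]
    rw [h3]
    refine Continuous.if_le (by fun_prop) ?_ (by fun_prop) continuous_const fun p hp => ?_
    · exact h1.comp (by fun_prop : Continuous fun p : I × upperHalfDisk =>
        (p.1, segmentRetract (T.exit v) (1, p.2)))
    · rw [tileClock_of_le hp.ge, move_eq_cell _ _ (tileClock_of_lt (T.rank_lt v hv) hp.le),
        hglue _ _ _ (segmentRetract_one_mem _ _)]

end TileTree
end Tree

/-! ### Flat bundles over the disk with three holes -/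

section FlatBundle

/-- The disk with three holes as a space. -/
abbrev Disk : Type := threeHoledDisk

/-- The free group of rank three, the fundamental group of the disk with three holes. -/
abbrev Free3 : Type := FreeGroup (Fin 3)

instance : TopologicalSpace Free3 := ⊥

instance : DiscreteTopology Free3 := ⟨rfl⟩

/-- The element of the free group picked up when crossing the `k`-th segment of the real axis
upwards. -/
def crossing : Fin 4 → Free3 := Fin.cons 1 FreeGroup.of

/-- The left ends of the intervals into which the centers of the holes cut the real axis. -/
def cutLeft : Fin 4 → ℝ := ![-5, -2, 0, 2]

/-- The right ends of the intervals into which the centers of the holes cut the real axis. -/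
def cutRight : Fin 4 → ℝ := ![-2, 0, 2, 5]

/-- The plane with all of the real axis but the `k`-th interval removed. -/
def sheet (k : Fin 4) : Set ℂ := {z | z.im ≠ 0 ∨ z.re ∈ Ioo (cutLeft k) (cutRight k)}

theorem isOpen_sheet (k : Fin 4) : IsOpen (sheet k) :=
  (isOpen_ne_fun Complex.continuous_im continuous_const).union
    (isOpen_Ioo.preimage Complex.continuous_re)

/-- The index of a sheet which contains the point. -/
def sheetAt (z : ℂ) : Fin 4 :=
  if z.im ≠ 0 ∨ z.re < -2 then 0 else if z.re < 0 then 1 else if z.re < 2 then 2 else 3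

theorem sheetAt_of_im_ne {z : ℂ} (h : z.im ≠ 0) : sheetAt z = 0 := if_pos (Or.inl h)

theorem mem_seg_of_im_eq {z : ℂ} (hz : z ∈ threeHoledDisk) (h : z.im = 0) {k : Fin 4}
    (hk : z ∈ sheet k) : z.re ∈ Icc (segLeft k) (segRight k) := by
  rw [mem_threeHoledDisk_iff, h] at hz
  obtain ⟨h1, h2, h3, h4⟩ := hz
  obtain ⟨h5, h6⟩ := hk.resolve_left (not_not.2 h)
  fin_cases k <;> simp [segLeft, segRight, cutLeft, cutRight] at h5 h6 ⊢ <;>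
    constructor <;> nlinarith

theorem mem_sheet_of_mem_seg {z : ℂ} {k : Fin 4} (h : z.re ∈ Icc (segLeft k) (segRight k)) :
    z ∈ sheet k := by
  obtain ⟨h5, h6⟩ := h
  right
  fin_cases k <;> simp [segLeft, segRight, cutLeft, cutRight] at h5 h6 ⊢ <;>
    constructor <;> linarith

theorem mem_sheet_sheetAt {z : ℂ} (hz : z ∈ threeHoledDisk) : z ∈ sheet (sheetAt z) := by
  by_cases him : z.im = 0
  · rw [mem_threeHoledDisk_iff, him] at hz
    obtain ⟨h1, h2, h3, h4⟩ := hz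
    right
    simp only [sheetAt, him, ne_eq, not_true_eq_false, false_or]
    split_ifs with h5 h6 h7 <;> simp [cutLeft, cutRight] <;> constructor <;> nlinarith
  · exact Or.inl him

theorem sheetAt_eq {z : ℂ} (h : z.im = 0) {k : Fin 4} (hk : z ∈ sheet k) :
    sheetAt z = k := by
  obtain ⟨h5, h6⟩ := hk.resolve_left (not_not.2 h)
  simp only [sheetAt, h, ne_eq, not_true_eq_false, false_or]
  fin_cases k <;> simp [cutLeft, cutRight] at h5 h6 ⊢
  · exact fun h => absurd h5 (by linarith)
  · rw [if_neg (by linarith), if_pos (by linarith)]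
  · rw [if_neg (by linarith), if_neg (by linarith), if_pos (by linarith)]
  · rw [if_neg (by linarith), if_neg (by linarith), if_neg (by linarith)]

/-- The element of the free group by which the coordinate with respect to the sheet `k` is
shifted: it is trivial in the upper half plane. -/
def shift (k : Fin 4) (z : ℂ) : Free3 := if 0 ≤ z.im then 1 else crossing k

theorem shift_of_nonneg {k : Fin 4} {z : ℂ} (h : 0 ≤ z.im) : shift k z = 1 := if_pos h

theorem shift_of_neg {k : Fin 4} {z : ℂ} (h : z.im < 0) : shift k z = crossing k :=
  if_neg (not_le.2 h)

theorem shift_sheetAt (z : ℂ) : shift (sheetAt z) z = 1 := by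
  rcases le_or_gt 0 z.im with h | h
  · exact shift_of_nonneg h
  · rw [shift_of_neg h, sheetAt_of_im_ne h.ne]; rfl

theorem eventually_shift_eq {j k : Fin 4} {z : ℂ} (hj : z ∈ sheet j) (hk : z ∈ sheet k) :
    ∀ᶠ w in 𝓝 z, (shift k w)⁻¹ * shift j w = (shift k z)⁻¹ * shift j z := by
  rcases lt_trichotomy z.im 0 with h | h | h
  · filter_upwards [Complex.continuous_im.continuousAt.eventually_lt_const h] with w hw
    rw [shift_of_neg h, shift_of_neg h, shift_of_neg hw, shift_of_neg hw]
  · obtain rfl : j = k := (sheetAt_eq h hj).symm.trans (sheetAt_eq h hk)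
    simp
  · filter_upwards [Complex.continuous_im.continuousAt.eventually_const_lt h] with w hw
    rw [shift_of_nonneg h.le, shift_of_nonneg h.le, shift_of_nonneg hw.le, shift_of_nonneg hw.le]

variable {F : Type} [TopologicalSpace F] (ρ : Free3 →* (F ≃ₜ F))

/-- The flat bundle over the disk with three holes in which a path that crosses the `k`-th segment
upwards acts on the fiber by `ρ (crossing k)`. It has one trivialization over each sheet. -/
def flatBundleCore : FiberBundleCore (Fin 4) Disk F where
  baseSet k := Subtype.val ⁻¹' sheet k
  isOpen_baseSet k := (isOpen_sheet k).preimage continuous_subtype_val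
  indexAt z := sheetAt z
  mem_baseSet_at z := mem_sheet_sheetAt z.2
  coordChange j k z x := ρ ((shift k z)⁻¹ * shift j z) x
  coordChange_self k z _ x := by simp
  continuousOn_coordChange j k := by
    rintro ⟨z, x⟩ ⟨⟨hj, hk⟩, -⟩
    refine ContinuousAt.continuousWithinAt ?_
    have h1 : ∀ᶠ p : Disk × F in 𝓝 (z, x),
        ρ ((shift k p.1)⁻¹ * shift j p.1) p.2 = ρ ((shift k z)⁻¹ * shift j z) p.2 := by
      have h2 : Filter.Tendsto (fun p : Disk × F => (p.1 : ℂ)) (𝓝 (z, x)) (𝓝 (z : ℂ)) :=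
        (continuous_subtype_val.comp continuous_fst).continuousAt
      filter_upwards [h2.eventually (eventually_shift_eq hj hk)] with p hp
      rw [hp]
    exact ((ρ _).continuous.comp continuous_snd).continuousAt.congr (h1.mono fun _ h => h.symm)
  coordChange_comp i j k z _ x := by
    rw [← Homeomorph.mul_apply, ← map_mul]
    congr 2
    group

/-- The total space of the flat bundle. -/
def FlatBundle : Type := (flatBundleCore ρ).TotalSpace

namespace FlatBundle

instance : TopologicalSpace (FlatBundle ρ) :=
  inferInstanceAs (TopologicalSpace (flatBundleCore ρ).TotalSpace)

variable {ρ}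

/-- The base point of a point of the bundle. -/
def base (e : FlatBundle ρ) : Disk := e.1

/-- The position in the fiber: the coordinate with respect to the sheet `sheetAt` of the base
point. It is continuous over the closed upper half disk and over the open lower half disk. -/
def fib (e : FlatBundle ρ) : F := e.2

/-- The coordinate in the fiber with respect to the trivialization over the sheet `k`. -/
def coord (k : Fin 4) (e : FlatBundle ρ) : F := ρ (shift k e.base)⁻¹ e.fib

variable (ρ) in
/-- The point of the bundle with given base point and position in the fiber. -/
def pt (z : Disk) (x : F) : FlatBundle ρ := ⟨z, x⟩

@[simp] theorem base_pt (z : Disk) (x : F) : (pt ρ z x).base = z := rfl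

@[simp] theorem fib_pt (z : Disk) (x : F) : (pt ρ z x).fib = x := rfl

@[simp] theorem pt_base_fib (e : FlatBundle ρ) : pt ρ e.base e.fib = e := rfl

theorem ext {e e' : FlatBundle ρ} (h : e.base = e'.base) (h' : e.fib = e'.fib) : e = e' := by
  rw [← pt_base_fib e, ← pt_base_fib e', h, h']

theorem ext_coord {e e' : FlatBundle ρ} (k : Fin 4) (h : e.base = e'.base)
    (h' : e.coord k = e'.coord k) : e = e' := by
  rw [coord, coord, h] at h'
  exact ext h ((ρ _).injective h')

theorem coord_pt_shift (k : Fin 4) (z : Disk) (x : F) : (pt ρ z (ρ (shift k z) x)).coord k = x := by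
  rw [coord, base_pt, fib_pt, map_inv]
  exact (ρ (shift k z)).symm_apply_apply x

theorem rho_shift_coord (k : Fin 4) (e : FlatBundle ρ) :
    ρ (shift k e.base) (e.coord k) = e.fib := by
  rw [coord, map_inv]
  exact (ρ (shift k e.base)).apply_symm_apply e.fib

theorem pt_coord (k : Fin 4) (e : FlatBundle ρ) :
    pt ρ e.base (ρ (shift k e.base) (e.coord k)) = e := by
  rw [rho_shift_coord, pt_base_fib]

theorem coord_of_nonneg {k : Fin 4} {e : FlatBundle ρ} (h : 0 ≤ (e.base : ℂ).im) :
    e.coord k = e.fib := by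
  rw [coord, shift_of_nonneg h, inv_one, map_one]; rfl

theorem coord_of_neg {k : Fin 4} {e : FlatBundle ρ} (h : (e.base : ℂ).im < 0) :
    e.coord k = ρ (crossing k)⁻¹ e.fib := by
  rw [coord, shift_of_neg h]

theorem continuous_base : Continuous (base : FlatBundle ρ → Disk) :=
  (flatBundleCore ρ).continuous_proj

variable (ρ) in
/-- The trivialization of the bundle over the sheet `k`. -/
def triv (k : Fin 4) : OpenPartialHomeomorph (FlatBundle ρ) (Disk × F) :=
  ((flatBundleCore ρ).localTriv k).toOpenPartialHomeomorph

theorem triv_apply (k : Fin 4) (e : FlatBundle ρ) : triv ρ k e = (e.base, e.coord k) := by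
  change (e.base, ρ ((shift k e.base)⁻¹ * shift (sheetAt e.base) e.base) e.fib) = _
  rw [shift_sheetAt, mul_one]; rfl

theorem mem_triv_source {k : Fin 4} {e : FlatBundle ρ} :
    e ∈ (triv ρ k).source ↔ (e.base : ℂ) ∈ sheet k := Iff.rfl

theorem continuousAt_coord {k : Fin 4} {e : FlatBundle ρ} (h : (e.base : ℂ) ∈ sheet k) :
    ContinuousAt (coord k) e := by
  have h1 := (triv ρ k).continuousAt (mem_triv_source.2 h)
  rw [show ⇑(triv ρ k) = fun e => (base e, coord k e) from funext (triv_apply k)] at h1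
  exact continuousAt_snd.comp h1

/-- A map to the bundle is continuous if its base component and its coordinate with respect to one
of the sheets are. -/
theorem continuousAt_of_coord {A : Type*} [TopologicalSpace A] {g : A → FlatBundle ρ} {a : A}
    (k : Fin 4) (hk : ((g a).base : ℂ) ∈ sheet k) (h1 : ContinuousAt (fun b => (g b).base) a)
    (h2 : ContinuousAt (fun b => (g b).coord k) a) : ContinuousAt g a := by
  have h3 : g ⁻¹' (triv ρ k).source ∈ 𝓝 a :=
    (continuous_subtype_val.continuousAt.comp h1).eventually ((isOpen_sheet k).mem_nhds hk)
  rw [(triv ρ k).continuousAt_iff_continuousAt_comp_left h3]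
  exact (h1.prodMk h2).congr (.of_forall fun b => (triv_apply k (g b)).symm)

theorem base_mem_sheet (e : FlatBundle ρ) : (e.base : ℂ) ∈ sheet (sheetAt e.base) :=
  mem_sheet_sheetAt e.base.2

/-! #### The two halves of the bundle -/

/-- The point of the upper half disk over which the disk is folded along the real axis. -/
def fold (z : Disk) : upperHalfDisk :=
  ⟨⟨(z : ℂ).re, |(z : ℂ).im|⟩, by
    have := mem_threeHoledDisk_iff.1 z.2
    simpa [upperHalfDisk, mem_threeHoledDisk_iff, sq_abs] using this⟩

theorem continuous_fold : Continuous fold := by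
  refine Continuous.subtype_mk (Complex.equivRealProdCLM.symm.continuous.comp
    (by fun_prop : Continuous fun z : Disk => ((z : ℂ).re, |(z : ℂ).im|))) _

/-- A point of the upper half disk as a point of the disk. -/
def upBase (q : upperHalfDisk) : Disk := ⟨q, q.2.1⟩

/-- The mirror image in the lower half disk of a point of the upper half disk. -/
def lowBase (q : upperHalfDisk) : Disk :=
  ⟨⟨(q : ℂ).re, -(q : ℂ).im⟩, by
    have := mem_threeHoledDisk_iff.1 q.2.1
    simpa [mem_threeHoledDisk_iff] using this⟩

theorem continuous_upBase : Continuous upBase := continuous_subtype_val.subtype_mk _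

theorem continuous_lowBase : Continuous lowBase :=
  Continuous.subtype_mk (Complex.equivRealProdCLM.symm.continuous.comp
    (by fun_prop : Continuous fun q : upperHalfDisk => ((q : ℂ).re, -(q : ℂ).im))) _

theorem upBase_fold {z : Disk} (h : 0 ≤ (z : ℂ).im) : upBase (fold z) = z :=
  Subtype.ext (Complex.ext rfl (abs_of_nonneg h))

theorem lowBase_fold {z : Disk} (h : (z : ℂ).im ≤ 0) : lowBase (fold z) = z :=
  Subtype.ext (Complex.ext rfl (by simp [lowBase, fold, abs_of_nonpos h]))

theorem fold_upBase (q : upperHalfDisk) : fold (upBase q) = q :=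
  Subtype.ext (Complex.ext rfl (abs_of_nonneg q.2.2))

theorem fold_lowBase (q : upperHalfDisk) : fold (lowBase q) = q :=
  Subtype.ext (Complex.ext rfl (by simp [lowBase, fold, abs_of_nonneg q.2.2]))

variable (ρ) in
/-- The trivialization of the bundle over the upper half disk. -/
def up (p : upperHalfDisk × F) : FlatBundle ρ := pt ρ (upBase p.1) p.2

/-- The shift between the trivialization of the bundle over the lower half disk and the position
in the fiber. -/
def lowShift (z : ℂ) : Free3 := if z.im = 0 then (crossing (sheetAt z))⁻¹ else 1

variable (ρ) in
/-- The trivialization of the bundle over the lower half disk. -/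
def low (p : upperHalfDisk × F) : FlatBundle ρ :=
  pt ρ (lowBase p.1) (ρ (lowShift (lowBase p.1)) p.2)

theorem coord_up (k : Fin 4) (p : upperHalfDisk × F) : (up ρ p).coord k = p.2 :=
  coord_of_nonneg p.1.2.2

theorem coord_low {k : Fin 4} {p : upperHalfDisk × F} (hk : (lowBase p.1 : ℂ) ∈ sheet k) :
    (low ρ p).coord k = ρ (crossing k)⁻¹ p.2 := by
  have h0 : (lowBase p.1 : ℂ).im ≤ 0 := neg_nonpos.2 p.1.2.2
  rcases h0.lt_or_eq with h | h
  · rw [coord_of_neg (by exact h)]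
    change ρ _ (ρ (lowShift (lowBase p.1)) p.2) = _
    rw [lowShift, if_neg h.ne, map_one]; rfl
  · rw [coord_of_nonneg (by exact h.ge)]
    change ρ (lowShift (lowBase p.1)) p.2 = _
    rw [lowShift, if_pos h, sheetAt_eq h hk]

theorem continuous_up : Continuous (up ρ) := by
  refine continuous_iff_continuousAt.2 fun p =>
    continuousAt_of_coord _ (base_mem_sheet _) ?_ ?_
  · exact (continuous_upBase.comp continuous_fst).continuousAt
  · simp only [coord_up]
    exact continuousAt_snd

theorem continuous_low : Continuous (low ρ) := by
  refine continuous_iff_continuousAt.2 fun p =>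
    continuousAt_of_coord _ (base_mem_sheet _) ?_ ?_
  · exact (continuous_lowBase.comp continuous_fst).continuousAt
  · have h1 : ∀ᶠ q : upperHalfDisk × F in 𝓝 p,
        (lowBase q.1 : ℂ) ∈ sheet (sheetAt (low ρ p).base) :=
      (continuous_subtype_val.comp (continuous_lowBase.comp continuous_fst)).continuousAt
        ((isOpen_sheet _).mem_nhds (base_mem_sheet (low ρ p)))
    exact ((ρ _).continuous.comp continuous_snd).continuousAt.congr
      (h1.mono fun q hq => (coord_low hq).symm)

theorem up_of_nonneg {e : FlatBundle ρ} {k : Fin 4} (h : 0 ≤ (e.base : ℂ).im) :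
    up ρ (fold e.base, e.coord k) = e :=
  ext (upBase_fold h) (coord_of_nonneg h)

theorem low_of_nonpos {e : FlatBundle ρ} {k : Fin 4} (hk : (e.base : ℂ) ∈ sheet k)
    (h : (e.base : ℂ).im ≤ 0) :
    low ρ (fold e.base, ρ (crossing k) (e.coord k)) = e := by
  refine ext_coord k (lowBase_fold h) ?_
  rw [coord_low (by rwa [lowBase_fold h]), map_inv]
  exact (ρ (crossing k)).symm_apply_apply _

/-- A map on the bundle is continuous if its restrictions to the two halves are. -/
theorem continuous_of_up_low {A T : Type*} [TopologicalSpace A] [TopologicalSpace T]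
    {h : A × FlatBundle ρ → T}
    (h1 : Continuous fun p : A × (upperHalfDisk × F) => h (p.1, up ρ p.2))
    (h2 : Continuous fun p : A × (upperHalfDisk × F) => h (p.1, low ρ p.2)) : Continuous h := by
  refine continuous_iff_continuousAt.2 fun ⟨a, e⟩ => ?_
  set k := sheetAt e.base
  have hk := base_mem_sheet e
  have him : Continuous fun p : A × FlatBundle ρ => (p.2.base : ℂ).im :=
    Complex.continuous_im.comp
      (continuous_subtype_val.comp (continuous_base.comp continuous_snd))
  have hs : ∀ᶠ p : A × FlatBundle ρ in 𝓝 (a, e), (p.2.base : ℂ) ∈ sheet k :=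
    (continuous_subtype_val.comp (continuous_base.comp continuous_snd)).continuousAt
      ((isOpen_sheet k).mem_nhds hk)
  have hc : ContinuousAt (fun p : A × FlatBundle ρ => p.2.coord k) (a, e) :=
    ContinuousAt.comp (f := Prod.snd) (continuousAt_coord hk) continuousAt_snd
  have hf : Continuous fun p : A × FlatBundle ρ => fold p.2.base :=
    continuous_fold.comp (continuous_base.comp continuous_snd)
  have hup : ContinuousAt (fun p : A × FlatBundle ρ =>
      h (p.1, up ρ (fold p.2.base, p.2.coord k))) (a, e) :=
    h1.continuousAt.comp (f := fun p : A × FlatBundle ρ => (p.1, fold p.2.base, p.2.coord k))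
      (continuousAt_fst.prodMk (hf.continuousAt.prodMk hc))
  have hlow : ContinuousAt (fun p : A × FlatBundle ρ =>
      h (p.1, low ρ (fold p.2.base, ρ (crossing k) (p.2.coord k)))) (a, e) :=
    h2.continuousAt.comp
      (f := fun p : A × FlatBundle ρ => (p.1, fold p.2.base, ρ (crossing k) (p.2.coord k)))
      (continuousAt_fst.prodMk
        (hf.continuousAt.prodMk ((ρ _).continuous.continuousAt.comp hc)))
  intro s hs'
  by_cases h0 : 0 ≤ (e.base : ℂ).im <;> by_cases h0' : (e.base : ℂ).im ≤ 0
  · rw [← up_of_nonneg (k := k) h0] at hs'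
    have hs'' := hs'
    rw [up_of_nonneg h0, ← low_of_nonpos (k := k) hk h0'] at hs''
    rw [Filter.mem_map]
    filter_upwards [hs, hup hs', hlow hs''] with p hp hp1 hp2
    rcases le_total 0 (p.2.base : ℂ).im with h3 | h3
    · rwa [mem_preimage, up_of_nonneg h3] at hp1
    · rwa [mem_preimage, low_of_nonpos hp h3] at hp2
  · rw [← up_of_nonneg (k := k) h0] at hs'
    rw [Filter.mem_map]
    filter_upwards [hup hs', him.continuousAt.eventually_const_lt (not_le.1 h0')] with p hp hp2
    rwa [mem_preimage, up_of_nonneg hp2.le] at hp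
  · rw [← low_of_nonpos (k := k) hk h0'] at hs'
    rw [Filter.mem_map]
    filter_upwards [hs, hlow hs', him.continuousAt.eventually_lt_const (not_le.1 h0)]
      with p hp hp1 hp2
    rwa [mem_preimage, low_of_nonpos hp hp2.le] at hp1
  · exact absurd (le_of_not_ge h0) h0'

end FlatBundle
end FlatBundle

/-! ### The universal cover of the disk with three holes -/

section UniversalCover

/-- The action of a discrete group on itself by left translations. -/
def leftTranslation : Free3 →* (Free3 ≃ₜ Free3) where
  toFun g := Homeomorph.mulLeft g
  map_one' := by ext; simp
  map_mul' g h := by ext; simp [_root_.mul_assoc]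

@[simp] theorem leftTranslation_apply (g h : Free3) : leftTranslation g h = g * h := rfl

/-- The universal cover of the disk with three holes: the flat bundle with fiber the free group. -/
abbrev DiskCover : Type := FlatBundle leftTranslation

theorem FreeGroup.toWord_mk_singleton_mul {α : Type*} [DecidableEq α] (a : α × Bool)
    (g : FreeGroup α) (h : g.toWord.head? ≠ some (a.1, !a.2)) :
    (FreeGroup.mk [a] * g).toWord = a :: g.toWord := by
  rw [FreeGroup.toWord_mul, FreeGroup.toWord_mk, FreeGroup.reduce_singleton, List.singleton_append,
    FreeGroup.reduce.cons, FreeGroup.reduce_toWord]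
  rcases hw : g.toWord with _ | ⟨b, L⟩
  · rfl
  · simp only
    rw [if_neg]
    rintro ⟨h1, h2⟩
    refine h ?_
    rw [hw, List.head?_cons, Option.some.injEq]
    exact Prod.ext h1.symm (by rw [h2, Bool.not_not])

theorem FreeGroup.toWord_eq_cons_of_head? {α : Type*} [DecidableEq α] (a : α × Bool)
    (g : FreeGroup α) (h : g.toWord.head? = some (a.1, !a.2)) :
    g.toWord = (a.1, !a.2) :: (FreeGroup.mk [a] * g).toWord := by
  obtain ⟨L, hL⟩ : ∃ L, g.toWord = (a.1, !a.2) :: L := by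
    rcases hw : g.toWord with _ | ⟨b, L⟩
    · simp [hw] at h
    · rw [hw, List.head?_cons, Option.some.injEq] at h
      exact ⟨L, by rw [h]⟩
  have hr : FreeGroup.reduce L = L := by
    have := FreeGroup.isReduced_toWord (x := g)
    rw [hL] at this
    exact (this.infix (List.suffix_cons _ L).isInfix).reduce_eq
  rw [FreeGroup.toWord_mul, FreeGroup.toWord_mk, FreeGroup.reduce_singleton, List.singleton_append,
    FreeGroup.reduce.cons, FreeGroup.reduce_toWord, hL]
  simp

/-- The group element by which the position in the fiber changes on leaving the upper half of the
universal cover (`b = true`) or the lower half (`b = false`) through the segment `k`. -/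
def step (b : Bool) : Fin 4 → Free3 := Fin.cons 1 fun j => FreeGroup.mk [(j, b)]

theorem step_not_mul_step (b : Bool) (k : Fin 4) : step (!b) k * step b k = 1 := by
  refine Fin.cases rfl (fun j => ?_) k
  change FreeGroup.mk [(j, !b)] * FreeGroup.mk [(j, b)] = 1
  refine mul_eq_one_iff_inv_eq.2 ?_
  rw [FreeGroup.inv_mk]
  simp [FreeGroup.invRev]

theorem step_false (k : Fin 4) : step false k = (crossing k)⁻¹ :=
  eq_inv_of_mul_eq_one_left (step_not_mul_step true k)

/-- The segment through which the half disk `(b, g)` is left on the way to the root: if the first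
letter of `g` can be cancelled, it is the corresponding segment. -/
def exitSegment (v : Bool × Free3) : Fin 4 :=
  match v.2.toWord.head? with
  | some (j, c) => if c = !v.1 then j.succ else 0
  | none => 0

theorem exitSegment_eq_succ_iff {b : Bool} {g : Free3} {j : Fin 3} :
    exitSegment (b, g) = j.succ ↔ g.toWord.head? = some (j, !b) := by
  unfold exitSegment
  rcases h : g.toWord.head? with _ | ⟨i, c⟩
  · simp [(Fin.succ_ne_zero j).symm]
  · simp only [Option.some.injEq, Prod.mk.injEq]
    split_ifs with hc
    · simp [hc]
    · simp [hc, (Fin.succ_ne_zero j).symm]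

theorem exitSegment_eq_zero {b : Bool} {g : Free3} {j : Fin 3}
    (h : g.toWord.head? = some (j, b)) : exitSegment (b, g) = 0 := by
  simp [exitSegment, h]

theorem exitSegment_one (b : Bool) : exitSegment (b, 1) = 0 := by
  simp [exitSegment]

/-- The universal cover of the disk with three holes is a tree of half disks. -/
def coverTree : TileTree (Bool × Free3) where
  nbr k v := (!v.1, step v.1 k * v.2)
  root := (true, 1)
  exit := exitSegment
  rank v := 2 * v.2.norm + if exitSegment v = 0 ∧ v ≠ (true, 1) then 1 else 0
  nbr_nbr k v := by
    rw [← _root_.mul_assoc, step_not_mul_step, one_mul, Bool.not_not]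
  exit_or k v := by
    obtain ⟨b, g⟩ := v
    induction k using Fin.cases with
    | zero =>
      change (_ ∧ _) ∨ ((!b, 1 * g) ≠ _ ∧ exitSegment (!b, 1 * g) = 0)
      rw [one_mul]
      rcases hw : g.toWord.head? with _ | ⟨j, c⟩
      · have hg : g = 1 := FreeGroup.toWord_eq_nil_iff.1 (List.head?_eq_none_iff.1 hw)
        subst hg
        cases b
        · exact Or.inl ⟨by simp, exitSegment_one _⟩
        · exact Or.inr ⟨by simp, exitSegment_one _⟩
      · have hg : g ≠ 1 := by rintro rfl; simp at hw
        rcases Bool.eq_or_eq_not c b with rfl | rfl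
        · exact Or.inl ⟨by simp [hg], exitSegment_eq_zero hw⟩
        · exact Or.inr ⟨by simp [hg], exitSegment_eq_zero hw⟩
    | succ j =>
      change (_ ∧ _) ∨ ((!b, FreeGroup.mk [(j, b)] * g) ≠ _ ∧
        exitSegment (!b, FreeGroup.mk [(j, b)] * g) = j.succ)
      by_cases hw : g.toWord.head? = some (j, !b)
      · refine Or.inl ⟨?_, exitSegment_eq_succ_iff.2 hw⟩
        intro h
        rw [(Prod.mk.inj h).2] at hw
        simp at hw
      · have h1 := FreeGroup.toWord_mk_singleton_mul (j, b) g hw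
        refine Or.inr ⟨fun h => ?_, exitSegment_eq_succ_iff.2 (by rw [h1]; simp)⟩
        rw [(Prod.mk.inj h).2] at h1
        simp at h1
  rank_lt v hv := by
    obtain ⟨b, g⟩ := v
    change 2 * FreeGroup.norm (step b (exitSegment (b, g)) * g) +
        (if exitSegment (!b, step b (exitSegment (b, g)) * g) = 0 ∧
          (!b, step b (exitSegment (b, g)) * g) ≠ (true, 1) then 1 else 0) <
      2 * FreeGroup.norm g + if exitSegment (b, g) = 0 ∧ (b, g) ≠ (true, 1) then 1 else 0
    rcases Fin.eq_zero_or_eq_succ (exitSegment (b, g)) with h0 | ⟨j, hj⟩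
    · have h1 : step b (exitSegment (b, g)) * g = g := by rw [h0]; exact one_mul g
      rw [h1, if_neg, if_pos ⟨h0, hv⟩]
      · exact Nat.lt_succ_self _
      rintro ⟨h2, h3⟩
      rcases hw : g.toWord.head? with _ | ⟨j, c⟩
      · have hg : g = 1 := FreeGroup.toWord_eq_nil_iff.1 (List.head?_eq_none_iff.1 hw)
        subst hg
        cases b
        · exact absurd rfl h3
        · exact absurd rfl hv
      · rcases Bool.eq_or_eq_not c b with rfl | rfl
        · have := exitSegment_eq_succ_iff (b := !c) (g := g) (j := j)
          rw [Bool.not_not] at this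
          exact (Fin.succ_ne_zero j) ((this.2 hw).symm.trans h2)
        · exact (Fin.succ_ne_zero j) ((exitSegment_eq_succ_iff.2 hw).symm.trans h0)
    · have h1 := FreeGroup.toWord_eq_cons_of_head? (j, b) g (exitSegment_eq_succ_iff.1 hj)
      have h2 : g.norm = (FreeGroup.mk [(j, b)] * g).norm + 1 := by
        rw [FreeGroup.norm, h1, List.length_cons]; rfl
      rw [hj]
      change 2 * FreeGroup.norm (FreeGroup.mk [(j, b)] * g) + _ < _
      rw [h2]
      split_ifs <;> omega

/-- The tiles of the universal cover. -/
def coverTile (v : Bool × Free3) : C(upperHalfDisk, DiskCover) where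
  toFun q := if v.1 then FlatBundle.up _ (q, v.2) else FlatBundle.low _ (q, v.2)
  continuous_toFun := by
    obtain ⟨b, g⟩ := v
    cases b
    · exact FlatBundle.continuous_low.comp (by fun_prop : Continuous fun q => (q, g))
    · exact FlatBundle.continuous_up.comp (by fun_prop : Continuous fun q => (q, g))

theorem coverTile_true (g : Free3) (q : upperHalfDisk) :
    coverTile (true, g) q = FlatBundle.up _ (q, g) := rfl

theorem coverTile_false (g : Free3) (q : upperHalfDisk) :
    coverTile (false, g) q = FlatBundle.low _ (q, g) := rfl

theorem lowBase_eq_upBase {q : upperHalfDisk} (h : (q : ℂ).im = 0) :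
    FlatBundle.lowBase q = FlatBundle.upBase q :=
  Subtype.ext (Complex.ext rfl (by simp [FlatBundle.lowBase, FlatBundle.upBase, h]))

theorem up_eq_low {q : upperHalfDisk} {k : Fin 4} (hq : q ∈ realSegment k) (g : Free3) :
    FlatBundle.up leftTranslation (q, g) = FlatBundle.low leftTranslation (q, crossing k * g) := by
  have h1 : (FlatBundle.lowBase q : ℂ) ∈ sheet k := by
    rw [lowBase_eq_upBase hq.1]
    exact mem_sheet_of_mem_seg hq.2
  refine FlatBundle.ext_coord k (lowBase_eq_upBase hq.1).symm ?_
  rw [FlatBundle.coord_low h1, FlatBundle.coord_up, leftTranslation_apply, inv_mul_cancel_left]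

theorem coverTile_glue (k : Fin 4) (v : Bool × Free3) (q : upperHalfDisk) (hq : q ∈ realSegment k) :
    coverTile v q = coverTile (coverTree.nbr k v) q := by
  obtain ⟨b, g⟩ := v
  cases b
  · change FlatBundle.low _ (q, g) = FlatBundle.up _ (q, step false k * g)
    rw [up_eq_low hq, step_false, mul_inv_cancel_left]
  · exact up_eq_low hq g

open unitInterval

/-- The tile which contains a point of the universal cover. -/
def tileOf (e : DiskCover) : Bool × Free3 :=
  if 0 ≤ (e.base : ℂ).im then (true, e.fib) else (false, e.fib)

theorem move_tileOf_up (τ : I) (p : upperHalfDisk × Free3) :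
    coverTree.move coverTile (tileOf (FlatBundle.up _ p)) τ
      (FlatBundle.fold (FlatBundle.up leftTranslation p).base) =
    coverTree.move coverTile (true, p.2) τ p.1 := by
  rw [tileOf, if_pos (show 0 ≤ ((FlatBundle.up leftTranslation p).base : ℂ).im from p.1.2.2)]
  change coverTree.move coverTile (true, p.2) τ (FlatBundle.fold (FlatBundle.upBase p.1)) = _
  rw [FlatBundle.fold_upBase]

theorem move_tileOf_low (τ : I) (p : upperHalfDisk × Free3) :
    coverTree.move coverTile (tileOf (FlatBundle.low _ p)) τ
      (FlatBundle.fold (FlatBundle.low leftTranslation p).base) =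
    coverTree.move coverTile (false, p.2) τ p.1 := by
  obtain ⟨q, g⟩ := p
  rcases q.2.2.eq_or_lt with h | h
  · have hk := FlatBundle.base_mem_sheet (FlatBundle.low leftTranslation (q, g))
    have hq : q ∈ realSegment (sheetAt (FlatBundle.low leftTranslation (q, g)).base) := by
      have h2 := mem_seg_of_im_eq (FlatBundle.low leftTranslation (q, g)).base.2
        (by change -(q : ℂ).im = 0; rw [← h, neg_zero]) hk
      exact ⟨h.symm, h2⟩
    rw [coverTree.move_glue _ coverTile_glue _ (false, g) τ hq]
    change _ = coverTree.move coverTile (true, step false _ * g) τ q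
    rw [← move_tileOf_up τ (q, step false _ * g)]
    rw [up_eq_low hq, step_false, mul_inv_cancel_left]
  · rw [tileOf, if_neg (show ¬ 0 ≤ ((FlatBundle.low leftTranslation (q, g)).base : ℂ).im from
      not_le.2 (neg_neg_of_pos h))]
    change coverTree.move coverTile (false, leftTranslation (FlatBundle.lowShift _) g) τ
      (FlatBundle.fold (FlatBundle.lowBase q)) = _
    rw [FlatBundle.fold_lowBase, FlatBundle.lowShift,
      if_neg (show ((FlatBundle.lowBase q : Disk) : ℂ).im ≠ 0 from (neg_neg_of_pos h).ne), map_one]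
    rfl

instance : ContractibleSpace DiskCover := by
  rw [contractible_iff_id_nullhomotopic]
  have hcont : Continuous fun p : I × DiskCover =>
      coverTree.move coverTile (tileOf p.2) p.1 (FlatBundle.fold p.2.base) := by
    have key : ∀ b, Continuous fun p : I × (upperHalfDisk × Free3) =>
        coverTree.move coverTile (b, p.2.2) p.1 p.2.1 := fun b => by
      have h1 : Continuous fun p : (I × upperHalfDisk) × Free3 =>
          coverTree.move coverTile (b, p.2) p.1.1 p.1.2 :=
        continuous_prod_of_discrete_right.2 fun g =>
          coverTree.continuous_move coverTile coverTile_glue (b, g)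
      exact h1.comp (by fun_prop :
        Continuous fun p : I × (upperHalfDisk × Free3) => ((p.1, p.2.1), p.2.2))
    refine FlatBundle.continuous_of_up_low ?_ ?_
    · simp only [move_tileOf_up]; exact key true
    · simp only [move_tileOf_low]; exact key false
  refine ⟨coverTree.move coverTile coverTree.root 1 (FlatBundle.fold ⟨-3 * Complex.I, ?_⟩), ⟨?_⟩⟩
  · rw [mem_threeHoledDisk_iff]; norm_num
  · refine ⟨⟨_, hcont⟩, fun e => ?_, fun e => coverTree.move_one coverTile _ _ _⟩
    change coverTree.move coverTile (tileOf e) 0 (FlatBundle.fold e.base) = e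
    rw [coverTree.move_zero]
    by_cases h : 0 ≤ (e.base : ℂ).im
    · rw [tileOf, if_pos h, coverTile_true]
      conv_rhs => rw [← FlatBundle.up_of_nonneg (k := 0) h]
      rw [FlatBundle.coord_of_nonneg h]
    · have h' := not_le.1 h
      rw [tileOf, if_neg h, coverTile_false]
      conv_rhs => rw [← FlatBundle.low_of_nonpos (k := 0) (Or.inl h'.ne) h'.le]
      rw [FlatBundle.coord_of_neg h', map_inv]
      congr 2
      exact ((leftTranslation (crossing 0)).apply_symm_apply _).symm

end UniversalCover

/-! ### Coverings of flat bundles -/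

section BundleCover

section
variable {F : Type} [TopologicalSpace F] (ρ : Free3 →* (F ≃ₜ F))

/-- The covering of a flat bundle by the product of the universal cover of the base and the
fiber. -/
def developing (x : DiskCover × F) : FlatBundle ρ := FlatBundle.pt ρ x.1.base (ρ x.1.fib x.2)

theorem coord_developing (k : Fin 4) (x : DiskCover × F) :
    (developing ρ x).coord k = ρ (x.1.coord k) x.2 := by
  change ρ (shift k x.1.base)⁻¹ (ρ x.1.fib x.2) = ρ ((shift k x.1.base)⁻¹ * x.1.fib) x.2
  rw [map_mul, Homeomorph.mul_apply]

theorem continuous_developing : Continuous (developing ρ) := by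
  refine continuous_iff_continuousAt.2 fun x =>
    FlatBundle.continuousAt_of_coord _ (FlatBundle.base_mem_sheet _) ?_ ?_
  · exact (FlatBundle.continuous_base.comp continuous_fst).continuousAt
  · simp only [coord_developing]
    have h1 : Continuous fun p : Free3 × F => ρ p.1 p.2 :=
      continuous_prod_of_discrete_left.2 fun g => (ρ g).continuous
    exact h1.continuousAt.comp
      (f := fun y : DiskCover × F => (y.1.coord (sheetAt (developing ρ x).base), y.2))
      ((ContinuousAt.comp (f := Prod.fst) (FlatBundle.continuousAt_coord
        (FlatBundle.base_mem_sheet x.1)) continuousAt_fst).prodMk continuousAt_snd)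

theorem developing_surjective : Function.Surjective (developing ρ) := fun e =>
  ⟨(FlatBundle.pt _ e.base 1, e.fib), FlatBundle.ext rfl (by
    change ρ 1 e.fib = _
    rw [map_one]; rfl)⟩

/-- Through each point there is a local section of the covering: it keeps the coordinate in the
universal cover fixed. -/
theorem isOpenMap_developing : IsOpenMap (developing ρ) := by
  refine IsOpenMap.of_sections fun x => ?_
  set k := sheetAt x.1.base
  have hk : (x.1.base : ℂ) ∈ sheet k := FlatBundle.base_mem_sheet x.1
  set g := x.1.coord k
  refine ⟨fun e => (FlatBundle.pt _ e.base (leftTranslation (shift k e.base) g),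
    ρ g⁻¹ (e.coord k)), ?_, ?_, fun e => ?_⟩
  · refine ContinuousAt.prodMk (FlatBundle.continuousAt_of_coord k hk ?_ ?_) ?_
    · exact FlatBundle.continuous_base.continuousAt
    · simp only [FlatBundle.coord_pt_shift]
      exact continuousAt_const
    · exact (ρ g⁻¹).continuous.continuousAt.comp
        (FlatBundle.continuousAt_coord (e := developing ρ x) hk)
  · refine Prod.ext (FlatBundle.ext_coord k rfl ?_) ?_
    · rw [FlatBundle.coord_pt_shift]
    · change ρ g⁻¹ ((developing ρ x).coord k) = x.2
      rw [coord_developing, map_inv]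
      exact (ρ g).symm_apply_apply x.2
  · refine FlatBundle.ext_coord k rfl ?_
    rw [coord_developing, FlatBundle.coord_pt_shift, map_inv]
    exact (ρ g).apply_symm_apply _

/-- The action of the free group on the covering of a flat bundle by deck transformations. -/
abbrev deckAction : MulAction Free3 (DiskCover × F) where
  smul h x := (FlatBundle.pt _ x.1.base (x.1.fib * h⁻¹), ρ h x.2)
  one_smul x := by
    change (FlatBundle.pt _ x.1.base (x.1.fib * 1⁻¹), ρ 1 x.2) = x
    rw [inv_one, mul_one, map_one]; rfl
  mul_smul h h' x := by
    change (FlatBundle.pt _ x.1.base (x.1.fib * (h * h')⁻¹), ρ (h * h') x.2) =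
      (FlatBundle.pt _ x.1.base (x.1.fib * h'⁻¹ * h⁻¹), ρ h (ρ h' x.2))
    rw [mul_inv_rev, _root_.mul_assoc, map_mul]; rfl

theorem isQuotientCoveringMap_developing :
    letI := deckAction ρ
    IsQuotientCoveringMap (developing ρ) Free3 := by
  let := deckAction ρ
  have smul_def : ∀ (h : Free3) (x : DiskCover × F),
    h • x = (FlatBundle.pt _ x.1.base (x.1.fib * h⁻¹), ρ h x.2) := fun _ _ => rfl
  have coord_smul : ∀ (k : Fin 4) (h : Free3) (x : DiskCover × F),
    (h • x).1.coord k = x.1.coord k * h⁻¹ := fun k h x => (_root_.mul_assoc _ _ _).symm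
  refine (isQuotientCoveringMap_iff ..).2 ⟨?_, ⟨fun g => ?_⟩, fun {x y} => ?_, fun x => ?_⟩
  · exact (isOpenMap_developing ρ).isQuotientMap (continuous_developing ρ)
      (developing_surjective ρ)
  · refine continuous_iff_continuousAt.2 fun x => ContinuousAt.prodMk
      (FlatBundle.continuousAt_of_coord _ (FlatBundle.base_mem_sheet x.1)
        (FlatBundle.continuous_base.comp continuous_fst).continuousAt ?_)
      ((ρ g).continuous.comp continuous_snd).continuousAt
    have h1 : Continuous fun h : Free3 => h * g⁻¹ := continuous_of_discreteTopology
    have h2 := ContinuousAt.comp (f := fun y : DiskCover × F => y.1.coord (sheetAt x.1.base))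
      (x := x) h1.continuousAt (ContinuousAt.comp (f := Prod.fst) (FlatBundle.continuousAt_coord
        (FlatBundle.base_mem_sheet x.1)) continuousAt_fst)
    exact h2.congr (.of_forall fun y => (coord_smul _ _ _).symm)
  · constructor
    · intro h
      have h1 : x.1.base = y.1.base := congrArg (FlatBundle.base (ρ := ρ)) h
      have h2 : ρ x.1.fib x.2 = ρ y.1.fib y.2 := congrArg (FlatBundle.fib (ρ := ρ)) h
      refine ⟨x.1.fib⁻¹ * y.1.fib, ?_⟩
      change (FlatBundle.pt _ y.1.base (y.1.fib * (x.1.fib⁻¹ * y.1.fib)⁻¹),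
        ρ (x.1.fib⁻¹ * y.1.fib) y.2) = x
      rw [map_mul, Homeomorph.mul_apply, ← h2, ← Homeomorph.mul_apply, ← map_mul, inv_mul_cancel,
        map_one, mul_inv_rev, mul_inv_cancel_left, inv_inv, ← h1]
      rfl
    · rintro ⟨g, rfl⟩
      refine FlatBundle.ext rfl ?_
      change ρ (y.1.fib * g⁻¹) (ρ g y.2) = ρ y.1.fib y.2
      rw [← Homeomorph.mul_apply, ← map_mul, inv_mul_cancel_right]
  · set k := sheetAt x.1.base
    have hc := (ContinuousAt.comp (f := Prod.fst) (x := x) (FlatBundle.continuousAt_coord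
      (FlatBundle.base_mem_sheet x.1)) continuousAt_fst)
    refine ⟨_, hc (mem_nhds_discrete.2 (mem_singleton (x.1.coord k))), ?_⟩
    rintro g ⟨_, ⟨y, hy, rfl⟩, hy'⟩
    have h1 : y.1.coord k = x.1.coord k := hy
    have h2 : (g • y).1.coord k = x.1.coord k := hy'
    rw [coord_smul, h1] at h2
    simpa using h2

theorem hasUniqueLifting_developing : HasUniqueLifting (developing ρ) :=
  letI := deckAction ρ
  (isQuotientCoveringMap_developing ρ).isCoveringMap.hasUniqueLifting

/-- The free group acts on the covering of the bundle by deck transformations; the covering and its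
product with a three point space have Euler characteristic zero, because of the circle factors. -/
theorem FlatBundle.hasEulerCharacteristic_torus (ρ : Free3 →* (Torus ≃ₜ Torus)) :
    HasEulerCharacteristic (FlatBundle ρ) 0 := by
  have key : ∀ (P : Type) [TopologicalSpace P] [DiscreteTopology P] [Finite P],
      HasEulerCharacteristic (P × (DiskCover × Torus)) 0 := fun P _ _ _ => by
    obtain ⟨k, hk⟩ := exists_hasEulerCharacteristic_of_finite P
    have h1 := hk.congr (ContractibleSpace.nonempty_prod_homotopyEquiv P DiskCover).some
    have h2 := h1.prod_circle.prod_circle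
    exact h2.congr ((Homeomorph.prodAssoc (P × DiskCover) Circle Circle).trans
      (Homeomorph.prodAssoc P DiskCover Torus)).toHomotopyEquiv
  let := deckAction ρ
  have h1 := (key Unit).congr (Homeomorph.punitProd (DiskCover × Torus)).toHomotopyEquiv
  simpa using (isQuotientCoveringMap_developing ρ).hasEulerCharacteristic (key (Fin 3)) h1
end

/-- The covering of the torus by the plane. -/
def planeToTorus (v : ℝ × ℝ) : Torus :=
  (Circle.exp (2 * Real.pi * v.1), Circle.exp (2 * Real.pi * v.2))

theorem circleExp_surjective : Function.Surjective Circle.exp := fun z => ⟨_, Circle.exp_arg z⟩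

theorem Homeomorph.hasUniqueLifting {E X : Type} [TopologicalSpace E] [TopologicalSpace X]
    (h : E ≃ₜ X) : HasUniqueLifting h where
  continuous := h.continuous
  exists_lift f a e he :=
    ⟨⟨h.symm ∘ f, h.symm.continuous.comp f.continuous⟩, by
      rw [ContinuousMap.coe_mk, Function.comp_apply, ← he, h.symm_apply_apply],
      fun x => h.apply_symm_apply _⟩
  eq_of_comp_eq F F' hF _ _ x := h.injective (hF x)

theorem planeToTorus_eq :
    planeToTorus = Prod.map Circle.exp Circle.exp ∘
      Prod.map (fun t => 2 * Real.pi * t) (fun t => 2 * Real.pi * t) := rfl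

theorem planeToTorus_surjective : Function.Surjective planeToTorus := by
  have h : Function.Surjective fun t : ℝ => 2 * Real.pi * t :=
    mul_left_surjective₀ Real.two_pi_pos.ne'
  rw [planeToTorus_eq]
  exact (circleExp_surjective.prodMap circleExp_surjective).comp (h.prodMap h)

theorem hasUniqueLifting_planeToTorus : HasUniqueLifting planeToTorus := by
  have h : HasUniqueLifting fun t : ℝ => 2 * Real.pi * t :=
    (Homeomorph.mulLeft₀ (2 * Real.pi) Real.two_pi_pos.ne').hasUniqueLifting
  rw [planeToTorus_eq]
  have h' := isCoveringMap_circleExp.hasUniqueLifting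
  exact (h'.prodMap h').comp (h.prodMap h)

variable (ρ : Free3 →* (Torus ≃ₜ Torus))

/-- The contractible covering of a flat torus bundle. -/
def bundleCover : DiskCover × (ℝ × ℝ) → FlatBundle ρ := developing ρ ∘ Prod.map id planeToTorus

theorem hasUniqueLifting_bundleCover : HasUniqueLifting (bundleCover ρ) :=
  (hasUniqueLifting_developing ρ).comp (hasUniqueLifting_id.prodMap hasUniqueLifting_planeToTorus)

theorem bundleCover_surjective : Function.Surjective (bundleCover ρ) :=
  (developing_surjective ρ).comp (Function.surjective_id.prodMap planeToTorus_surjective)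

theorem FlatBundle.isAspherical_torus : IsAspherical (FlatBundle ρ) :=
  (hasUniqueLifting_bundleCover ρ).isAspherical (bundleCover_surjective ρ)

end BundleCover

/-! ### The bundle over the boundary circles -/

section BoundaryLoops

theorem boundaryLoop_eq (i : Fin 4) (t : ℝ) : boundaryLoop i t =
    circleCenter i - circleRadius i * Complex.I * ((Real.cos (2 * Real.pi * t) : ℝ) -
      (Real.sin (2 * Real.pi * t) : ℝ) * Complex.I) := by
  rw [boundaryLoop, show -(2 * Real.pi * t * Complex.I) = ((-(2 * Real.pi * t) : ℝ) : ℂ) * Complex.I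
    by push_cast; ring, Complex.exp_mul_I, ← Complex.ofReal_cos, ← Complex.ofReal_sin, Real.cos_neg,
    Real.sin_neg, Complex.ofReal_neg, neg_mul, ← sub_eq_add_neg]

theorem boundaryLoop_re (i : Fin 4) (t : ℝ) : (boundaryLoop i t).re =
    (circleCenter i).re - circleRadius i * Real.sin (2 * Real.pi * t) := by
  rw [boundaryLoop_eq]
  generalize Real.cos (2 * Real.pi * t) = c
  generalize Real.sin (2 * Real.pi * t) = s
  simp

theorem circleCenter_im (i : Fin 4) : (circleCenter i).im = 0 := by
  fin_cases i <;> simp [circleCenter]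

theorem circleRadius_pos (i : Fin 4) : 0 < circleRadius i := by
  fin_cases i <;> simp [circleRadius]

theorem boundaryLoop_im (i : Fin 4) (t : ℝ) : (boundaryLoop i t).im =
    -(circleRadius i * Real.cos (2 * Real.pi * t)) := by
  rw [boundaryLoop_eq]
  generalize Real.cos (2 * Real.pi * t) = c
  generalize Real.sin (2 * Real.pi * t) = s
  simp [circleCenter_im]

theorem boundaryLoop_add_int (i : Fin 4) (t : ℝ) (n : ℤ) :
    boundaryLoop i (t + n) = boundaryLoop i t := by
  have h : 2 * Real.pi * (t + n) = 2 * Real.pi * t + n * (2 * Real.pi) := by ring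
  apply Complex.ext
  · rw [boundaryLoop_re, boundaryLoop_re, h, Real.sin_add_int_mul_two_pi]
  · rw [boundaryLoop_im, boundaryLoop_im, h, Real.cos_add_int_mul_two_pi]

theorem boundaryLoop_eq_iff {i : Fin 4} {t t' : ℝ} :
    boundaryLoop i t = boundaryLoop i t' ↔ ∃ n : ℤ, t' = t + n := by
  constructor
  · intro h
    have h0 := (circleRadius_pos i).ne'
    have h1 := congrArg Complex.re h
    have h2 := congrArg Complex.im h
    rw [boundaryLoop_re, boundaryLoop_re, sub_right_inj, mul_right_inj' h0] at h1
    rw [boundaryLoop_im, boundaryLoop_im, neg_inj, mul_right_inj' h0] at h2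
    have h3 : Circle.exp (2 * Real.pi * t') = Circle.exp (2 * Real.pi * t) := by
      apply Circle.ext
      rw [Circle.coe_exp, Circle.coe_exp, Complex.exp_mul_I, Complex.exp_mul_I,
        ← Complex.ofReal_cos, ← Complex.ofReal_sin, ← Complex.ofReal_cos, ← Complex.ofReal_sin,
        h1, h2]
    obtain ⟨m, hm⟩ := Circle.exp_eq_exp.1 h3
    refine ⟨m, ?_⟩
    have : 2 * Real.pi * t' = 2 * Real.pi * (t + m) := by rw [hm]; ring
    exact mul_left_cancel₀ Real.two_pi_pos.ne' this
  · rintro ⟨n, rfl⟩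
    exact (boundaryLoop_add_int i t n).symm

theorem continuous_boundaryLoop (i : Fin 4) : Continuous (boundaryLoop i) := by
  unfold boundaryLoop; fun_prop

theorem boundaryLoop_mem (i : Fin 4) (t : ℝ) : boundaryLoop i t ∈ threeHoledDisk := by
  rw [mem_threeHoledDisk_iff, boundaryLoop_re, boundaryLoop_im]
  have h := Real.sin_sq_add_cos_sq (2 * Real.pi * t)
  have h1 := Real.sin_le_one (2 * Real.pi * t)
  have h2 := Real.neg_one_le_sin (2 * Real.pi * t)
  fin_cases i <;> simp [circleCenter, circleRadius] <;> refine ⟨?_, ?_, ?_, ?_⟩ <;> nlinarith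

theorem boundaryLoop_im_neg {i : Fin 4} {t : ℝ} {n : ℤ} (h : |t - n| < 1 / 4) :
    (boundaryLoop i t).im < 0 := by
  rw [boundaryLoop_im, neg_lt_zero]
  refine mul_pos (circleRadius_pos i) ?_
  rw [abs_lt] at h
  have h3 := Real.pi_pos
  rw [show 2 * Real.pi * t = 2 * Real.pi * (t - n) + n * (2 * Real.pi) by ring,
    Real.cos_add_int_mul_two_pi]
  exact Real.cos_pos_of_mem_Ioo ⟨by nlinarith, by nlinarith⟩

theorem boundaryLoop_im_nonneg {i : Fin 4} {t : ℝ} {n : ℤ} (h : 1 / 4 ≤ t - n)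
    (h' : t - n ≤ 3 / 4) : 0 ≤ (boundaryLoop i t).im := by
  rw [boundaryLoop_im, neg_nonneg]
  refine mul_nonpos_of_nonneg_of_nonpos (circleRadius_pos i).le ?_
  have h3 := Real.pi_pos
  rw [show 2 * Real.pi * t = 2 * Real.pi * (t - n) + n * (2 * Real.pi) by ring,
    Real.cos_add_int_mul_two_pi]
  exact Real.cos_nonpos_of_pi_div_two_le_of_le (by nlinarith) (by nlinarith)

/-- The segment of the real axis on which the boundary circle crosses upwards: it ends at the
leftmost point of an inner circle, and begins at that of the outer circle. -/
def leftSegment : Fin 4 → Fin 4 := ![0, 1, 2, 0]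

/-- The segment of the real axis on which the boundary circle crosses downwards, at its rightmost
point. -/
def rightSegment : Fin 4 → Fin 4 := ![1, 2, 3, 3]

/-- The element of the free group represented by the boundary circle. -/
def peripheral (i : Fin 4) : Free3 := crossing (leftSegment i) * (crossing (rightSegment i))⁻¹

/-- The position in the fiber of a horizontal lift of the boundary circle, starting at `1`. It is
constant between the passages through the real axis; in the course of each turn it is multiplied
from the right by the inverse of `peripheral i`. -/
def loopLift (i : Fin 4) (t : ℝ) : Free3 :=
  if (boundaryLoop i t).im < 0 then peripheral i ^ (-round t)
  else (crossing (leftSegment i))⁻¹ * peripheral i ^ (-⌊t⌋)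

theorem loopLift_add_int (i : Fin 4) (t : ℝ) (n : ℤ) :
    loopLift i (t + n) = loopLift i t * peripheral i ^ (-n) := by
  rw [loopLift, loopLift, boundaryLoop_add_int, round_add_intCast, Int.floor_add_intCast]
  split_ifs
  · rw [neg_add, zpow_add]
  · rw [neg_add, zpow_add, _root_.mul_assoc]

theorem shift_mul_loopLift_lower {i k : Fin 4} {t : ℝ} {n : ℤ} (h : |t - n| < 1 / 4) :
    (shift k (boundaryLoop i t))⁻¹ * loopLift i t =
      (crossing k)⁻¹ * peripheral i ^ (-n) := by
  have h1 := boundaryLoop_im_neg (i := i) h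
  rw [loopLift, if_pos h1, shift_of_neg h1]
  congr 3
  rw [abs_lt] at h
  rw [round_eq, Int.floor_eq_iff]
  constructor <;> linarith

theorem shift_mul_loopLift_upper {i k : Fin 4} {t : ℝ} {n : ℤ} (h : 1 / 4 ≤ t - n)
    (h' : t - n ≤ 3 / 4) : (shift k (boundaryLoop i t))⁻¹ * loopLift i t =
      (crossing (leftSegment i))⁻¹ * peripheral i ^ (-n) := by
  have h1 := boundaryLoop_im_nonneg (i := i) h h'
  rw [loopLift, if_neg (not_lt.2 h1), shift_of_nonneg h1, inv_one, one_mul]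
  congr 3
  rw [Int.floor_eq_iff]
  constructor <;> linarith

theorem boundaryLoop_left (i : Fin 4) (n : ℤ) : (boundaryLoop i (1 / 4 + n)).im = 0 ∧
    boundaryLoop i (1 / 4 + n) ∈ sheet (leftSegment i) := by
  have h : 2 * Real.pi * (1 / 4) = Real.pi / 2 := by ring
  rw [boundaryLoop_add_int]
  refine ⟨by rw [boundaryLoop_im, h, Real.cos_pi_div_two]; simp, Or.inr ?_⟩
  rw [boundaryLoop_re, h, Real.sin_pi_div_two]
  fin_cases i <;> simp [circleCenter, circleRadius, leftSegment, cutLeft, cutRight] <;> norm_num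

theorem boundaryLoop_right (i : Fin 4) (n : ℤ) : (boundaryLoop i (3 / 4 + n)).im = 0 ∧
    boundaryLoop i (3 / 4 + n) ∈ sheet (rightSegment i) := by
  have h : 2 * Real.pi * (3 / 4) = Real.pi / 2 + Real.pi := by ring
  rw [boundaryLoop_add_int]
  refine ⟨by rw [boundaryLoop_im, h, Real.cos_add_pi, Real.cos_pi_div_two]; simp, Or.inr ?_⟩
  rw [boundaryLoop_re, h, Real.sin_add_pi, Real.sin_pi_div_two]
  fin_cases i <;> simp [circleCenter, circleRadius, rightSegment, cutLeft, cutRight] <;> norm_num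

/-- With respect to each sheet the coordinate of the lift of the boundary circle is locally
constant. -/
theorem eventually_shift_mul_loopLift {i k : Fin 4} {t : ℝ} (h : boundaryLoop i t ∈ sheet k) :
    ∀ᶠ s in 𝓝 t, (shift k (boundaryLoop i s))⁻¹ * loopLift i s =
      (shift k (boundaryLoop i t))⁻¹ * loopLift i t := by
  have near : ∀ {a b : ℝ}, a < t → t < b → ∀ᶠ s in 𝓝 t, a < s ∧ s < b := fun ha hb =>
    (lt_mem_nhds ha).and (gt_mem_nhds hb)
  obtain ⟨n, hn, hn'⟩ : ∃ n : ℤ, n ≤ t + 1 / 4 ∧ t + 1 / 4 < n + 1 :=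
    ⟨_, Int.floor_le _, Int.lt_floor_add_one _⟩
  rcases hn.eq_or_lt with h0 | h0
  · -- crossing the segment on the right at `t = n - 1 / 4`
    have ht : t = 3 / 4 + ((n - 1 : ℤ) : ℝ) := by push_cast; linarith
    have hr := boundaryLoop_right i (n - 1)
    rw [← ht] at hr
    obtain rfl : k = rightSegment i := (sheetAt_eq hr.1 h).symm.trans (sheetAt_eq hr.1 hr.2)
    have hup : ∀ s, t - 1 / 4 < s → s ≤ t →
        (shift (rightSegment i) (boundaryLoop i s))⁻¹ * loopLift i s =
          (crossing (leftSegment i))⁻¹ * peripheral i ^ (-(n - 1)) := fun s h1 h2 =>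
      shift_mul_loopLift_upper (by push_cast; linarith) (by push_cast; linarith)
    filter_upwards [near (by linarith : t - 1 / 4 < t) (by linarith : t < t + 1 / 4)] with s hs
    rw [hup t (by linarith) le_rfl]
    rcases le_or_gt s t with h1 | h1
    · exact hup s hs.1 h1
    · rw [shift_mul_loopLift_lower (n := n) (by rw [abs_lt]; constructor <;> linarith),
        show -(n - 1) = 1 + -n by ring, zpow_one_add, ← _root_.mul_assoc]
      congr 1
      rw [peripheral, inv_mul_cancel_left]
  · rcases lt_trichotomy (t - n) (1 / 4) with h1 | h1 | h1
    · filter_upwards [near (by linarith : (n : ℝ) - 1 / 4 < t) (by linarith : t < n + 1 / 4)]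
        with s hs
      rw [shift_mul_loopLift_lower (n := n) (by rw [abs_lt]; constructor <;> linarith),
        shift_mul_loopLift_lower (n := n) (by rw [abs_lt]; constructor <;> linarith)]
    · have ht : t = 1 / 4 + (n : ℝ) := by linarith
      have hl := boundaryLoop_left i n
      rw [← ht] at hl
      obtain rfl : k = leftSegment i := (sheetAt_eq hl.1 h).symm.trans (sheetAt_eq hl.1 hl.2)
      filter_upwards [near (by linarith : t - 1 / 4 < t) (by linarith : t < t + 1 / 4)] with s hs
      rw [shift_mul_loopLift_upper (n := n) (t := t) (by linarith) (by linarith)]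
      rcases lt_or_ge s t with h1 | h1
      · exact shift_mul_loopLift_lower (by rw [abs_lt]; constructor <;> linarith)
      · exact shift_mul_loopLift_upper (by linarith) (by linarith)
    · filter_upwards [near (by linarith : (n : ℝ) + 1 / 4 < t) (by linarith : t < n + 3 / 4)]
        with s hs
      rw [shift_mul_loopLift_upper (n := n) (by linarith) (by linarith),
        shift_mul_loopLift_upper (n := n) (by linarith) (by linarith)]

/-- The elements of the free group represented by the boundary circles have infinite order. -/
theorem peripheral_zpow_eq_one {i : Fin 4} {n : ℤ} (h : peripheral i ^ n = 1) : n = 0 := by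
  let χ : Free3 →* Multiplicative ℤ :=
    FreeGroup.lift ![Multiplicative.ofAdd 1, Multiplicative.ofAdd 2, Multiplicative.ofAdd 3]
  have hχ : ∀ k : Fin 4, χ (crossing k) = Multiplicative.ofAdd (k : ℤ) := by
    intro k
    fin_cases k
    · exact map_one χ
    all_goals exact FreeGroup.lift_apply_of
  have h1 : χ (peripheral i) ^ n = 1 := by rw [← map_zpow, h, map_one]
  rw [peripheral, map_mul, map_inv, hχ, hχ, ← ofAdd_neg, ← ofAdd_add, ← ofAdd_zsmul,
    ofAdd_eq_one] at h1
  fin_cases i <;> simpa [leftSegment, rightSegment] using h1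

variable {F : Type} [TopologicalSpace F] (ρ : Free3 →* (F ≃ₜ F))

/-- The parametrization of the bundle over a boundary circle by horizontal lifts. -/
def loopMap (i : Fin 4) (x : F × ℝ) : FlatBundle ρ :=
  FlatBundle.pt ρ ⟨boundaryLoop i x.2, boundaryLoop_mem i x.2⟩ (ρ (loopLift i x.2) x.1)

theorem coord_loopMap (i k : Fin 4) (x : F × ℝ) : (loopMap ρ i x).coord k =
    ρ ((shift k (boundaryLoop i x.2))⁻¹ * loopLift i x.2) x.1 := by
  rw [map_mul]; rfl

/-- Near each point the coordinate of the parametrization is a fixed homeomorphism of the fiber. -/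
theorem eventually_coord_loopMap {i k : Fin 4} {x : F × ℝ} (h : boundaryLoop i x.2 ∈ sheet k) :
    ∀ᶠ y in 𝓝 x, (loopMap ρ i y).coord k =
      ρ ((shift k (boundaryLoop i x.2))⁻¹ * loopLift i x.2) y.1 := by
  filter_upwards [continuousAt_snd.eventually (eventually_shift_mul_loopLift h)] with y hy
  rw [coord_loopMap, hy]

theorem continuous_loopMap (i : Fin 4) : Continuous (loopMap ρ i) := by
  refine continuous_iff_continuousAt.2 fun x =>
    FlatBundle.continuousAt_of_coord _ (FlatBundle.base_mem_sheet _) ?_ ?_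
  · exact (Continuous.subtype_mk ((continuous_boundaryLoop i).comp continuous_snd)
      _).continuousAt
  · exact ((ρ _).continuous.comp continuous_fst).continuousAt.congr
      ((eventually_coord_loopMap ρ (FlatBundle.base_mem_sheet (loopMap ρ i x))).mono
        fun y hy => hy.symm)

theorem loopMap_eq_iff {i : Fin 4} {x y : F × ℝ} : loopMap ρ i x = loopMap ρ i y ↔
    ∃ n : ℤ, y = (ρ (peripheral i ^ n) x.1, x.2 + n) := by
  constructor
  · intro h
    obtain ⟨n, hn⟩ := boundaryLoop_eq_iff.1
      (congrArg Subtype.val (congrArg (FlatBundle.base (ρ := ρ)) h) :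
        boundaryLoop i x.2 = boundaryLoop i y.2)
    refine ⟨n, Prod.ext ?_ hn⟩
    have h2 : ρ (loopLift i x.2) x.1 = ρ (loopLift i y.2) y.1 :=
      congrArg (FlatBundle.fib (ρ := ρ)) h
    rw [hn, loopLift_add_int, map_mul, Homeomorph.mul_apply] at h2
    rw [(ρ (loopLift i x.2)).injective h2, ← Homeomorph.mul_apply, ← map_mul, zpow_neg,
      mul_inv_cancel, map_one]
    rfl
  · rintro ⟨n, rfl⟩
    refine FlatBundle.ext (Subtype.ext (boundaryLoop_add_int i x.2 n).symm) ?_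
    change ρ (loopLift i x.2) x.1 = ρ (loopLift i (x.2 + n)) (ρ (peripheral i ^ n) x.1)
    rw [loopLift_add_int, ← Homeomorph.mul_apply, ← map_mul, zpow_neg, inv_mul_cancel_right]

end BoundaryLoops

/-! ### Compactness and separation -/

section Compactness

theorem isCompact_threeHoledDisk : IsCompact threeHoledDisk := by
  refine (isCompact_closedBall (0 : ℂ) 4).of_isClosed_subset ?_ fun z hz => ?_
  · have h : threeHoledDisk =
        {z | ‖z‖ ≤ 4} ∩ ⋂ i : Fin 3, {z | 1 / 2 ≤ ‖z - circleCenter i.castSucc‖} := by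
      ext; simp [threeHoledDisk]
    rw [h]
    exact (isClosed_le continuous_norm continuous_const).inter
      (isClosed_iInter fun i => isClosed_le continuous_const (by fun_prop))
  · simpa using hz.1

instance : CompactSpace upperHalfDisk :=
  isCompact_iff_compactSpace.1
    (isCompact_threeHoledDisk.inter_right (isClosed_le continuous_const Complex.continuous_im))

variable {F : Type} [TopologicalSpace F] {ρ : Free3 →* (F ≃ₜ F)}

instance [CompactSpace F] : CompactSpace (FlatBundle ρ) := by
  have h1 := isCompact_range (FlatBundle.continuous_up (ρ := ρ))
  have h2 := isCompact_range (FlatBundle.continuous_low (ρ := ρ))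
  refine ⟨(h1.union h2).of_isClosed_subset isClosed_univ fun e _ => ?_⟩
  rcases le_total 0 (e.base : ℂ).im with h | h
  · exact Or.inl ⟨_, FlatBundle.up_of_nonneg (k := 0) h⟩
  · exact Or.inr ⟨_, FlatBundle.low_of_nonpos (FlatBundle.base_mem_sheet e) h⟩

instance [T2Space F] : T2Space (FlatBundle ρ) := by
  refine ⟨fun e e' hne => ?_⟩
  by_cases hb : e.base = e'.base
  · have hk := FlatBundle.base_mem_sheet e
    have hk' : (e'.base : ℂ) ∈ sheet (sheetAt e.base) := hb ▸ hk
    have hc : e.coord (sheetAt e.base) ≠ e'.coord (sheetAt e.base) := fun h =>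
      hne (FlatBundle.ext_coord _ hb h)
    obtain ⟨u, v, hu, hv, hau, hbv, huv⟩ := t2_separation hc
    have h1 := FlatBundle.continuousAt_coord (e := e) hk
      (hu.mem_nhds hau)
    have h2 := FlatBundle.continuousAt_coord (e := e') hk' (hv.mem_nhds hbv)
    obtain ⟨s, hs, hso, hes⟩ := mem_nhds_iff.1 h1
    obtain ⟨t, ht, hto, het⟩ := mem_nhds_iff.1 h2
    exact ⟨s, t, hso, hto, hes, het, disjoint_left.2 fun x hx hx' =>
      disjoint_left.1 huv (hs hx) (ht hx')⟩
  · exact separated_by_continuous FlatBundle.continuous_base hb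

end Compactness

/-! ### Mapping tori -/

namespace MappingTorus
section
variable {F : Type} [TopologicalSpace F] (φ : F ≃ₜ F)

theorem deck_zero : deck φ 0 = Homeomorph.refl _ := by
  ext x <;> simp [deck_apply]

theorem deck_add (m n : ℤ) (x : F × ℝ) : deck φ (m + n) x = deck φ m (deck φ n x) := by
  ext
  · simp [deck_apply, zpow_add]
  · simp [deck_apply]; ring

theorem isCoveringMap_mk : IsCoveringMap (mk φ) := by
  let : MulAction (Multiplicative ℤ) (F × ℝ) :=
    { smul := fun n x => deck φ n.toAdd x
      one_smul := fun x => congrArg (fun h : F × ℝ ≃ₜ F × ℝ => h x) (deck_zero φ)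
      mul_smul := fun m n x => deck_add φ m.toAdd n.toAdd x }
  have smul_def : ∀ (n : Multiplicative ℤ) (x : F × ℝ), n • x = deck φ n.toAdd x :=
    fun _ _ => rfl
  have hf : IsQuotientCoveringMap (mk φ) (Multiplicative ℤ) := by
    refine (isQuotientCoveringMap_iff ..).2 ⟨?_, ⟨fun g => ?_⟩, fun {x y} => ?_, fun x => ?_⟩
    · exact (isOpenMap_mk φ).isQuotientMap (continuous_mk φ) (mk_surjective φ)
    · exact (deck φ g.toAdd).continuous
    · rw [eq_comm, mk_eq_mk_iff]
      exact ⟨fun ⟨n, hn⟩ => ⟨Multiplicative.ofAdd n, hn.symm⟩, fun ⟨n, hn⟩ => ⟨n.toAdd, hn.symm⟩⟩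
    · refine ⟨Prod.snd ⁻¹' Metric.ball x.2 (1 / 2), (Metric.isOpen_ball.preimage
        continuous_snd).mem_nhds (Metric.mem_ball_self (by norm_num)), ?_⟩
      rintro g ⟨_, ⟨y, hy, rfl⟩, hy'⟩
      simp only [smul_def, deck_apply, mem_preimage, Metric.mem_ball, Real.dist_eq,
        abs_lt] at hy hy'
      have h1 : g.toAdd < 1 := by
        have : (g.toAdd : ℝ) < 1 := by linarith
        exact_mod_cast this
      have h2 : -1 < g.toAdd := by
        have : (-1 : ℝ) < g.toAdd := by linarith
        exact_mod_cast this
      exact toAdd_eq_zero.1 (by omega)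
  exact hf.isCoveringMap

instance [CompactSpace F] : CompactSpace (MappingTorus φ) := by
  have h := ((isCompact_univ (X := F)).prod (isCompact_Icc (a := (0 : ℝ)) (b := 1))).image
    (continuous_mk φ)
  refine ⟨h.of_isClosed_subset isClosed_univ fun y _ => ?_⟩
  obtain ⟨x, rfl⟩ := mk_surjective φ y
  refine ⟨deck φ (-⌊x.2⌋) x, ⟨mem_univ _, ?_⟩, ((mk_eq_mk_iff φ).2 ⟨_, rfl⟩).symm⟩
  simp only [deck_apply]
  push_cast
  constructor
  · linarith [Int.floor_le x.2]
  · linarith [Int.lt_floor_add_one x.2]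

end
end MappingTorus

/-! ### The splitter -/

section Splitter

/-- The action of `SL(2, ℤ)` on the torus. -/
def torusHom : Matrix.SpecialLinearGroup (Fin 2) ℤ →* (Torus ≃ₜ Torus) where
  toFun := torusHomeo
  map_one' := Homeomorph.ext linearTorusMap_one
  map_mul' A B := Homeomorph.ext fun x => (linearTorusMap_mul A.1 B.1 x).symm

/-- The monodromy representation of the splitter. The element picked up on crossing the `k`-th
segment upwards is sent to the inverse of the product of the first `k` of the matrices `τ_a`, `τ_b`,
`τ_a`. -/
def splitterMatrix : Free3 →* Matrix.SpecialLinearGroup (Fin 2) ℤ :=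
  FreeGroup.lift ![twistA⁻¹, twistB⁻¹ * twistA⁻¹, matrixPhi⁻¹]

theorem matrixPhi_eq : matrixPhi = twistA * twistB * twistA := by
  apply Subtype.ext
  rw [Matrix.SpecialLinearGroup.coe_mul, Matrix.SpecialLinearGroup.coe_mul]
  simp [matrixPhi, twistA, twistB]

theorem splitterMatrix_peripheral (i : Fin 4) :
    splitterMatrix (peripheral i) = splitterMonodromy i := by
  have h0 : splitterMatrix (crossing 0) = 1 := map_one splitterMatrix
  have h1 : splitterMatrix (crossing 1) = twistA⁻¹ := FreeGroup.lift_apply_of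
  have h2 : splitterMatrix (crossing 2) = twistB⁻¹ * twistA⁻¹ := FreeGroup.lift_apply_of
  have h3 : splitterMatrix (crossing 3) = matrixPhi⁻¹ := FreeGroup.lift_apply_of
  rw [peripheral, map_mul, map_inv]
  fin_cases i <;>
    simp [leftSegment, rightSegment, splitterMonodromy, h0, h1, h2, h3, matrixPhi_eq,
      _root_.mul_assoc]

/-- The action of the free group on the torus through the monodromy representation. -/
def splitterRep : Free3 →* (Torus ≃ₜ Torus) := torusHom.comp splitterMatrix

theorem splitterRep_peripheral_zpow (i : Fin 4) (n : ℤ) :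
    splitterRep (peripheral i ^ n) = torusHomeo (splitterMonodromy i) ^ n := by
  rw [map_zpow, splitterRep, MonoidHom.comp_apply, splitterMatrix_peripheral]; rfl

/-- The torus bundle over the disk with three holes. -/
abbrev Splitter : Type := FlatBundle splitterRep

/-- The parametrization of a boundary component of the splitter. -/
def boundaryMap (i : Fin 4) : C(TorusBundle (splitterMonodromy i), Splitter) where
  toFun := Quotient.lift (loopMap splitterRep i) fun x y ⟨n, hn⟩ => by
    rw [loopMap_eq_iff]
    exact ⟨n, by rw [splitterRep_peripheral_zpow]; exact hn⟩
  continuous_toFun := (continuous_loopMap splitterRep i).quotient_lift _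

theorem boundaryMap_mk (i : Fin 4) (x : Torus × ℝ) :
    boundaryMap i (MappingTorus.mk _ x) = loopMap splitterRep i x := rfl

theorem boundaryMap_injective (i : Fin 4) : Function.Injective (boundaryMap i) := by
  intro y y' h
  obtain ⟨x, rfl⟩ := MappingTorus.mk_surjective _ y
  obtain ⟨x', rfl⟩ := MappingTorus.mk_surjective _ y'
  rw [boundaryMap_mk, boundaryMap_mk, loopMap_eq_iff] at h
  obtain ⟨n, hn⟩ := h
  rw [splitterRep_peripheral_zpow] at hn
  exact (MappingTorus.mk_eq_mk_iff _).2 ⟨n, hn⟩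

theorem boundaryMap_isEmbedding (i : Fin 4) : Topology.IsEmbedding (boundaryMap i) :=
  ((boundaryMap i).continuous.isClosedEmbedding (boundaryMap_injective i)).isEmbedding

/-- The covering of a torus bundle over the circle by space. -/
def torusBundleCover (A : Matrix.SpecialLinearGroup (Fin 2) ℤ) :
    (ℝ × ℝ) × ℝ → TorusBundle A := MappingTorus.mk _ ∘ Prod.map planeToTorus id

theorem hasUniqueLifting_torusBundleCover (A : Matrix.SpecialLinearGroup (Fin 2) ℤ) :
    HasUniqueLifting (torusBundleCover A) :=
  (MappingTorus.isCoveringMap_mk _).hasUniqueLifting.comp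
    (hasUniqueLifting_planeToTorus.prodMap hasUniqueLifting_id)

theorem torusBundleCover_surjective (A : Matrix.SpecialLinearGroup (Fin 2) ℤ) :
    Function.Surjective (torusBundleCover A) :=
  (MappingTorus.mk_surjective _).comp (planeToTorus_surjective.prodMap Function.surjective_id)

theorem torusBundle_isAspherical (A : Matrix.SpecialLinearGroup (Fin 2) ℤ) :
    IsAspherical (TorusBundle A) :=
  (hasUniqueLifting_torusBundleCover A).isAspherical (torusBundleCover_surjective A)

/-- The boundary components lift to injective maps of universal covers, because the boundary
circles have infinite order in the free group. -/
theorem boundaryMap_isPiOneInjective (i : Fin 4) : IsPiOneInjective (boundaryMap i) := by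
  refine (hasUniqueLifting_torusBundleCover _).isPiOneInjective (torusBundleCover_surjective _)
    (hasUniqueLifting_bundleCover splitterRep) (boundaryMap i)
    ⟨fun x => (loopMap leftTranslation i (1, x.2), x.1),
      ((continuous_loopMap leftTranslation i).comp (by fun_prop)).prodMk (by fun_prop)⟩ ?_ ?_
  · rintro ⟨v, t⟩ ⟨v', t'⟩ h
    obtain ⟨n, hn⟩ := (loopMap_eq_iff leftTranslation).1 (congrArg Prod.fst h)
    have h1 : peripheral i ^ n = 1 := by
      have h : (1 : Free3) = peripheral i ^ n * 1 := congrArg Prod.fst hn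
      rw [mul_one] at h
      exact h.symm
    have h2 : v = v' := congrArg Prod.snd h
    have h3 : t' = t + n := congrArg Prod.snd hn
    rw [peripheral_zpow_eq_one h1, Int.cast_zero, add_zero] at h3
    rw [h2, h3]
  · rintro ⟨v, t⟩
    refine FlatBundle.ext rfl ?_
    change splitterRep (loopLift i t * 1) (planeToTorus v) = _
    rw [mul_one]; rfl

end Splitter

/-! ### Collar coordinates on the disk with three holes -/

section Collar

/-- The sign of the exponent in the polar coordinates at a boundary circle: the disk lies outside of
the three inner circles and inside of the outer circle. -/
def collarSign : Fin 4 → ℝ := ![1, 1, 1, -1]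

/-- Holomorphic coordinates on the disk with three holes: logarithmic polar coordinates at the
boundary circles, in which the disk is the half plane `0 ≤ re ζ`, and the coordinate `ζ = z + 5` in
the interior, which has positive real part. -/
def collarMap : Option (Fin 4) → ℂ → ℂ
  | none, ζ => ζ - 5
  | some i, ζ => circleCenter i - circleRadius i * Complex.I * Complex.exp (collarSign i * ζ)

/-- The part of the plane where a collar coordinate is used. -/
def collarRange : Option (Fin 4) → Set ℂ
  | none => {z | ‖z‖ < 4 ∧ ∀ i : Fin 3, 1 / 2 < ‖z - circleCenter i.castSucc‖}
  | some i => {z | if i = 3 then 5 / 2 < ‖z‖ else ‖z - circleCenter i‖ < 3 / 2}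

theorem isOpen_collarRange (j : Option (Fin 4)) : IsOpen (collarRange j) := by
  rcases j with _ | i
  · have h : collarRange none =
        {z | ‖z‖ < 4} ∩ ⋂ i : Fin 3, {z | 1 / 2 < ‖z - circleCenter i.castSucc‖} := by
      ext; simp [collarRange]
    rw [h]
    exact (isOpen_lt continuous_norm continuous_const).inter
      (isOpen_iInter_of_finite fun i => isOpen_lt continuous_const (by fun_prop))
  · by_cases hi : i = 3
    · simpa only [collarRange, if_pos hi] using isOpen_lt continuous_const continuous_norm
    · simpa only [collarRange, if_neg hi] using
        isOpen_lt (by fun_prop : Continuous fun z : ℂ => ‖z - circleCenter i‖) continuous_const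

theorem collarSign_ne_zero (i : Fin 4) : collarSign i ≠ 0 := by
  fin_cases i <;> simp [collarSign]

theorem norm_collarMap_sub (i : Fin 4) (ζ : ℂ) : ‖collarMap (some i) ζ - circleCenter i‖ =
    circleRadius i * Real.exp (collarSign i * ζ.re) := by
  rw [collarMap, sub_sub_cancel_left, norm_neg, norm_mul, norm_mul, Complex.norm_I, mul_one,
    Complex.norm_real, Complex.norm_exp, Complex.re_ofReal_mul,
    Real.norm_of_nonneg (circleRadius_pos i).le]

theorem collarMap_mem_iff {j : Option (Fin 4)} {ζ : ℂ} (h : collarMap j ζ ∈ collarRange j) :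
    collarMap j ζ ∈ threeHoledDisk ↔ 0 ≤ ζ.re := by
  rcases j with _ | i
  · refine iff_of_true ⟨h.1.le, fun i => (h.2 i).le⟩ ?_
    have h1 := (abs_le.1 (Complex.abs_re_le_norm (collarMap none ζ))).1
    have h2 : (collarMap none ζ).re = ζ.re - 5 := by simp [collarMap]
    linarith [h.1]
  · have hn := norm_collarMap_sub i ζ
    set z := collarMap (some i) ζ
    have hdist : ∀ a b : Fin 4, ‖circleCenter a - circleCenter b‖ ≤
        ‖z - circleCenter b‖ + ‖z - circleCenter a‖ := fun a b => by
      rw [← norm_neg (z - circleCenter a), neg_sub, add_comm]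
      simpa using norm_add_le (circleCenter a - z) (z - circleCenter b)
    by_cases hi : i = 3
    · subst hi
      simp only [collarRange, if_true, mem_ofPred_eq] at h
      have hc : circleCenter 3 = 0 := rfl
      rw [hc, sub_zero] at hn
      have h2 : ∀ i : Fin 3, 1 / 2 ≤ ‖z - circleCenter i.castSucc‖ := fun i => by
        have h3 : ‖circleCenter i.castSucc‖ ≤ 2 := by
          fin_cases i <;> simp [circleCenter]
        have h4 := norm_add_le (z - circleCenter i.castSucc) (circleCenter i.castSucc)
        rw [sub_add_cancel] at h4
        linarith
      rw [threeHoledDisk, mem_ofPred_eq, and_iff_left h2, hn]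
      simp [circleRadius, collarSign]
    · simp only [collarRange, if_neg hi, mem_ofPred_eq] at h
      have hr : circleRadius i = 1 / 2 := by
        fin_cases i <;> simp [circleRadius] at hi ⊢
      have hs : collarSign i = 1 := by
        fin_cases i <;> simp [collarSign] at hi ⊢
      rw [hr, hs, one_mul] at hn
      have h1 : ‖z‖ ≤ 4 := by
        have h3 : ‖circleCenter i‖ ≤ 2 := by
          fin_cases i <;> simp [circleCenter]
        have h4 := norm_add_le (z - circleCenter i) (circleCenter i)
        rw [sub_add_cancel] at h4
        linarith
      have h2 : ∀ i' : Fin 3, i'.castSucc ≠ i → 1 / 2 ≤ ‖z - circleCenter i'.castSucc‖ := by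
        intro i' hne
        have h3 : 2 ≤ ‖circleCenter i - circleCenter i'.castSucc‖ := by
          fin_cases i <;> fin_cases i' <;> simp [circleCenter] at hne hi ⊢ <;> norm_num
        linarith [hdist i i'.castSucc]
      have h3 : z ∈ threeHoledDisk ↔ 1 / 2 ≤ ‖z - circleCenter i‖ := by
        constructor
        · rintro ⟨-, h4⟩
          obtain ⟨i', rfl⟩ := Fin.exists_castSucc_eq.2 (show i ≠ Fin.last 3 from hi)
          exact h4 i'
        · refine fun h4 => ⟨h1, fun i' => ?_⟩
          by_cases hne : i'.castSucc = i
          · rwa [hne]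
          · exact h2 i' hne
      rw [h3, hn]
      rw [show (1 / 2 ≤ 1 / 2 * Real.exp ζ.re) ↔ 1 ≤ Real.exp ζ.re by
          constructor <;> intro <;> linarith,
        Real.one_le_exp_iff]

/-- In a collar coordinate the boundary circles are the imaginary axis. -/
theorem collarMap_re_eq_zero_iff {i : Fin 4} {ζ : ℂ} : ζ.re = 0 ↔
    ‖collarMap (some i) ζ - circleCenter i‖ = circleRadius i := by
  rw [norm_collarMap_sub, mul_eq_left₀ (circleRadius_pos i).ne', Real.exp_eq_one_iff,
    mul_eq_zero, or_iff_right (collarSign_ne_zero i)]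

/-- A collar coordinate is only used near its own boundary circle. -/
theorem collarRange_norm_ne {j : Option (Fin 4)} {i : Fin 4} (hj : j ≠ some i) {z : ℂ}
    (hz : z ∈ collarRange j) : ‖z - circleCenter i‖ ≠ circleRadius i := by
  intro h
  rcases j with _ | i'
  · obtain ⟨h1, h2⟩ := hz
    induction i using Fin.lastCases with
    | last =>
      have : ‖z‖ = 4 := by simpa [circleCenter, circleRadius] using h
      linarith
    | cast i =>
      have h3 := h2 i
      rw [h] at h3
      fin_cases i <;> simp [circleRadius] at h3
  · have hne : i' ≠ i := fun h => hj (congrArg some h)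
    simp only [collarRange, mem_ofPred_eq] at hz
    have h1 := norm_add_le (z - circleCenter i) (circleCenter i)
    have h2 := norm_sub_le (z - circleCenter i') (z - circleCenter i)
    have h3 := norm_sub_norm_le (z) (z - circleCenter i)
    rw [sub_add_cancel] at h1
    rw [h] at h1 h2
    rw [sub_sub_sub_cancel_left] at h2
    have h4 := norm_sub_norm_le z (circleCenter i')
    fin_cases i <;> fin_cases i' <;>
      simp [circleCenter, circleRadius] at hne hz h h1 h2 h4 <;>
      first
        | linarith
        | (norm_num at h2; linarith)

theorem exists_mem_collarRange (z : ℂ) : ∃ j, z ∈ collarRange j := by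
  by_cases h1 : ‖z‖ < 4
  · by_cases h2 : ∀ i : Fin 3, 1 / 2 < ‖z - circleCenter i.castSucc‖
    · exact ⟨none, h1, h2⟩
    · push Not at h2
      obtain ⟨i, hi⟩ := h2
      refine ⟨some i.castSucc, ?_⟩
      simp only [collarRange, mem_ofPred_eq]
      rw [if_neg (show i.castSucc ≠ 3 from (Fin.castSucc_lt_last i).ne)]
      linarith
  · refine ⟨some 3, ?_⟩
    simp only [collarRange, mem_ofPred_eq, if_true]
    linarith

theorem collarMap_surjOn {j : Option (Fin 4)} {z : ℂ} (hz : z ∈ collarRange j)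
    (hz' : z ∈ threeHoledDisk) : ∃ ζ, collarMap j ζ = z := by
  rcases j with _ | i
  · exact ⟨z + 5, by simp [collarMap]⟩
  · have h0 : z - circleCenter i ≠ 0 := by
      intro h
      by_cases hi : i = 3
      · subst hi
        have hc : circleCenter 3 = 0 := rfl
        simp only [collarRange, mem_ofPred_eq, if_true] at hz
        rw [hc, sub_zero] at h
        rw [h, norm_zero] at hz
        linarith
      · obtain ⟨i', rfl⟩ := Fin.exists_castSucc_eq.2 (show i ≠ Fin.last 3 from hi)
        have := hz'.2 i'
        rw [h, norm_zero] at this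
        linarith
    have hr : (circleRadius i : ℂ) * Complex.I ≠ 0 :=
      mul_ne_zero (Complex.ofReal_ne_zero.2 (circleRadius_pos i).ne') Complex.I_ne_zero
    have hs : (collarSign i : ℂ) ≠ 0 := Complex.ofReal_ne_zero.2 (collarSign_ne_zero i)
    refine ⟨Complex.log (-(z - circleCenter i) / (circleRadius i * Complex.I)) / collarSign i, ?_⟩
    rw [collarMap, mul_div_cancel₀ _ hs,
      Complex.exp_log (div_ne_zero (neg_ne_zero.2 h0) hr), mul_div_cancel₀ _ hr]
    ring

theorem hasStrictDerivAt_collarMap (j : Option (Fin 4)) (ζ : ℂ) :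
    ∃ a : ℂ, a ≠ 0 ∧ HasStrictDerivAt (collarMap j) a ζ := by
  rcases j with _ | i
  · exact ⟨1, one_ne_zero, (hasStrictDerivAt_id ζ).sub_const 5⟩
  · refine ⟨_, ?_, (((((hasStrictDerivAt_id ζ).const_mul (collarSign i : ℂ)).cexp).const_mul
      (circleRadius i * Complex.I)).const_sub (circleCenter i))⟩
    simp [(circleRadius_pos i).ne', collarSign_ne_zero, Complex.exp_ne_zero]

theorem contDiff_collarMap (j : Option (Fin 4)) : ContDiff ℂ ∞ (collarMap j) := by
  rcases j with _ | i
  · exact contDiff_id.sub contDiff_const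
  · exact contDiff_const.sub (contDiff_const.mul (contDiff_const.mul contDiff_id).cexp)

end Collar

/-! ### Local coordinates on the product of the plane and the torus -/

section ModelMap

/-- Euclidean space of dimension four. -/
abbrev E4 : Type := EuclideanSpace ℝ (Fin 4)

/-- A local inverse of `t ↦ exp (2πit)` near `t₀`. -/
def circleAngle (t₀ : ℝ) (z : Circle) : ℝ :=
  t₀ + (Complex.log ((z : ℂ) * (Circle.exp (2 * Real.pi * t₀) : ℂ)⁻¹)).im / (2 * Real.pi)

theorem circleAngle_exp {t₀ t : ℝ} (h : |t - t₀| < 1 / 2) :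
    circleAngle t₀ (Circle.exp (2 * Real.pi * t)) = t := by
  have h1 : (Circle.exp (2 * Real.pi * t) : ℂ) * (Circle.exp (2 * Real.pi * t₀) : ℂ)⁻¹ =
      Complex.exp ((2 * Real.pi * (t - t₀) : ℝ) * Complex.I) := by
    rw [Circle.coe_exp, Circle.coe_exp, ← Complex.exp_neg, ← Complex.exp_add]
    congr 1
    push_cast; ring
  have h2 := abs_lt.1 h
  have h3 := Real.pi_pos
  rw [circleAngle, h1, Complex.log_exp]
  · rw [Complex.im_ofReal_mul, Complex.I_im, mul_one]
    field_simp; ring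
  all_goals
    rw [Complex.im_ofReal_mul, Complex.I_im, mul_one]
    nlinarith

theorem contMDiffAt_circleAngle (t₀ : ℝ) :
    ContMDiffAt (𝓡 1) 𝓘(ℝ, ℝ) ∞ (circleAngle t₀) (Circle.exp (2 * Real.pi * t₀)) := by
  have h1 : ContMDiffAt (𝓡 1) 𝓘(ℝ, ℂ) ∞
      (fun z : Circle => (z : ℂ)) (Circle.exp (2 * Real.pi * t₀)) :=
    have : Fact (Module.finrank ℝ ℂ = 1 + 1) := finrank_real_complex_fact'
    (contMDiff_coe_sphere (E := ℂ) (n := 1)).contMDiffAt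
  have h2 : ContDiffAt ℝ ∞ (fun z : ℂ =>
      t₀ + (Complex.log (z * (Circle.exp (2 * Real.pi * t₀) : ℂ)⁻¹)).im / (2 * Real.pi))
      (Circle.exp (2 * Real.pi * t₀)) := by
    have h3 : ContDiffAt ℂ ∞ (fun z : ℂ =>
        Complex.log (z * (Circle.exp (2 * Real.pi * t₀) : ℂ)⁻¹)) (Circle.exp (2 * Real.pi * t₀)) :=
      (Complex.contDiffAt_log (by
        rw [mul_inv_cancel₀ (Circle.coe_ne_zero _)]; simp)).comp _
        (contDiffAt_id.mul contDiffAt_const)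
    exact contDiffAt_const.add ((Complex.imCLM.contDiff.contDiffAt.comp _
      (h3.restrict_scalars ℝ)).div_const _)
  exact h2.contMDiffAt.comp _ h1

/-- The coordinates `(y₀ + 2πi y₁, (y₂, y₃))`. -/
def splitCoords : E4 ≃L[ℝ] ℂ × (ℝ × ℝ) :=
  LinearEquiv.toContinuousLinearEquiv
    { toFun := fun y => (⟨y 0, 2 * Real.pi * y 1⟩, (y 2, y 3))
      invFun := fun p => !₂[p.1.re, p.1.im / (2 * Real.pi), p.2.1, p.2.2]
      map_add' := fun x y => by
        refine Prod.ext (Complex.ext ?_ ?_) (Prod.ext ?_ ?_) <;> simp [mul_add]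
      map_smul' := fun c x => by
        refine Prod.ext (Complex.ext ?_ ?_) (Prod.ext ?_ ?_)
        all_goals simp
        ring
      left_inv := fun y => by
        ext i
        fin_cases i <;> simp [Real.pi_ne_zero]
      right_inv := fun p => by
        refine Prod.ext (Complex.ext ?_ ?_) (Prod.ext ?_ ?_)
        all_goals simp
        field_simp }

theorem splitCoords_symm_apply (p : ℂ × (ℝ × ℝ)) :
    splitCoords.symm p = !₂[p.1.re, p.1.im / (2 * Real.pi), p.2.1, p.2.2] := rfl

/-- A collar coordinate and angular coordinates as a map to the product of the plane and the
torus. -/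
def modelMap (j : Option (Fin 4)) (y : E4) : ℂ × Torus :=
  (collarMap j (splitCoords y).1, planeToTorus (splitCoords y).2)

theorem contMDiff_planeToTorus : ContMDiff 𝓘(ℝ, ℝ × ℝ) torusModel ∞ planeToTorus := by
  have h : ∀ g : ℝ × ℝ → ℝ, ContDiff ℝ ∞ g →
      ContMDiff 𝓘(ℝ, ℝ × ℝ) (𝓡 1) ∞ fun v => Circle.exp (2 * Real.pi * g v) := fun g hg =>
    contMDiff_circleExp.comp (contDiff_const.mul hg).contMDiff
  exact (h _ contDiff_fst).prodMk (h _ contDiff_snd)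

theorem contMDiff_modelMap (j : Option (Fin 4)) :
    ContMDiff 𝓘(ℝ, E4) (𝓘(ℝ, ℂ).prod torusModel) ∞ (modelMap j) := by
  refine ContMDiff.prodMk ?_ ?_
  · exact (((contDiff_collarMap j).restrict_scalars ℝ).comp
      (contDiff_fst.comp splitCoords.contDiff)).contMDiff
  · exact contMDiff_planeToTorus.comp (contDiff_snd.comp splitCoords.contDiff).contMDiff

/-- The local inverse of `planeToTorus` near `v₀`. -/
def torusAngle (v₀ : ℝ × ℝ) (w : Torus) : ℝ × ℝ := (circleAngle v₀.1 w.1, circleAngle v₀.2 w.2)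

theorem contMDiffAt_torusAngle (v₀ : ℝ × ℝ) :
    ContMDiffAt torusModel 𝓘(ℝ, ℝ × ℝ) ∞ (torusAngle v₀) (planeToTorus v₀) :=
  ((contMDiffAt_circleAngle v₀.1).comp (planeToTorus v₀) contMDiffAt_fst).prodMk_space
    ((contMDiffAt_circleAngle v₀.2).comp (planeToTorus v₀) contMDiffAt_snd)

theorem eventually_torusAngle (v₀ : ℝ × ℝ) :
    ∀ᶠ v in 𝓝 v₀, torusAngle v₀ (planeToTorus v) = v := by
  have h1 : ∀ᶠ v : ℝ × ℝ in 𝓝 v₀, |v.1 - v₀.1| < 1 / 2 :=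
    (by fun_prop : Continuous fun v : ℝ × ℝ => |v.1 - v₀.1|).continuousAt.eventually_lt_const
      (by simp)
  have h2 : ∀ᶠ v : ℝ × ℝ in 𝓝 v₀, |v.2 - v₀.2| < 1 / 2 :=
    (by fun_prop : Continuous fun v : ℝ × ℝ => |v.2 - v₀.2|).continuousAt.eventually_lt_const
      (by simp)
  filter_upwards [h1, h2] with v hv1 hv2
  exact Prod.ext (circleAngle_exp hv1) (circleAngle_exp hv2)

/-- The map to the product of the plane and the torus has smooth local inverses. -/
theorem exists_modelMap_leftInverse (j : Option (Fin 4)) (y : E4) :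
    ∃ L : ℂ × Torus → E4, ContMDiffAt (𝓘(ℝ, ℂ).prod torusModel) 𝓘(ℝ, E4) ∞ L (modelMap j y) ∧
      ∀ᶠ x in 𝓝 y, L (modelMap j x) = x := by
  obtain ⟨a, ha, hd⟩ := hasStrictDerivAt_collarMap j (splitCoords y).1
  have hc : ContDiffAt ℂ ∞ (collarMap j) (splitCoords y).1 := (contDiff_collarMap j).contDiffAt
  have hd' := hd.hasStrictFDerivAt_equiv ha
  set φ := hd'.toOpenPartialHomeomorph (collarMap j) with hφ
  have hsrc : (splitCoords y).1 ∈ φ.source := hd'.mem_toOpenPartialHomeomorph_source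
  have hcoe : ⇑φ = collarMap j := hd'.toOpenPartialHomeomorph_coe
  have hinv : ContDiffAt ℂ ∞ φ.symm (collarMap j (splitCoords y).1) := by
    refine φ.contDiffAt_symm (f₀' := ContinuousLinearEquiv.unitsEquivAut ℂ (Units.mk0 a ha))
      ?_ ?_ ?_
    · rw [← hcoe]; exact φ.map_source hsrc
    · rw [← hcoe, φ.left_inv hsrc, hcoe]; exact hd'.hasFDerivAt
    · rw [← hcoe, φ.left_inv hsrc, hcoe]; exact hc
  refine ⟨fun p => splitCoords.symm (φ.symm p.1, torusAngle (splitCoords y).2 p.2), ?_, ?_⟩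
  · have h1 : ContMDiffAt (𝓘(ℝ, ℂ).prod torusModel) 𝓘(ℝ, ℂ) ∞
        (fun p : ℂ × Torus => φ.symm p.1) (modelMap j y) :=
      (hinv.restrict_scalars ℝ).contMDiffAt.comp (modelMap j y) contMDiffAt_fst
    have h2 : ContMDiffAt (𝓘(ℝ, ℂ).prod torusModel) 𝓘(ℝ, ℝ × ℝ) ∞
        (fun p : ℂ × Torus => torusAngle (splitCoords y).2 p.2) (modelMap j y) :=
      (contMDiffAt_torusAngle (splitCoords y).2).comp (modelMap j y) contMDiffAt_snd
    exact splitCoords.symm.contDiff.contMDiff.contMDiffAt.comp _ (h1.prodMk_space h2)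
  · have h1 := (continuous_fst.comp splitCoords.continuous).continuousAt.eventually
      (φ.open_source.mem_nhds hsrc)
    have h2 := (continuous_snd.comp splitCoords.continuous).continuousAt.eventually
      (eventually_torusAngle (splitCoords y).2)
    filter_upwards [h1, h2] with x hx1 hx2
    simp only [Function.comp_apply] at hx1 hx2
    change splitCoords.symm (φ.symm (collarMap j (splitCoords x).1),
      torusAngle (splitCoords y).2 (planeToTorus (splitCoords x).2)) = x
    rw [hx2, ← hcoe, φ.left_inv hx1]
    exact splitCoords.symm_apply_apply x

end ModelMap

/-! ### Charts of the splitter -/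

section Charts

/-- A partial homeomorphism which matches two subsets restricts to them. -/
def OpenPartialHomeomorph.restrictSubtypes {A B : Type*} [TopologicalSpace A] [TopologicalSpace B]
    (φ : OpenPartialHomeomorph A B) {s : Set A} {t : Set B}
    (h : ∀ x ∈ φ.source, x ∈ s ↔ φ x ∈ t) (a₀ : s) (b₀ : t) : OpenPartialHomeomorph s t := by
  classical
  have h' : ∀ y ∈ φ.target, φ.symm y ∈ s ↔ y ∈ t := fun y hy => by
    rw [h _ (φ.map_target hy), φ.right_inv hy]
  have e1 : ∀ x : s, (x : A) ∈ φ.source →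
      ((if hx : φ x ∈ t then (⟨φ x, hx⟩ : t) else b₀ : t) : B) = φ x := fun x hx => by
    rw [dif_pos ((h _ hx).1 x.2)]
  have e2 : ∀ y : t, (y : B) ∈ φ.target →
      ((if hy : φ.symm y ∈ s then (⟨φ.symm y, hy⟩ : s) else a₀ : s) : A) = φ.symm y :=
      fun y hy => by
    rw [dif_pos ((h' _ hy).2 y.2)]
  exact
  { toFun := fun x => if hx : φ x ∈ t then ⟨φ x, hx⟩ else b₀
    invFun := fun y => if hy : φ.symm y ∈ s then ⟨φ.symm y, hy⟩ else a₀
    source := Subtype.val ⁻¹' φ.source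
    target := Subtype.val ⁻¹' φ.target
    map_source' := fun x hx => by
      rw [mem_preimage, e1 x hx]; exact φ.map_source hx
    map_target' := fun y hy => by
      rw [mem_preimage, e2 y hy]; exact φ.map_target hy
    left_inv' := fun x hx => by
      apply Subtype.ext
      rw [e2 _ (by rw [e1 x hx]; exact φ.map_source hx), e1 x hx, φ.left_inv hx]
    right_inv' := fun y hy => by
      apply Subtype.ext
      rw [e1 _ (by rw [e2 y hy]; exact φ.map_target hy), e2 y hy, φ.right_inv hy]
    open_source := φ.open_source.preimage continuous_subtype_val
    open_target := φ.open_target.preimage continuous_subtype_val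
    continuousOn_toFun := by
      rw [Topology.IsInducing.subtypeVal.continuousOn_iff]
      exact (φ.continuousOn.comp continuous_subtype_val.continuousOn fun x hx => hx).congr
        fun x hx => e1 x hx
    continuousOn_invFun := by
      rw [Topology.IsInducing.subtypeVal.continuousOn_iff]
      exact (φ.symm.continuousOn.comp continuous_subtype_val.continuousOn fun x hx => hx).congr
        fun x hx => e2 x hx }

theorem OpenPartialHomeomorph.coe_restrictSubtypes {A B : Type*} [TopologicalSpace A]
    [TopologicalSpace B] (φ : OpenPartialHomeomorph A B) {s : Set A} {t : Set B}
    (h : ∀ x ∈ φ.source, x ∈ s ↔ φ x ∈ t) (a₀ : s) (b₀ : t) {x : s} (hx : (x : A) ∈ φ.source) :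
    (φ.restrictSubtypes h a₀ b₀ x : B) = φ x := by
  have : φ.restrictSubtypes h a₀ b₀ x = ⟨φ x, (h _ hx).1 x.2⟩ := dif_pos ((h _ hx).1 x.2)
  rw [this]

theorem isLocalHomeomorph_planeToTorus : IsLocalHomeomorph planeToTorus := by
  have h : IsLocalHomeomorph fun t : ℝ => Circle.exp (2 * Real.pi * t) :=
    isLocalHomeomorph_circleExp.comp
      (Homeomorph.mulLeft₀ (2 * Real.pi) Real.two_pi_pos.ne').isLocalHomeomorph
  intro v
  obtain ⟨φ, h1, h2⟩ := h v.1
  obtain ⟨ψ, h3, h4⟩ := h v.2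
  refine ⟨φ.prod ψ, ⟨h1, h3⟩, ?_⟩
  ext w : 1
  exact Prod.ext (congrFun h2 w.1) (congrFun h4 w.2)

/-- Near each point `modelMap j` is a homeomorphism onto an open set. -/
theorem exists_modelMap_localHomeomorph (j : Option (Fin 4)) (y : E4) :
    ∃ φ : OpenPartialHomeomorph E4 (ℂ × Torus), y ∈ φ.source ∧ ⇑φ = modelMap j := by
  obtain ⟨a, ha, hd⟩ := hasStrictDerivAt_collarMap j (splitCoords y).1
  have hd' := hd.hasStrictFDerivAt_equiv ha
  obtain ⟨ψ, h1, h2⟩ := isLocalHomeomorph_planeToTorus (splitCoords y).2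
  refine ⟨splitCoords.toHomeomorph.toOpenPartialHomeomorph.trans
    ((hd'.toOpenPartialHomeomorph (collarMap j)).prod ψ), ?_, ?_⟩
  · simp only [OpenPartialHomeomorph.trans_source, Homeomorph.toOpenPartialHomeomorph_source,
      univ_inter, mem_preimage, Homeomorph.toOpenPartialHomeomorph_apply]
    exact ⟨hd'.mem_toOpenPartialHomeomorph_source, h1⟩
  · ext x : 1
    exact Prod.ext (congrFun hd'.toOpenPartialHomeomorph_coe _) (congrFun h2 _).symm

/-- A chart of the splitter is adapted if the base point and the coordinate in the fiber are
expressed in it by `modelMap j`. -/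
def IsAdapted (j : Option (Fin 4)) (k : Fin 4)
    (c : OpenPartialHomeomorph Splitter (EuclideanHalfSpace 4)) : Prop :=
  ∀ x ∈ c.source, (x.base : ℂ) ∈ collarRange j ∧ (x.base : ℂ) ∈ sheet k ∧
    modelMap j (c x).1 = ((x.base : ℂ), x.coord k)

theorem exists_isAdapted (x : Splitter) :
    ∃ c : OpenPartialHomeomorph Splitter (EuclideanHalfSpace 4), x ∈ c.source ∧
      ∃ j k, IsAdapted j k c := by
  obtain ⟨j, hj⟩ := exists_mem_collarRange (x.base : ℂ)
  obtain ⟨ζ, hζ⟩ := collarMap_surjOn hj x.base.2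
  have hk := FlatBundle.base_mem_sheet x
  set k := sheetAt x.base
  obtain ⟨v, hv⟩ := planeToTorus_surjective (x.coord k)
  set y := splitCoords.symm (ζ, v) with hy
  have hyx : modelMap j y = ((x.base : ℂ), x.coord k) := by
    rw [modelMap, hy, ContinuousLinearEquiv.apply_symm_apply, hζ, hv]
  obtain ⟨φ, h1, h2⟩ := exists_modelMap_localHomeomorph j y
  have hopen : IsOpen (Prod.fst ⁻¹' collarRange j : Set (ℂ × Torus)) :=
    (isOpen_collarRange j).preimage continuous_fst
  set φ' := (φ.symm.restrOpen _ hopen).symm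
  have hφ' : ⇑φ' = modelMap j := h2
  have hsrc : ∀ z ∈ φ'.source, (modelMap j z).1 ∈ collarRange j := fun z hz => by
    have := φ'.map_source hz
    rw [hφ'] at this
    exact this.2
  have hyφ : y ∈ φ'.source := by
    have : φ y ∈ φ'.target := ⟨φ.map_source h1, by
      rw [mem_preimage, h2, hyx]; exact hj⟩
    have h3 := φ'.map_target this
    have h4 : φ'.symm (φ y) = φ.symm (φ y) := rfl
    rwa [h4, φ.left_inv h1] at h3
  have hst : ∀ z ∈ φ'.source, z ∈ {y : E4 | 0 ≤ y 0} ↔ φ' z ∈ threeHoledDisk ×ˢ univ := by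
    intro z hz
    rw [hφ', mem_prod, and_iff_left (mem_univ _)]
    exact (collarMap_mem_iff (hsrc z hz)).symm
  have hyH : y ∈ {y : E4 | 0 ≤ y 0} := by
    rw [hst y hyφ, hφ', hyx]
    exact ⟨x.base.2, mem_univ _⟩
  set ψ := φ'.restrictSubtypes hst ⟨y, hyH⟩ ⟨(x.base, x.coord k), x.base.2, mem_univ _⟩
  set h := (Homeomorph.Set.prod threeHoledDisk (univ : Set Torus)).trans
    ((Homeomorph.refl _).prodCongr (Homeomorph.Set.univ Torus))
  set c : OpenPartialHomeomorph Splitter (EuclideanHalfSpace 4) :=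
    (FlatBundle.triv splitterRep k).trans (h.symm.toOpenPartialHomeomorph.trans ψ.symm) with hc
  have hmem : ∀ z, z ∈ c.source ↔ (z.base : ℂ) ∈ sheet k ∧
      ((z.base : ℂ), z.coord k) ∈ φ'.target := by
    intro z
    simp only [hc, OpenPartialHomeomorph.trans_source, mem_inter_iff, mem_preimage,
      FlatBundle.mem_triv_source, FlatBundle.triv_apply, Homeomorph.toOpenPartialHomeomorph_source,
      univ_inter, OpenPartialHomeomorph.symm_source]
    rfl
  refine ⟨c, (hmem x).2 ⟨hk, ?_⟩, j, k, fun z hz => ?_⟩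
  · rw [← hyx, ← hφ']
    exact φ'.map_source hyφ
  · obtain ⟨h3, h4⟩ := (hmem z).1 hz
    refine ⟨h4.2, h3, ?_⟩
    have h5 : c z = ψ.symm (h.symm (z.base, z.coord k)) := by
      change ψ.symm (h.symm (FlatBundle.triv splitterRep k z)) = _
      rw [FlatBundle.triv_apply]
    have h7 : h.symm (z.base, z.coord k) ∈ ψ.target := h4
    have h8 := φ'.coe_restrictSubtypes hst ⟨y, hyH⟩ ⟨(x.base, x.coord k), x.base.2, mem_univ _⟩
      (ψ.map_target h7)
    rw [← hφ', h5]
    refine h8.symm.trans ?_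
    rw [ψ.right_inv h7]
    rfl

instance : ChartedSpace (EuclideanHalfSpace 4) Splitter where
  atlas := {c | ∃ j k, IsAdapted j k c}
  chartAt x := (exists_isAdapted x).choose
  mem_chart_source x := (exists_isAdapted x).choose_spec.1
  chart_mem_atlas x := (exists_isAdapted x).choose_spec.2

theorem exists_isAdapted_chartAt (x : Splitter) :
    ∃ j k, IsAdapted j k (chartAt (EuclideanHalfSpace 4) x) :=
  (exists_isAdapted x).choose_spec.2

theorem secondCountableTopology_splitter : SecondCountableTopology Splitter :=
  have : SecondCountableTopology (EuclideanHalfSpace 4) :=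
    inferInstanceAs (SecondCountableTopology {x : EuclideanSpace ℝ (Fin 4) // 0 ≤ x 0})
  ChartedSpace.secondCountable_of_sigmaCompact (EuclideanHalfSpace 4) Splitter

end Charts

/-! ### The smooth structure of the splitter -/

section Smooth

/-- The linear map of the plane given by an integer matrix. -/
def planeMap (A : Matrix.SpecialLinearGroup (Fin 2) ℤ) : ℝ × ℝ →L[ℝ] ℝ × ℝ :=
  (Matrix.toLin (Module.Basis.finTwoProd ℝ) (Module.Basis.finTwoProd ℝ)
    ((A : Matrix (Fin 2) (Fin 2) ℤ).map (Int.cast : ℤ → ℝ))).toContinuousLinearMap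

theorem planeMap_apply (A : Matrix.SpecialLinearGroup (Fin 2) ℤ) (v : ℝ × ℝ) :
    planeMap A v = (A.1 0 0 * v.1 + A.1 0 1 * v.2, A.1 1 0 * v.1 + A.1 1 1 * v.2) := by
  change Matrix.toLin (Module.Basis.finTwoProd ℝ) (Module.Basis.finTwoProd ℝ) _ v = _
  rw [Matrix.eta_fin_two ((A : Matrix (Fin 2) (Fin 2) ℤ).map (Int.cast : ℤ → ℝ)),
    Matrix.toLin_finTwoProd_apply]
  rfl

theorem det_planeMap (A : Matrix.SpecialLinearGroup (Fin 2) ℤ) :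
    LinearMap.det (planeMap A : ℝ × ℝ →ₗ[ℝ] ℝ × ℝ) = 1 := by
  have h : (planeMap A : ℝ × ℝ →ₗ[ℝ] ℝ × ℝ) =
    Matrix.toLin (Module.Basis.finTwoProd ℝ) (Module.Basis.finTwoProd ℝ)
      ((A : Matrix (Fin 2) (Fin 2) ℤ).map (Int.cast : ℤ → ℝ)) := rfl
  rw [h, LinearMap.det_toLin]
  have := (Int.castRingHom ℝ).map_det (A : Matrix (Fin 2) (Fin 2) ℤ)
  rw [A.2] at this
  simpa using this.symm

theorem planeToTorus_planeMap (A : Matrix.SpecialLinearGroup (Fin 2) ℤ) (v : ℝ × ℝ) :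
    planeToTorus (planeMap A v) = torusHomeo A (planeToTorus v) := by
  have key : ∀ (a b : ℤ), Circle.exp (2 * Real.pi * (a * v.1 + b * v.2)) =
      Circle.exp (2 * Real.pi * v.1) ^ a * Circle.exp (2 * Real.pi * v.2) ^ b := fun a b => by
    rw [← Circle.exp_intCast_mul, ← Circle.exp_intCast_mul, ← Circle.exp_add]
    congr 1; ring
  rw [planeMap_apply]
  exact Prod.ext (key _ _) (key _ _)

theorem planeToTorus_sub (v w : ℝ × ℝ) :
    planeToTorus (v - w) = planeToTorus v / planeToTorus w := by
  refine Prod.ext ?_ ?_ <;> simp [planeToTorus, mul_sub]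

/-- Two continuous functions with the same image in the torus differ locally by a constant. -/
theorem eventually_sub_eq {A : Type*} [TopologicalSpace A] {a : A} {f g : A → ℝ × ℝ}
    (hf : ContinuousAt f a) (hg : ContinuousAt g a)
    (h : ∀ᶠ b in 𝓝 a, planeToTorus (f b) = planeToTorus (g b)) :
    ∀ᶠ b in 𝓝 a, f b = g b + (f a - g a) := by
  have h1 := (hf.sub hg).eventually (eventually_torusAngle (f a - g a))
  filter_upwards [h1, h] with b hb1 hb2
  simp only [Pi.sub_apply] at hb1
  have h2 := h1.self_of_nhds
  simp only [Pi.sub_apply] at h2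
  rw [planeToTorus_sub, hb2, div_self'] at hb1
  rw [planeToTorus_sub, h.self_of_nhds, div_self'] at h2
  rw [← h2, hb1]
  abel

/-- The coordinate change in the fiber between two sheets is locally a linear diffeomorphism of the
torus. -/
theorem exists_eventually_coord_eq {x : Splitter} {k k' : Fin 4} (hk : (x.base : ℂ) ∈ sheet k)
    (hk' : (x.base : ℂ) ∈ sheet k') : ∃ A : Matrix.SpecialLinearGroup (Fin 2) ℤ,
      ∀ᶠ z in 𝓝 x, z.coord k' = torusHomeo A (z.coord k) := by
  refine ⟨splitterMatrix ((shift k' x.base)⁻¹ * shift k x.base), ?_⟩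
  have h1 := (continuous_subtype_val.comp (FlatBundle.continuous_base
    (ρ := splitterRep))).continuousAt (x := x) |>.eventually (eventually_shift_eq hk hk')
  filter_upwards [h1] with z hz
  simp only [Function.comp_apply] at hz
  rw [← hz]
  change _ = splitterRep ((shift k' z.base)⁻¹ * shift k z.base) (z.coord k)
  rw [map_mul, Homeomorph.mul_apply, FlatBundle.rho_shift_coord]
  rfl

theorem eventually_modelMap_comp {j : Option (Fin 4)} {y : E4} {L : ℂ × Torus → E4}
    (hL : ∀ᶠ x in 𝓝 y, L (modelMap j x) = x) :
    ∀ᶠ p in 𝓝 (modelMap j y), modelMap j (L p) = p := by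
  obtain ⟨φ, h1, h2⟩ := exists_modelMap_localHomeomorph j y
  have h3 := φ.map_nhds_eq h1
  rw [h2] at h3
  rw [← h3, Filter.eventually_map]
  filter_upwards [hL] with x hx
  rw [hx]

theorem contMDiff_torusHomeo (A : Matrix.SpecialLinearGroup (Fin 2) ℤ) :
    ContMDiff torusModel torusModel ∞ (torusHomeo A) := contMDiff_linearTorusMap A.1

/-- The transitions between adapted charts are the restrictions of smooth maps with positive
Jacobian determinant: they are products of a holomorphic map and an affine map with linear part in
`SL(2, ℤ)`. -/
theorem exists_transition {j j' : Option (Fin 4)} {k k' : Fin 4}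
    {c c' : OpenPartialHomeomorph Splitter (EuclideanHalfSpace 4)} (hc : IsAdapted j k c)
    (hc' : IsAdapted j' k' c') {x : Splitter} (hx : x ∈ c.source) (hx' : x ∈ c'.source) :
    ∃ T : E4 → E4, ContDiffAt ℝ ∞ T (c x).1 ∧ (∀ᶠ z in 𝓝 x, (c' z).1 = T (c z).1) ∧
      0 < (fderiv ℝ T (c x).1).det := by
  obtain ⟨h1, h2, h3⟩ := hc x hx
  obtain ⟨h1', h2', h3'⟩ := hc' x hx'
  obtain ⟨A, hA⟩ := exists_eventually_coord_eq h2 h2'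
  obtain ⟨L, hL, hL'⟩ := exists_modelMap_leftInverse j' (c' x).1
  set y := (c x).1
  let g : ℂ × Torus → ℂ × Torus := Prod.map id (torusHomeo A)
  have hg : ContMDiff (𝓘(ℝ, ℂ).prod torusModel) (𝓘(ℝ, ℂ).prod torusModel) ∞ g :=
    contMDiff_id.prodMap (contMDiff_torusHomeo A)
  have hgy : g (modelMap j y) = modelMap j' (c' x).1 := by
    rw [h3, h3', hA.self_of_nhds]; rfl
  have hTy : L (g (modelMap j y)) = (c' x).1 := by rw [hgy]; exact hL'.self_of_nhds
  have hT : ContDiffAt ℝ ∞ (fun u => L (g (modelMap j u))) y := by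
    rw [← contMDiffAt_iff_contDiffAt]
    rw [← hgy] at hL
    exact hL.comp y ((hg.comp (contMDiff_modelMap j)).contMDiffAt)
  refine ⟨_, hT, ?_, ?_⟩
  · have h4 : ∀ᶠ z in 𝓝 x, L (modelMap j' (c' z).1) = (c' z).1 :=
      (continuous_subtype_val.continuousAt.comp (c'.continuousAt hx')).eventually hL'
    filter_upwards [h4, hA, c.open_source.mem_nhds hx, c'.open_source.mem_nhds hx']
      with z hz1 hz2 hz3 hz4
    rw [← hz1, (hc z hz3).2.2, (hc' z hz4).2.2, hz2]
    rfl
  · set T := fun u => L (g (modelMap j u)) with hTdef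
    have hgc : Continuous fun u => g (modelMap j u) :=
      hg.continuous.comp (contMDiff_modelMap j).continuous
    have h4 : ∀ᶠ u in 𝓝 y, modelMap j' (T u) = g (modelMap j u) := by
      have := eventually_modelMap_comp hL'
      rw [← hgy] at this
      exact hgc.continuousAt.eventually this
    have hTd : HasFDerivAt T (fderiv ℝ T y) y :=
      (hT.differentiableAt (by simp)).hasFDerivAt
    set T' := fderiv ℝ T y
    have hS : HasFDerivAt (fun u => splitCoords (T u))
        (splitCoords.toContinuousLinearMap ∘L T') y :=
      splitCoords.toContinuousLinearMap.hasFDerivAt.comp y hTd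
    obtain ⟨a, ha, hda⟩ := hasStrictDerivAt_collarMap j (splitCoords y).1
    obtain ⟨a', ha', hda'⟩ := hasStrictDerivAt_collarMap j' (splitCoords (T y)).1
    have e1 : ∀ v, a' * (splitCoords (T' v)).1 = a * (splitCoords v).1 := by
      have f1 : HasFDerivAt (fun u => collarMap j' (splitCoords (T u)).1) _ y :=
        HasFDerivAt.comp (g := collarMap j') (f := fun u => (splitCoords (T u)).1) y
          (hda'.hasDerivAt.hasFDerivAt.restrictScalars ℝ) hS.fst
      have f2 : HasFDerivAt (fun u => collarMap j (splitCoords u).1) _ y :=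
        HasFDerivAt.comp (g := collarMap j) (f := fun u => (splitCoords u).1) y
          (hda.hasDerivAt.hasFDerivAt.restrictScalars ℝ)
          splitCoords.toContinuousLinearMap.hasFDerivAt.fst
      have f3 := f1.unique (f2.congr_of_eventuallyEq (h4.mono fun u hu => congrArg Prod.fst hu))
      intro v
      have := DFunLike.congr_fun f3 v
      simpa [mul_comm] using this
    have e2 : ∀ v, (splitCoords (T' v)).2 = planeMap A (splitCoords v).2 := by
      have f0 : ∀ᶠ u in 𝓝 y, planeToTorus (splitCoords (T u)).2 =
          planeToTorus (planeMap A (splitCoords u).2) := h4.mono fun u hu => by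
        rw [planeToTorus_planeMap]; exact congrArg Prod.snd hu
      have f2 : HasFDerivAt (fun u => planeMap A (splitCoords u).2) _ y :=
        (planeMap A).hasFDerivAt.comp y splitCoords.toContinuousLinearMap.hasFDerivAt.snd
      have f3 := hS.snd.unique ((f2.add_const _).congr_of_eventuallyEq
        (eventually_sub_eq hS.snd.continuousAt f2.continuousAt f0))
      intro v
      exact DFunLike.congr_fun f3 v
    have e3 : (T' : E4 →ₗ[ℝ] E4) = (splitCoords.symm.toLinearEquiv : ℂ × (ℝ × ℝ) →ₗ[ℝ] E4) ∘ₗ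
        (LinearMap.prodMap (LinearMap.mulLeft ℝ (a'⁻¹ * a)) (planeMap A : ℝ × ℝ →ₗ[ℝ] ℝ × ℝ)) ∘ₗ
          (splitCoords.symm.toLinearEquiv.symm : E4 →ₗ[ℝ] ℂ × (ℝ × ℝ)) := by
      ext1 v
      apply splitCoords.injective
      refine Prod.ext ?_ ?_
      · change _ = (splitCoords (splitCoords.symm (a'⁻¹ * a * (splitCoords v).1, _))).1
        rw [ContinuousLinearEquiv.apply_symm_apply, _root_.mul_assoc, ← e1,
          inv_mul_cancel_left₀ ha']
        rfl
      · change _ = (splitCoords (splitCoords.symm (_, planeMap A (splitCoords v).2))).2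
        rw [ContinuousLinearEquiv.apply_symm_apply, ← e2]
        rfl
    rw [ContinuousLinearMap.det, e3, LinearMap.det_conj, LinearMap.det_prodMap, det_planeMap,
      mul_one]
    change 0 < Algebra.norm ℝ (a'⁻¹ * a)
    rw [Algebra.norm_complex_apply, Complex.normSq_pos]
    exact mul_ne_zero (inv_ne_zero ha') ha

/-- The coordinate change between two charts at a point of the model. -/
theorem eventually_transition {c c' : OpenPartialHomeomorph Splitter (EuclideanHalfSpace 4)}
    {x : Splitter} (hx : x ∈ c.source) {T : E4 → E4} (hT : ∀ᶠ z in 𝓝 x, (c' z).1 = T (c z).1) :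
    ∀ᶠ u in 𝓝[range (𝓡∂ 4)] (c x).1, (c' (c.symm ((𝓡∂ 4).symm u))).1 = T u := by
  have hs : (𝓡∂ 4).symm (c x).1 = c x := (𝓡∂ 4).left_inv (c x)
  have h1 : ContinuousAt (fun u : E4 => c.symm ((𝓡∂ 4).symm u)) (c x).1 := by
    refine ContinuousAt.comp (g := c.symm) ?_ (𝓡∂ 4).continuous_symm.continuousAt
    rw [hs]; exact c.continuousAt_symm (c.map_source hx)
  have h2 : ∀ᶠ u in 𝓝 (c x).1, (𝓡∂ 4).symm u ∈ c.target := by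
    refine (𝓡∂ 4).continuous_symm.continuousAt.eventually (c.open_target.mem_nhds ?_)
    rw [hs]; exact c.map_source hx
  have h3 : c.symm ((𝓡∂ 4).symm (c x).1) = x := by rw [hs, c.left_inv hx]
  rw [← h3] at hT
  filter_upwards [mem_nhdsWithin_of_mem_nhds (h1.eventually hT), mem_nhdsWithin_of_mem_nhds h2,
    self_mem_nhdsWithin] with u hu1 hu2 hu3
  rw [hu1, c.right_inv hu2]
  exact congrArg T ((𝓡∂ 4).right_inv hu3)

instance : IsManifold (𝓡∂ 4) ∞ Splitter := by
  apply isManifold_of_contDiffOn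
  rintro c c' ⟨j, k, hc⟩ ⟨j', k', hc'⟩ y ⟨hy, hyr⟩
  obtain ⟨hy1, hy2⟩ := hy
  have hx := c.map_target hy1
  have hyx : (c (c.symm ((𝓡∂ 4).symm y))).1 = y := by
    rw [c.right_inv hy1]; exact (𝓡∂ 4).right_inv hyr
  obtain ⟨T, h1, h2, -⟩ := exists_transition hc hc' hx hy2
  have h3 := eventually_transition hx h2
  rw [hyx] at h1 h3
  exact (h1.contDiffWithinAt.congr_of_eventuallyEq h3 (h3.self_of_nhdsWithin hyr)).mono
    inter_subset_right

instance : IsManifold (𝓡∂ 4) 1 Splitter := .of_le (n := ∞) (by simp)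

/-- The orientation of the splitter: in each adapted chart it is the standard orientation. -/
def splitterOrientation : ManifoldOrientation (𝓡∂ 4) Splitter where
  orient _ := (EuclideanSpace.basisFun (Fin 4) ℝ).toBasis.orientation
  locallyConstant x₀ := by
    refine ⟨(EuclideanSpace.basisFun (Fin 4) ℝ).toBasis.orientation, .of_forall fun x hx => ?_⟩
    rw [TangentBundle.trivializationAt_baseSet] at hx
    obtain ⟨j, k, hc⟩ := exists_isAdapted_chartAt x
    obtain ⟨j', k', hc'⟩ := exists_isAdapted_chartAt x₀
    have hx0 := mem_chart_source (EuclideanHalfSpace 4) x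
    obtain ⟨T, h1, h2, h3⟩ := exists_transition hc hc' hx0 hx
    have h4 := eventually_transition hx0 h2
    have h5 : HasFDerivWithinAt T (tangentCoordChange (𝓡∂ 4) x x₀ x) (range (𝓡∂ 4))
        (extChartAt (𝓡∂ 4) x x) :=
      (hasFDerivWithinAt_tangentCoordChange (I := 𝓡∂ 4) (x := x) (y := x₀) (z := x)
        ⟨mem_extChartAt_source x, by rwa [extChartAt_source]⟩).congr_of_eventuallyEq
        (h4.mono fun u hu => hu.symm) (h4.self_of_nhdsWithin (mem_range_self _)).symm
    have h6 : tangentCoordChange (𝓡∂ 4) x x₀ x =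
        fderiv ℝ T (chartAt (EuclideanHalfSpace 4) x x).1 :=
      ((𝓡∂ 4).uniqueDiffOn _ (mem_range_self _)).eq h5
        (h1.differentiableAt (by simp)).hasFDerivAt.hasFDerivWithinAt
    rw [← h6] at h3
    have h7 := TangentBundle.continuousLinearMapAt_trivializationAt_eq_core (I := 𝓡∂ 4) hx
    let e : E4 ≃ₗ[ℝ] E4 := ((trivializationAt (EuclideanSpace ℝ (Fin 4))
      (TangentSpace (𝓡∂ 4) : Splitter → Type _) x₀).continuousLinearEquivAt ℝ x hx).toLinearEquiv
    have h8 : (e : E4 →ₗ[ℝ] E4) = (tangentCoordChange (𝓡∂ 4) x x₀ x : E4 →ₗ[ℝ] E4) :=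
      LinearMap.ext fun v =>
        (congrFun (Bundle.Trivialization.coe_continuousLinearEquivAt_eq (R := ℝ)
          (trivializationAt (EuclideanSpace ℝ (Fin 4)) (TangentSpace (𝓡∂ 4) : Splitter → Type _) x₀)
          hx) v).trans (DFunLike.congr_fun h7 v)
    refine (Orientation.map_eq_iff_det_pos (M := E4) _ e (by simp)).2 ?_
    rw [h8]
    exact h3

end Smooth

/-! ### Smooth maps from and to the splitter -/

section SmoothMaps

theorem exists_contMDiffAt_base_coord (x : Splitter) : ∃ k, (x.base : ℂ) ∈ sheet k ∧
    ContMDiffAt (𝓡∂ 4) (𝓘(ℝ, ℂ).prod torusModel) ∞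
      (fun z : Splitter => ((z.base : ℂ), z.coord k)) x := by
  obtain ⟨j, k, hc⟩ := exists_isAdapted_chartAt x
  have hx := mem_chart_source (EuclideanHalfSpace 4) x
  refine ⟨k, (hc x hx).2.1, ?_⟩
  have h1 : ContMDiffAt (𝓡∂ 4) 𝓘(ℝ, E4) ∞ (extChartAt (𝓡∂ 4) x) x := contMDiffAt_extChartAt
  refine ((contMDiff_modelMap j).contMDiffAt.comp x h1).congr_of_eventuallyEq ?_
  filter_upwards [(chartAt (EuclideanHalfSpace 4) x).open_source.mem_nhds hx] with z hz
  exact (hc z hz).2.2.symm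

theorem contMDiff_base : ContMDiff (𝓡∂ 4) 𝓘(ℝ, ℂ) ∞ fun x : Splitter => (x.base : ℂ) := by
  intro x
  obtain ⟨k, -, h⟩ := exists_contMDiffAt_base_coord x
  exact contMDiffAt_fst.comp x h

theorem contMDiffAt_coord {k : Fin 4} {x : Splitter} (hk : (x.base : ℂ) ∈ sheet k) :
    ContMDiffAt (𝓡∂ 4) torusModel ∞ (FlatBundle.coord k : Splitter → Torus) x := by
  obtain ⟨k', hk', h⟩ := exists_contMDiffAt_base_coord x
  obtain ⟨A, hA⟩ := exists_eventually_coord_eq hk' hk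
  have h2 : ContMDiffAt (𝓡∂ 4) torusModel ∞ (FlatBundle.coord k' : Splitter → Torus) x :=
    contMDiffAt_snd.comp x h
  exact ((contMDiff_torusHomeo A).contMDiffAt.comp x h2).congr_of_eventuallyEq hA

theorem FlatBundle.continuousWithinAt_of_coord {F : Type} [TopologicalSpace F]
    {ρ : Free3 →* (F ≃ₜ F)} {A : Type*} [TopologicalSpace A] {g : A → FlatBundle ρ} {s : Set A}
    {a : A} (ha : a ∈ s) (k : Fin 4) (hk : ((g a).base : ℂ) ∈ sheet k)
    (h1 : ContinuousWithinAt (fun b => (g b).base) s a)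
    (h2 : ContinuousWithinAt (fun b => (g b).coord k) s a) : ContinuousWithinAt g s a := by
  rw [continuousWithinAt_iff_continuousAt_domRestrict _ ha] at h1 h2 ⊢
  exact continuousAt_of_coord k hk h1 h2

variable {E H N : Type*} [NormedAddCommGroup E] [NormedSpace ℝ E] [TopologicalSpace H]
  {I : ModelWithCorners ℝ E H} [TopologicalSpace N] [ChartedSpace H N]

/-- A map to the splitter is smooth if its base component and its coordinate with respect to one of
the sheets are. -/
theorem contMDiffWithinAt_of_coord {g : N → Splitter} {s : Set N} {a : N} (ha : a ∈ s) (k : Fin 4)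
    (hk : ((g a).base : ℂ) ∈ sheet k)
    (h1 : ContMDiffWithinAt I 𝓘(ℝ, ℂ) ∞ (fun b => ((g b).base : ℂ)) s a)
    (h2 : ContMDiffWithinAt I torusModel ∞ (fun b => (g b).coord k) s a) :
    ContMDiffWithinAt I (𝓡∂ 4) ∞ g s a := by
  have hcont : ContinuousWithinAt g s a :=
    FlatBundle.continuousWithinAt_of_coord ha k hk
      (Topology.IsInducing.subtypeVal.continuousWithinAt_iff.2 h1.continuousWithinAt)
      h2.continuousWithinAt
  rw [contMDiffWithinAt_iff_target]
  refine ⟨hcont, ?_⟩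
  obtain ⟨j, k', hc⟩ := exists_isAdapted_chartAt (g a)
  have hga := mem_chart_source (EuclideanHalfSpace 4) (g a)
  obtain ⟨-, hk', hm⟩ := hc _ hga
  obtain ⟨A, hA⟩ := exists_eventually_coord_eq hk hk'
  obtain ⟨L, hL, hL'⟩ := exists_modelMap_leftInverse j
    (chartAt (EuclideanHalfSpace 4) (g a) (g a)).1
  have h3 : ContMDiffWithinAt I torusModel ∞ (fun b => (g b).coord k') s a :=
    ((contMDiff_torusHomeo A).contMDiffAt.comp_contMDiffWithinAt a h2).congr_of_eventuallyEq
      (hcont.eventually hA) hA.self_of_nhds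
  rw [hm] at hL
  have h4 := hL.comp_contMDiffWithinAt a (h1.prodMk h3)
  have h5 : ∀ᶠ z in 𝓝 (g a), extChartAt (𝓡∂ 4) (g a) z = L ((z.base : ℂ), z.coord k') := by
    have h6 : ContinuousAt (fun z => (chartAt (EuclideanHalfSpace 4) (g a) z).1) (g a) :=
      continuous_subtype_val.continuousAt.comp
        ((chartAt (EuclideanHalfSpace 4) (g a)).continuousAt hga)
    filter_upwards [h6.eventually hL', (chartAt (EuclideanHalfSpace 4) (g a)).open_source.mem_nhds
      hga] with z hz1 hz2
    rw [← (hc z hz2).2.2, hz1]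
    rfl
  exact h4.congr_of_eventuallyEq (hcont.eventually h5) h5.self_of_nhds

theorem contMDiffAt_of_coord {g : N → Splitter} {a : N} (k : Fin 4)
    (hk : ((g a).base : ℂ) ∈ sheet k)
    (h1 : ContMDiffAt I 𝓘(ℝ, ℂ) ∞ (fun b => ((g b).base : ℂ)) a)
    (h2 : ContMDiffAt I torusModel ∞ (fun b => (g b).coord k) a) :
    ContMDiffAt I (𝓡∂ 4) ∞ g a :=
  contMDiffWithinAt_of_coord (mem_univ a) k hk h1 h2

/-- The boundary of the splitter lies over the boundary circles. -/
theorem mem_boundary_iff {x : Splitter} : x ∈ (𝓡∂ 4).boundary Splitter ↔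
    ∃ i, ‖(x.base : ℂ) - circleCenter i‖ = circleRadius i := by
  have h0 : x ∈ (𝓡∂ 4).boundary Splitter ↔ (chartAt (EuclideanHalfSpace 4) x x).1 0 = 0 := by
    change (𝓡∂ 4).IsBoundaryPoint x ↔ _
    rw [ModelWithCorners.isBoundaryPoint_iff, frontier_range_modelWithCornersEuclideanHalfSpace]
    exact eq_comm
  obtain ⟨j, k, hc⟩ := exists_isAdapted_chartAt x
  obtain ⟨hj, -, hm⟩ := hc x (mem_chart_source _ x)
  have hbase : collarMap j (splitCoords (chartAt (EuclideanHalfSpace 4) x x).1).1 = x.base :=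
    congrArg Prod.fst hm
  have hre : (splitCoords (chartAt (EuclideanHalfSpace 4) x x).1).1.re =
    (chartAt (EuclideanHalfSpace 4) x x).1 0 := rfl
  rw [h0, ← hre]
  rcases j with _ | i
  · refine iff_of_false (fun h => ?_) fun ⟨i, hi⟩ => collarRange_norm_ne (by simp) hj hi
    have h1 := (abs_le.1 (Complex.abs_re_le_norm (x.base : ℂ))).1
    rw [← hbase] at h1 hj
    have h2 := hj.1
    have h3 : (collarMap none (splitCoords (chartAt (EuclideanHalfSpace 4) x x).1).1).re = -5 := by
      simp [collarMap, h]
    linarith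
  · rw [collarMap_re_eq_zero_iff, hbase]
    refine ⟨fun h => ⟨i, h⟩, fun ⟨i', hi'⟩ => ?_⟩
    by_cases h : some i = some i'
    · rw [Option.some.inj h]; exact hi'
    · exact absurd hi' (collarRange_norm_ne h hj)

end SmoothMaps

/-! ### Mapping tori as smooth manifolds -/

section SmoothMappingTorus
variable {F : Type} [TopologicalSpace F] (φ : F ≃ₜ F)
  {H : Type*} [TopologicalSpace H] [ChartedSpace H F]
  {E : Type*} [NormedAddCommGroup E] [NormedSpace ℝ E] {I : ModelWithCorners ℝ E H}

/-- The covering of a mapping torus has smooth local inverses. -/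
theorem MappingTorus.exists_leftInverse [IsManifold I ∞ F] (h : ContMDiff I I ∞ φ)
    (h' : ContMDiff I I ∞ φ.symm) (y : MappingTorus φ) :
    ∃ L : MappingTorus φ → F × ℝ, ContMDiffAt (I.prod 𝓘(ℝ, ℝ)) (I.prod 𝓘(ℝ, ℝ)) ∞ L y ∧
      ∀ᶠ z in 𝓝 y, mk φ (L z) = z := by
  set a := (mk_surjective φ).hasRightInverse.choose y
  set L := (isLocalHomeomorph_mk φ).localInverseAt (x := a)
  have := MappingTorus.isManifold φ I h h'
  have hchart : chartAt (ModelProd H ℝ) y = L.trans (chartAt (ModelProd H ℝ) a) := rfl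
  have hy := mem_chart_source (ModelProd H ℝ) y
  rw [hchart, OpenPartialHomeomorph.trans_source] at hy
  refine ⟨L, ?_, ?_⟩
  · have h1 : ContMDiffOn (I.prod 𝓘(ℝ, ℝ)) (I.prod 𝓘(ℝ, ℝ)) ∞
        ((extChartAt (I.prod 𝓘(ℝ, ℝ)) a).symm ∘ extChartAt (I.prod 𝓘(ℝ, ℝ)) y)
        (chartAt (ModelProd H ℝ) y).source := by
      refine (contMDiffOn_extChartAt_symm a).comp contMDiffOn_extChartAt fun z hz => ?_
      rw [hchart, OpenPartialHomeomorph.trans_source] at hz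
      exact (extChartAt (I.prod 𝓘(ℝ, ℝ)) a).map_source (by rw [extChartAt_source]; exact hz.2)
    refine (h1.contMDiffAt ((chartAt (ModelProd H ℝ) y).open_source.mem_nhds
      (mem_chart_source _ y))).congr_of_eventuallyEq ?_
    filter_upwards [(chartAt (ModelProd H ℝ) y).open_source.mem_nhds (mem_chart_source _ y)]
      with z hz
    rw [hchart, OpenPartialHomeomorph.trans_source] at hz
    exact ((extChartAt (I.prod 𝓘(ℝ, ℝ)) a).left_inv
      (by rw [extChartAt_source]; exact hz.2)).symm
  · filter_upwards [L.open_source.mem_nhds hy.1] with z hz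
    exact (isLocalHomeomorph_mk φ).apply_localInverseAt_of_mem hz

theorem MappingTorus.contMDiff_mk [IsManifold I ∞ F] (h : ContMDiff I I ∞ φ)
    (h' : ContMDiff I I ∞ φ.symm) :
    ContMDiff (I.prod 𝓘(ℝ, ℝ)) (I.prod 𝓘(ℝ, ℝ)) ∞ (mk φ) := by
  intro b
  have := MappingTorus.isManifold φ I h h'
  set y := mk φ b with hy
  set a := (mk_surjective φ).hasRightInverse.choose y with ha
  have hay : mk φ a = y := (mk_surjective φ).hasRightInverse.choose_spec y
  obtain ⟨n, hn⟩ := (mk_eq_mk_iff φ).1 (hy ▸ hay.symm : mk φ b = mk φ a)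
  have hD : ContMDiff (I.prod 𝓘(ℝ, ℝ)) (I.prod 𝓘(ℝ, ℝ)) ∞ (deck φ n) :=
    (contMDiff_zpow φ I h h' n).prodMap
      (contDiff_id.add contDiff_const : ContDiff ℝ ∞ fun t : ℝ => t + (n : ℝ)).contMDiff
  rw [contMDiffAt_iff_target]
  refine ⟨(continuous_mk φ).continuousAt, ?_⟩
  set L := (isLocalHomeomorph_mk φ).localInverseAt (x := a)
  have haL : a ∈ L.target := (isLocalHomeomorph_mk φ).self_mem_localInverseAt_target
  have h1 : ContMDiffAt (I.prod 𝓘(ℝ, ℝ)) 𝓘(ℝ, E × ℝ) ∞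
      (fun c => extChartAt (I.prod 𝓘(ℝ, ℝ)) a (deck φ n c)) b := by
    have h2 : ContMDiffAt (I.prod 𝓘(ℝ, ℝ)) 𝓘(ℝ, E × ℝ) ∞
      (extChartAt (I.prod 𝓘(ℝ, ℝ)) a) (deck φ n b) := hn ▸ contMDiffAt_extChartAt
    exact h2.comp b hD.contMDiffAt
  refine h1.congr_of_eventuallyEq ?_
  rw [hn] at haL
  filter_upwards [(deck φ n).continuous.continuousAt.eventually (L.open_target.mem_nhds haL)]
    with c hc
  have h3 : L (mk φ c) = deck φ n c := by
    have h4 : mk φ c = L.symm (deck φ n c) := by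
      rw [(isLocalHomeomorph_mk φ).localInverseAt_symm]
      exact (mk_eq_mk_iff φ).2 ⟨n, rfl⟩
    rw [h4, L.right_inv hc]
  change extChartAt (I.prod 𝓘(ℝ, ℝ)) a (L (mk φ c)) = _
  rw [h3]
end SmoothMappingTorus

/-! ### The parametrization of the boundary -/

section BoundaryParametrization

theorem collarSign_mul_self (i : Fin 4) : collarSign i * collarSign i = 1 := by
  fin_cases i <;> simp [collarSign]

theorem boundaryLoop_eq_collarMap (i : Fin 4) (t : ℝ) :
    boundaryLoop i t = collarMap (some i) ⟨0, -(collarSign i * (2 * Real.pi * t))⟩ := by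
  have h : (collarSign i : ℂ) * ⟨0, -(collarSign i * (2 * Real.pi * t))⟩ =
      -(2 * Real.pi * t * Complex.I) := by
    apply Complex.ext
    · simp
    · simp only [Complex.im_ofReal_mul, mul_neg, ← mul_assoc, collarSign_mul_self]
      simp
  rw [boundaryLoop, collarMap, h]

theorem norm_boundaryLoop_sub (i : Fin 4) (t : ℝ) :
    ‖boundaryLoop i t - circleCenter i‖ = circleRadius i := by
  rw [boundaryLoop_eq_collarMap, ← collarMap_re_eq_zero_iff]

theorem mem_collarRange_of_norm_eq {i : Fin 4} {z : ℂ}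
    (h : ‖z - circleCenter i‖ = circleRadius i) : z ∈ collarRange (some i) := by
  simp only [collarRange, mem_ofPred_eq]
  fin_cases i <;> simp [circleCenter, circleRadius] at h ⊢ <;> rw [h] <;> norm_num

theorem exists_boundaryLoop_eq {i : Fin 4} {z : ℂ} (h : ‖z - circleCenter i‖ = circleRadius i) :
    ∃ t, boundaryLoop i t = z := by
  have h0 : (circleRadius i : ℂ) * Complex.I ≠ 0 :=
    mul_ne_zero (Complex.ofReal_ne_zero.2 (circleRadius_pos i).ne') Complex.I_ne_zero
  set u := (circleCenter i - z) / (circleRadius i * Complex.I) with hu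
  have hn : ‖u‖ = 1 := by
    rw [hu, norm_div, norm_sub_rev, h, norm_mul, Complex.norm_I, mul_one, Complex.norm_real,
      Real.norm_of_nonneg (circleRadius_pos i).le, div_self (circleRadius_pos i).ne']
  refine ⟨-(u.arg / (2 * Real.pi)), ?_⟩
  have h1 : -(2 * Real.pi * ((-(u.arg / (2 * Real.pi)) : ℝ) : ℂ) * Complex.I) =
      u.arg * Complex.I := by
    have := Complex.ofReal_ne_zero.2 Real.pi_ne_zero
    push_cast
    field_simp
  have h2 := Complex.norm_mul_exp_arg_mul_I u
  rw [hn, Complex.ofReal_one, one_mul] at h2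
  rw [boundaryLoop, h1, h2, hu, mul_div_cancel₀ _ h0]
  ring

theorem contDiff_boundaryLoop (i : Fin 4) : ContDiff ℝ ∞ (boundaryLoop i) := by
  have h : ContDiff ℝ ∞ fun t : ℝ => (t : ℂ) := Complex.ofRealCLM.contDiff
  exact contDiff_const.sub (contDiff_const.mul
    ((((contDiff_const.mul h).mul contDiff_const).neg).cexp))

theorem contMDiff_loopMap (i : Fin 4) :
    ContMDiff torusBundleModel (𝓡∂ 4) ∞ (loopMap splitterRep i) := by
  intro x
  have hk := FlatBundle.base_mem_sheet (loopMap splitterRep i x)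
  refine contMDiffAt_of_coord _ hk ?_ ?_
  · exact ((contDiff_boundaryLoop i).contMDiff.comp contMDiff_snd) x
  · exact ((contMDiff_torusHomeo (splitterMatrix _)).comp
      contMDiff_fst).contMDiffAt.congr_of_eventuallyEq (eventually_coord_loopMap _ hk)

theorem contMDiff_boundaryMap (i : Fin 4) :
    ContMDiff torusBundleModel (𝓡∂ 4) ∞ (boundaryMap i) := by
  intro y
  obtain ⟨L, hL, hL'⟩ := MappingTorus.exists_leftInverse (torusHomeo (splitterMonodromy i))
    (contMDiff_torusHomeo _) (contMDiff_torusHomeo (splitterMonodromy i)⁻¹) y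
  refine ((contMDiff_loopMap i).contMDiffAt.comp y hL).congr_of_eventuallyEq ?_
  filter_upwards [hL'] with z hz
  rw [← hz, boundaryMap_mk, hz]
  rfl

/-- A local inverse near `t₀` of the parametrization of a boundary circle. -/
def loopAngle (i : Fin 4) (t₀ : ℝ) (z : ℂ) : ℝ :=
  t₀ - (Complex.log ((z - circleCenter i) / (boundaryLoop i t₀ - circleCenter i))).im /
    (2 * Real.pi)

theorem boundaryLoop_sub_ne_zero (i : Fin 4) (t : ℝ) : boundaryLoop i t - circleCenter i ≠ 0 := by
  rw [← norm_ne_zero_iff, norm_boundaryLoop_sub]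
  exact (circleRadius_pos i).ne'

theorem loopAngle_boundaryLoop {i : Fin 4} {t₀ t : ℝ} (h : |t - t₀| < 1 / 2) :
    loopAngle i t₀ (boundaryLoop i t) = t := by
  have h1 : (boundaryLoop i t - circleCenter i) / (boundaryLoop i t₀ - circleCenter i) =
      Complex.exp ((-(2 * Real.pi * (t - t₀)) : ℝ) * Complex.I) := by
    rw [div_eq_iff (boundaryLoop_sub_ne_zero i t₀), boundaryLoop, boundaryLoop,
      sub_sub_cancel_left, sub_sub_cancel_left, mul_neg, neg_inj, mul_left_comm, ← Complex.exp_add]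
    congr 2
    push_cast; ring
  have h2 := abs_lt.1 h
  have h3 := Real.pi_pos
  rw [loopAngle, h1, Complex.log_exp]
  · rw [Complex.im_ofReal_mul, Complex.I_im, mul_one]
    field_simp; ring
  all_goals
    rw [Complex.im_ofReal_mul, Complex.I_im, mul_one]
    nlinarith

theorem contDiffAt_loopAngle (i : Fin 4) (t₀ : ℝ) :
    ContDiffAt ℝ ∞ (loopAngle i t₀) (boundaryLoop i t₀) := by
  have h3 : ContDiffAt ℂ ∞ (fun z : ℂ =>
      Complex.log ((z - circleCenter i) / (boundaryLoop i t₀ - circleCenter i)))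
      (boundaryLoop i t₀) :=
    (Complex.contDiffAt_log (by
      rw [div_self (boundaryLoop_sub_ne_zero i t₀)]; simp)).comp _
      ((contDiffAt_id.sub contDiffAt_const).div_const _)
  exact contDiffAt_const.sub ((Complex.imCLM.contDiff.contDiffAt.comp _
    (h3.restrict_scalars ℝ)).div_const _)

/-- The parametrization of a boundary component has smooth local left inverses. -/
theorem exists_boundaryMap_leftInverse (i : Fin 4) (y : TorusBundle (splitterMonodromy i)) :
    ∃ R : Splitter → TorusBundle (splitterMonodromy i),
      ContMDiffAt (𝓡∂ 4) torusBundleModel ∞ R (boundaryMap i y) ∧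
      ∀ᶠ z in 𝓝 y, R (boundaryMap i z) = z := by
  obtain ⟨x, rfl⟩ := MappingTorus.mk_surjective _ y
  have hk := FlatBundle.base_mem_sheet (loopMap splitterRep i x)
  set k := sheetAt (loopMap splitterRep i x).base
  set A := splitterMatrix ((shift k (boundaryLoop i x.2))⁻¹ * loopLift i x.2)
  refine ⟨fun z => MappingTorus.mk _ (torusHomeo A⁻¹ (z.coord k), loopAngle i x.2 z.base), ?_, ?_⟩
  · have h1 : ContMDiffAt (𝓡∂ 4) torusBundleModel ∞ (fun z : Splitter =>
        (torusHomeo A⁻¹ (z.coord k), loopAngle i x.2 z.base)) (loopMap splitterRep i x) :=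
      ((contMDiff_torusHomeo A⁻¹).contMDiffAt.comp _ (contMDiffAt_coord hk)).prodMk
        (ContMDiffAt.comp (g := loopAngle i x.2) (loopMap splitterRep i x)
          (contDiffAt_loopAngle i x.2).contMDiffAt contMDiff_base.contMDiffAt)
    exact (MappingTorus.contMDiff_mk (torusHomeo (splitterMonodromy i)) (contMDiff_torusHomeo _)
      (contMDiff_torusHomeo (splitterMonodromy i)⁻¹)).contMDiffAt.comp _ h1
  · rw [← (MappingTorus.isLocalHomeomorph_mk _).map_nhds_eq, Filter.eventually_map]
    have h2 : ∀ᶠ z : Torus × ℝ in 𝓝 x, |z.2 - x.2| < 1 / 2 :=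
      (by fun_prop : Continuous fun z : Torus × ℝ =>
        |z.2 - x.2|).continuousAt.eventually_lt_const (by simp)
    filter_upwards [eventually_coord_loopMap splitterRep hk, h2] with z hz hz2
    rw [boundaryMap_mk, hz]
    refine congrArg _ (Prod.ext ?_ (loopAngle_boundaryLoop hz2))
    exact (torusHomeo A).symm_apply_apply z.1

theorem mfderiv_boundaryMap_injective (i : Fin 4) (y : TorusBundle (splitterMonodromy i)) :
    Function.Injective (mfderiv torusBundleModel (𝓡∂ 4) (boundaryMap i) y) := by
  obtain ⟨R, hR, hR'⟩ := exists_boundaryMap_leftInverse i y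
  have h1 := mfderiv_comp y (hR.mdifferentiableAt (by simp))
    ((contMDiff_boundaryMap i).contMDiffAt.mdifferentiableAt (by simp))
  have h2 : (R ∘ boundaryMap i) =ᶠ[𝓝 y] id := hR'
  rw [h2.mfderiv_eq, mfderiv_id] at h1
  intro v w hvw
  have h3 := DFunLike.congr_fun h1 v
  have h4 := DFunLike.congr_fun h1 w
  simp only [ContinuousLinearMap.comp_apply] at h3 h4
  rw [hvw, ← h4] at h3
  exact h3

theorem range_boundaryMap (i : Fin 4) : range (boundaryMap i) =
    {x : Splitter | ‖(x.base : ℂ) - circleCenter i‖ = circleRadius i} := by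
  ext x
  constructor
  · rintro ⟨y, rfl⟩
    obtain ⟨z, rfl⟩ := MappingTorus.mk_surjective _ y
    exact norm_boundaryLoop_sub i z.2
  · intro h
    obtain ⟨t, ht⟩ := exists_boundaryLoop_eq h
    refine ⟨MappingTorus.mk _ ((splitterRep (loopLift i t)).symm x.fib, t), ?_⟩
    rw [boundaryMap_mk]
    exact FlatBundle.ext (Subtype.ext ht) ((splitterRep (loopLift i t)).apply_symm_apply x.fib)

theorem parametrizesBoundary_boundaryMap : ParametrizesBoundary boundaryMap where
  smooth := contMDiff_boundaryMap
  embedding := boundaryMap_isEmbedding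
  immersion := mfderiv_boundaryMap_injective
  disjoint i j hij := by
    simp only [range_boundaryMap, disjoint_left]
    exact fun x hi => collarRange_norm_ne (by simpa using hij) (mem_collarRange_of_norm_eq hi)
  range_eq := by
    ext x
    rw [mem_boundary_iff, mem_iUnion]
    simp only [range_boundaryMap, mem_ofPred_eq]

end BoundaryParametrization

/-! ### The fibration and its monodromies -/

section Fibration

theorem isSmoothTorusFibration_base :
    IsSmoothTorusFibration (fun x : Splitter => (x.base : ℂ)) threeHoledDisk where
  smooth := contMDiff_base
  mem_base x := x.base.2
  locallyTrivial b hb := by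
    classical
    set k := sheetAt b
    let e : Splitter := FlatBundle.pt splitterRep ⟨b, hb⟩ 1
    let s : ℂ × Torus → Splitter := fun p => if hz : p.1 ∈ threeHoledDisk then
      FlatBundle.pt splitterRep ⟨p.1, hz⟩ (splitterRep (shift k p.1) p.2) else e
    have hs : ∀ (p : ℂ × Torus) (hz : p.1 ∈ threeHoledDisk),
        s p = FlatBundle.pt splitterRep ⟨p.1, hz⟩ (splitterRep (shift k p.1) p.2) :=
      fun p hz => dif_pos hz
    have hbase : ∀ p : ℂ × Torus, p.1 ∈ threeHoledDisk → ((s p).base : ℂ) = p.1 := fun p hz => by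
      rw [hs p hz]; rfl
    have hcoord : ∀ p : ℂ × Torus, p.1 ∈ threeHoledDisk → (s p).coord k = p.2 := fun p hz => by
      rw [hs p hz]; exact FlatBundle.coord_pt_shift k ⟨p.1, hz⟩ p.2
    refine ⟨sheet k, isOpen_sheet k, mem_sheet_sheetAt hb, FlatBundle.coord k, s,
      fun x hx => (contMDiffAt_coord hx).contMDiffWithinAt, fun p hp => ?_, fun x _ => ?_,
      fun z hz w => ⟨hbase (z, w) hz.2, hcoord (z, w) hz.2⟩⟩
    · refine contMDiffWithinAt_of_coord hp k (by rw [hbase p hp.1.2]; exact hp.1.1) ?_ ?_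
      · exact contMDiffWithinAt_fst.congr (fun q hq => hbase q hq.1.2) (hbase p hp.1.2)
      · exact contMDiffWithinAt_snd.congr (fun q hq => hcoord q hq.1.2) (hcoord p hp.1.2)
    · rw [hs _ x.base.2]
      exact FlatBundle.pt_coord k x

theorem boundaryArc_re (i : Fin 4) (s : ℝ) :
    (boundaryArc i s).re = s * (circleCenter i).re := by
  have h := boundaryLoop_re i 0
  simp only [mul_zero, Real.sin_zero, sub_zero] at h
  rw [boundaryArc, Complex.add_re, Complex.re_ofReal_mul, h,
    show (1 - (s : ℂ)) = ((1 - s : ℝ) : ℂ) by push_cast; rfl, Complex.re_ofReal_mul]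
  simp

theorem boundaryArc_im (i : Fin 4) (s : ℝ) :
    (boundaryArc i s).im = -(3 * (1 - s)) - s * circleRadius i := by
  have h := boundaryLoop_im i 0
  simp only [mul_zero, Real.cos_zero, mul_one] at h
  rw [boundaryArc, Complex.add_im, Complex.im_ofReal_mul, h,
    show (1 - (s : ℂ)) = ((1 - s : ℝ) : ℂ) by push_cast; rfl, Complex.im_ofReal_mul]
  simp; ring

theorem boundaryArc_mem (i : Fin 4) (s : unitInterval) : boundaryArc i s ∈ threeHoledDisk := by
  obtain ⟨s, h0, h1⟩ := s
  rw [mem_threeHoledDisk_iff, boundaryArc_re, boundaryArc_im]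
  fin_cases i <;> simp [circleCenter, circleRadius] <;> refine ⟨?_, ?_, ?_, ?_⟩ <;> nlinarith

/-- The four arcs stay below the real axis. -/
theorem boundaryArc_im_neg (i : Fin 4) (s : unitInterval) : (boundaryArc i s).im < 0 := by
  rw [boundaryArc_im]
  have h0 := s.2.1
  have h1 := s.2.2
  fin_cases i <;> simp [circleRadius] <;> linarith

theorem loopLift_zero (i : Fin 4) : loopLift i 0 = 1 := by
  have h := boundaryLoop_im_neg (i := i) (t := 0) (n := 0) (by simp)
  rw [loopLift, if_pos h]
  simp

/-- Parallel transport along an arc: below the real axis the bundle is trivial. -/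
def arcTransport (i : Fin 4) : C(unitInterval × Torus, Splitter) where
  toFun p := FlatBundle.pt splitterRep ⟨boundaryArc i p.1, boundaryArc_mem i p.1⟩ p.2
  continuous_toFun := by
    refine continuous_iff_continuousAt.2 fun p =>
      FlatBundle.continuousAt_of_coord 0 (Or.inl (boundaryArc_im_neg i p.1).ne) ?_ ?_
    · have h : Continuous (boundaryArc i) := by unfold boundaryArc; fun_prop
      exact (Continuous.subtype_mk
        (h.comp (continuous_subtype_val.comp continuous_fst)) _).continuousAt
    · have h : ∀ q : unitInterval × Torus, (FlatBundle.pt splitterRep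
          ⟨boundaryArc i q.1, boundaryArc_mem i q.1⟩ q.2).coord 0 =
            splitterRep (crossing 0)⁻¹ q.2 := fun q =>
        FlatBundle.coord_of_neg (boundaryArc_im_neg i q.1)
      simp only [h]
      exact ((splitterRep _).continuous.comp continuous_snd).continuousAt

theorem hasMonodromies_boundaryMap :
    HasMonodromies (fun x : Splitter => (x.base : ℂ)) boundaryMap where
  covers i w t := rfl
  transport := by
    refine ⟨fun w => arcTransport 0 (0, w), fun i => ⟨arcTransport i, fun s => ⟨?_, ?_, ?_⟩,
      fun w => ⟨?_, ?_⟩⟩⟩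
    · exact fun w _ => rfl
    · exact fun w _ w' _ h => congrArg (FlatBundle.fib (ρ := splitterRep)) h
    · exact fun x hx => ⟨x.fib, mem_univ _, FlatBundle.ext (Subtype.ext hx.symm) rfl⟩
    · refine FlatBundle.ext (Subtype.ext ?_) rfl
      change boundaryArc i (0 : ℝ) = boundaryArc 0 (0 : ℝ)
      simp [boundaryArc]
    · rw [boundaryMap_mk]
      refine FlatBundle.ext (Subtype.ext ?_) ?_
      · change boundaryArc i (1 : ℝ) = boundaryLoop i 0
        simp [boundaryArc]
      · change w = splitterRep (loopLift i 0) w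
        rw [loopLift_zero, map_one]; rfl

end Fibration

/-! ### The orientation of the boundary -/

section BoundaryOrientation

theorem hasDerivAt_collarMap_some (i : Fin 4) (ζ : ℂ) :
    HasDerivAt (collarMap (some i)) (collarSign i * (collarMap (some i) ζ - circleCenter i)) ζ := by
  have h := (((((hasDerivAt_id ζ).const_mul (collarSign i : ℂ)).cexp).const_mul
      (circleRadius i * Complex.I)).const_sub (circleCenter i))
  refine h.congr_deriv ?_
  simp only [collarMap, id]
  ring

/-- The first two coordinates. -/
def planePart : EuclideanSpace ℝ (Fin 3) →L[ℝ] ℝ × ℝ :=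
  (EuclideanSpace.proj 0).prod (EuclideanSpace.proj 1)

/-- In collar coordinates the parametrization of a boundary component is affine, and its linear
part is the product of a map in `SL(2, ℤ)` and a reversal of the circle direction at the inner
circles. -/
theorem exists_mfderiv_boundaryMap_unroll (i : Fin 4) (a : EuclideanSpace ℝ (Fin 3)) :
    ∃ M : Matrix.SpecialLinearGroup (Fin 2) ℤ, ∀ v : EuclideanSpace ℝ (Fin 3),
      mfderiv (𝓡 3) (𝓡∂ 4) (boundaryMap i ∘ unroll (splitterMonodromy i)) a v =
        splitCoords.symm (⟨0, -(collarSign i * (2 * Real.pi * v 2))⟩, planeMap M (v 0, v 1)) := by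
  set g : EuclideanSpace ℝ (Fin 3) → Splitter := boundaryMap i ∘ unroll (splitterMonodromy i)
    with hg
  let u : EuclideanSpace ℝ (Fin 3) → Torus × ℝ := fun b => (planeToTorus (planePart b), b 2)
  have hgu : g = loopMap splitterRep i ∘ u := rfl
  have hu : ContMDiff (𝓡 3) torusBundleModel ∞ u :=
    (contMDiff_planeToTorus.comp planePart.contDiff.contMDiff).prodMk
      (EuclideanSpace.proj 2 : EuclideanSpace ℝ (Fin 3) →L[ℝ] ℝ).contDiff.contMDiff
  have hgs : ContMDiff (𝓡 3) (𝓡∂ 4) ∞ g := hgu ▸ (contMDiff_loopMap i).comp hu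
  obtain ⟨j, k, hc⟩ := exists_isAdapted_chartAt (g a)
  have hsrc := mem_chart_source (EuclideanHalfSpace 4) (g a)
  obtain ⟨hj, hk, -⟩ := hc _ hsrc
  obtain rfl : j = some i := by
    by_contra h
    exact collarRange_norm_ne h hj (norm_boundaryLoop_sub i (a 2))
  set M := splitterMatrix ((shift k (boundaryLoop i (a 2)))⁻¹ * loopLift i (a 2))
  set y : EuclideanSpace ℝ (Fin 3) → E4 := fun b => extChartAt (𝓡∂ 4) (g a) (g b) with hy
  have hys : ContDiffAt ℝ ∞ y a := by
    rw [← contMDiffAt_iff_contDiffAt]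
    exact ContMDiffAt.comp (I' := 𝓡∂ 4) a contMDiffAt_extChartAt hgs.contMDiffAt
  have hyd : HasFDerivAt y (fderiv ℝ y a) a := (hys.differentiableAt (by simp)).hasFDerivAt
  set D := fderiv ℝ y a
  have hS : HasFDerivAt (fun b => splitCoords (y b)) (splitCoords.toContinuousLinearMap ∘L D) a :=
    splitCoords.toContinuousLinearMap.hasFDerivAt.comp a hyd
  have hmodel : ∀ᶠ b in 𝓝 a, modelMap (some i) (y b) =
      (boundaryLoop i (b 2), planeToTorus (planeMap M (planePart b))) := by
    have h1 := hu.continuous.continuousAt.eventually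
      (eventually_coord_loopMap splitterRep (x := u a) hk)
    filter_upwards [h1, hgs.continuous.continuousAt.eventually
      ((chartAt (EuclideanHalfSpace 4) (g a)).open_source.mem_nhds hsrc)] with b hb1 hb2
    refine (hc _ hb2).2.2.trans (Prod.ext rfl ?_)
    rw [planeToTorus_planeMap]
    exact hb1
  let l : EuclideanSpace ℝ (Fin 3) →L[ℝ] ℂ := (EuclideanSpace.proj 2).smulRight
    (⟨0, -(collarSign i * (2 * Real.pi))⟩ : ℂ)
  have hl : ∀ b, l b = ⟨0, -(collarSign i * (2 * Real.pi * b 2))⟩ := fun b => by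
    apply Complex.ext
    · simp [l]
    · simp [l]; ring
  have e1 : ∀ v, (splitCoords (D v)).1 = l v := by
    -- the derivative of the collar coordinate only depends on its value
    have f1 : HasFDerivAt (fun b => collarMap (some i) (splitCoords (y b)).1) _ a :=
      HasFDerivAt.comp (g := collarMap (some i)) (f := fun b => (splitCoords (y b)).1) a
        ((hasDerivAt_collarMap_some i _).hasFDerivAt.restrictScalars ℝ) hS.fst
    have f2 : HasFDerivAt (fun b => collarMap (some i) (l b)) _ a :=
      HasFDerivAt.comp (g := collarMap (some i)) (f := l) a
        ((hasDerivAt_collarMap_some i _).hasFDerivAt.restrictScalars ℝ) l.hasFDerivAt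
    have hev : ∀ᶠ b in 𝓝 a, collarMap (some i) (splitCoords (y b)).1 = collarMap (some i) (l b) :=
      hmodel.mono fun b hb => by
        rw [hl, ← boundaryLoop_eq_collarMap]; exact congrArg Prod.fst hb
    have f3 := f1.unique (f2.congr_of_eventuallyEq hev)
    intro v
    have h1 := DFunLike.congr_fun f3 v
    rw [hev.self_of_nhds] at h1
    have h2 : (collarSign i : ℂ) * (collarMap (some i) (l a) - circleCenter i) ≠ 0 := by
      rw [hl, ← boundaryLoop_eq_collarMap]
      exact mul_ne_zero (Complex.ofReal_ne_zero.2 (collarSign_ne_zero i))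
        (boundaryLoop_sub_ne_zero i _)
    refine mul_right_cancel₀ h2 ?_
    simpa using h1
  have e2 : ∀ v, (splitCoords (D v)).2 = planeMap M (planePart v) := by
    have f2 : HasFDerivAt (fun b => planeMap M (planePart b)) _ a :=
      (planeMap M).hasFDerivAt.comp a planePart.hasFDerivAt
    have f3 := hS.snd.unique ((f2.add_const _).congr_of_eventuallyEq
      (eventually_sub_eq hS.snd.continuousAt f2.continuousAt
        (hmodel.mono fun b hb => congrArg Prod.snd hb)))
    intro v
    exact DFunLike.congr_fun f3 v
  refine ⟨M, fun v => ?_⟩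
  have hD : mfderiv (𝓡 3) (𝓡∂ 4) g a = D := by
    refine (hgs.contMDiffAt.mdifferentiableAt (by simp) :
      MDifferentiableAt (𝓡 3) (𝓡∂ 4) g a).mfderiv.trans ?_
    rw [ModelWithCorners.range_eq_univ]
    exact congrFun fderivWithin_univ a
  rw [hD]
  apply splitCoords.injective
  refine (Prod.ext ?_ ?_ : splitCoords (D v) = _).trans (splitCoords.apply_symm_apply _).symm
  · rw [e1, hl]
  · exact e2 v

theorem isOutward_iff {x : Splitter} {v : TangentSpace (𝓡∂ 4) x} :
    IsOutward x v ↔ (show E4 from v) 0 < 0 := by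
  have h : mfderiv (𝓡∂ 4) 𝓘(ℝ, E4) (extChartAt (𝓡∂ 4) x) x = tangentCoordChange (𝓡∂ 4) x x x :=
    (mdifferentiableAt_extChartAt (mem_chart_source _ x)).mfderiv
  have h2 : tangentCoordChange (𝓡∂ 4) x x x v = v :=
    tangentCoordChange_self (mem_extChartAt_source x)
  unfold IsOutward
  rw [h]
  change (tangentCoordChange (𝓡∂ 4) x x x v : E4) 0 < 0 ↔ _
  rw [h2]

/-- At the boundary circle `i` the parametrization matches the boundary orientation up to the sign
`collarSign i`. -/
theorem exists_boundary_basis (i : Fin 4) (a : EuclideanSpace ℝ (Fin 3)) (v : E4) (hv : v 0 < 0) :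
    ∃ e : Module.Basis (Fin 4) ℝ E4, e 0 = v ∧
      (∀ l : Fin 3, e l.succ = mfderiv (𝓡 3) (𝓡∂ 4) (boundaryMap i ∘ unroll (splitterMonodromy i)) a
        (EuclideanSpace.single l (1 : ℝ))) ∧
      0 < collarSign i * (EuclideanSpace.basisFun (Fin 4) ℝ).toBasis.det e := by
  obtain ⟨M, hM⟩ := exists_mfderiv_boundaryMap_unroll i a
  set D := mfderiv (𝓡 3) (𝓡∂ 4) (boundaryMap i ∘ unroll (splitterMonodromy i)) a
  let b : Fin 4 → E4 := Fin.cons v fun l => D (EuclideanSpace.single l (1 : ℝ))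
  have hMdet : (M.1 0 0 : ℝ) * M.1 1 1 - M.1 0 1 * M.1 1 0 = 1 := by
    have h := M.2
    rw [Matrix.det_fin_two] at h
    exact_mod_cast h
  have hdet : (EuclideanSpace.basisFun (Fin 4) ℝ).toBasis.det b = -(collarSign i * v 0) := by
    have h0 : b 0 = v := rfl
    have h1 : b 1 = !₂[0, 0, (M.1 0 0 : ℝ), (M.1 1 0 : ℝ)] := by
      refine (hM (EuclideanSpace.single 0 1)).trans ?_
      rw [splitCoords_symm_apply, planeMap_apply]
      simp
      rfl
    have h2 : b 2 = !₂[0, 0, (M.1 0 1 : ℝ), (M.1 1 1 : ℝ)] := by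
      refine (hM (EuclideanSpace.single 1 1)).trans ?_
      rw [splitCoords_symm_apply, planeMap_apply]
      simp
      rfl
    have h3 : b 3 = !₂[0, -collarSign i, 0, 0] := by
      refine (hM (EuclideanSpace.single 2 1)).trans ?_
      rw [splitCoords_symm_apply, planeMap_apply]
      simp
      field_simp
      rfl
    rw [Module.Basis.det_apply, Matrix.det_succ_row_zero, Fin.sum_univ_four]
    simp [Module.Basis.toMatrix_apply, h0, h1, h2, h3, Matrix.det_fin_three, Matrix.submatrix_apply,
      Fin.succAbove]
    linear_combination -(collarSign i * v 0) * hMdet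
  have hne : collarSign i * v 0 ≠ 0 := mul_ne_zero (collarSign_ne_zero i) hv.ne
  have hunit : IsUnit ((EuclideanSpace.basisFun (Fin 4) ℝ).toBasis.det b) := by
    rw [hdet]; exact (neg_ne_zero.2 hne).isUnit
  obtain ⟨h1, h2⟩ := (Module.Basis.is_basis_iff_det _).2 hunit
  refine ⟨Module.Basis.mk h1 h2.ge, ?_, fun l => ?_, ?_⟩
  · rw [Module.Basis.mk_apply]; rfl
  · rw [Module.Basis.mk_apply]; rfl
  · rw [Module.Basis.coe_mk, hdet, mul_neg, ← mul_assoc, collarSign_mul_self]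
    linarith

theorem preservesBoundaryOrientation_of_inner {i : Fin 4} (hi : collarSign i = 1) :
    PreservesBoundaryOrientation splitterOrientation.orient (boundaryMap i) := by
  intro a v hv
  obtain ⟨e, h1, h2, h3⟩ := exists_boundary_basis i a v (isOutward_iff.1 hv)
  refine ⟨e, h1, h2, ?_⟩
  rw [hi, one_mul] at h3
  exact ((Module.Basis.orientation_eq_iff_det_pos _ _).2 h3).symm

theorem preservesBoundaryOrientation_of_outer {i : Fin 4} (hi : collarSign i = -1) :
    PreservesBoundaryOrientation (fun x => -splitterOrientation.orient x) (boundaryMap i) := by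
  intro a v hv
  obtain ⟨e, h1, h2, h3⟩ := exists_boundary_basis i a v (isOutward_iff.1 hv)
  refine ⟨e, h1, h2, ?_⟩
  refine (Module.Basis.orientation_ne_iff_eq_neg (M := E4)
    (EuclideanSpace.basisFun (Fin 4) ℝ).toBasis e.orientation).1 fun h => ?_
  have h4 := (Module.Basis.orientation_eq_iff_det_pos
    (EuclideanSpace.basisFun (Fin 4) ℝ).toBasis e).1 h.symm
  rw [hi] at h3
  linarith

end BoundaryOrientation

end

/-! ### Existence of the splitter -/

theorem mainTheorem4 :
    matrixPhi = twistA * twistB * twistA ∧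
    ∃ (X : Type) (_ : TopologicalSpace X) (_ : ChartedSpace (EuclideanHalfSpace 4) X)
      (_ : IsManifold (𝓡∂ 4) ∞ X) (_ : T2Space X) (_ : SecondCountableTopology X)
      (_ : CompactSpace X)
      (o : ManifoldOrientation (𝓡∂ 4) X)
      (p : X → ℂ)
      (f : ∀ i : Fin 4, C(TorusBundle (splitterMonodromy i), X)),
      IsAspherical X ∧
      HasEulerCharacteristic X 0 ∧
      ParametrizesBoundary f ∧
      PreservesBoundaryOrientation o.orient (f 0) ∧
      PreservesBoundaryOrientation o.orient (f 1) ∧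
      PreservesBoundaryOrientation o.orient (f 2) ∧
      PreservesBoundaryOrientation (fun x => -o.orient x) (f 3) ∧
      (∀ i, IsPiOneInjective (f i)) ∧
      (∀ i, IsAspherical (TorusBundle (splitterMonodromy i))) ∧
      IsSmoothTorusFibration p threeHoledDisk ∧
      HasMonodromies p f := by
  exact ⟨matrixPhi_eq, Splitter, inferInstance, inferInstance, inferInstance, inferInstance,
    secondCountableTopology_splitter, inferInstance,
    splitterOrientation, fun x => (x.base : ℂ), boundaryMap,
    FlatBundle.isAspherical_torus _, FlatBundle.hasEulerCharacteristic_torus _,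
    parametrizesBoundary_boundaryMap,
    preservesBoundaryOrientation_of_inner rfl, preservesBoundaryOrientation_of_inner rfl,
    preservesBoundaryOrientation_of_inner rfl, preservesBoundaryOrientation_of_outer rfl,
    boundaryMap_isPiOneInjective, fun i => torusBundle_isAspherical _,
    isSmoothTorusFibration_base, hasMonodromies_boundaryMap⟩
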